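/- **Setting.** For a real constant $\mu$ and $f:\mathbb R^2\to\mathbb R$ supported in the closed unit disc, the exponential Radon transform is $T_\mu f(\theta,s)=\int_{x\cdot\theta=s}e^{\mu x\cdot\theta^\perp}f(x)\,dx$, $(\theta,s)\in Z=S^1\times[-1,1]$, where $\theta^\perp$ is $\theta$ rotated by a right angle. One observes $n$ i.i.d. triples $(\theta_i,s_i,Y_i)$ with $(\theta_i,s_i)$ uniform on $Z$ and $Y_i=T_\mu f(\theta_i,s_i)+\epsilon_i$, where $\epsilon_i\sim N(0,\sigma^2)$, $\sigma>0$, is independent of the design; $E_f$ is the corresponding expectation. Fix $x_0$ with $\|x_0\|<1$; an estimator $\hat f_n$ of $f(x_0)$ is a measurable function of the data (it is not allowed to depend on the unknown smoothness of $f$), and its risk is $E_f(\hat f_n-f(x_0))^2$. Fix $C,L>0$. $B(L)$ is the set of functions supported in the closed unit disc, continuous almost everywhere and bounded by $L$ in absolute value. For $\beta>1$, $H(\beta)=H(\beta,C)$ is the Sobolev ball $\int_{\mathbb R^2}(1+\|\xi\|^2)^\beta|\tilde f(\xi)|^2d\xi\le C$, $\tilde f(\xi)=\frac1{2\pi}\int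 e^{-ix\cdot\xi}f(x)\,dx$, whose elements are identified with their continuous representatives. An estimator $\hat f_n$ is minimax optimal on a class $\mathcal F$ if there are a positive sequence $\Psi_n\to0$ and constants $C_1,C_2>0$ with $C_1\Psi_n^2\le\inf_{T}\sup_{f\in\mathcal F}E_f(T-f(x_0))^2\le\sup_{f\in\mathcal F}E_f(\hat f_n-f(x_0))^2\le C_2\Psi_n^2$ for all large $n$, the infimum being over all estimators $T$ from $n$ observations. Let $B_n=\{\beta_1<\dots<\beta_{N_n}\}$ be finite sets of reals whose least element $\beta_1>1$ does not depend on $n$ and whose largest element $\beta_{N_n}$ tends to $\infty$. The points other than $\beta_1$ may depend on $n$; call the grids persistent if each $\beta$ that lies in some $B_m$ lies in $B_n$ for all large $n$ (for instance, if $B_n$ consists of the first $N_n$ terms of one fixed increasing sequence). A family of positive rates $\rho_{n,\beta}$ is attained by $\hat f_n$ if $$\limsup_{n\to\infty}\sup_{\beta\in B_n}\sup_{f\in H(\beta)\cap B(L)}\rho_{n,\beta}^{-2}E_f(\hat f_n-f(x_0))^2<\infty .$$ **Theorem.** 1. There is no optimally rate adaptive estimator: no estimator attains the minimax rates $\varphi_{n,\beta}=n^{-(\beta-1)/(2\beta+1)}$;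 and, if the grids are persistent, no estimator is minimax optimal on $H(\beta)\cap B(L)$ for every $\beta\in\bigcup_nB_n$ (with $\Psi_n$, $C_1$, $C_2$ allowed to depend on $\beta$). 2. $\psi_{n,\beta}=\left(\frac{\log n}{n}\right)^{\frac{\beta-1}{2\beta+1}}$ is the adaptive rate of convergence: (a) some estimator attains $\psi_{n,\beta}$; (b) if positive rates $\gamma_{n,\beta}$ are attained by some estimator and $\gamma_{n,\beta'}/\psi_{n,\beta'}\to0$ for some $\beta'$ that lies in $B_n$ for all large $n$, then there is $\beta''$, lying in $B_n$ for all large $n$, such that $$\frac{\gamma_{n,\beta'}}{\psi_{n,\beta'}}\cdot\frac{\gamma_{n,\beta''}}{\psi_{n,\beta''}}\to\infty .$$ Here $\beta''$ is a fixed number if the grids are persistent; otherwise it may depend on $n$. -/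

import Mathlib

open Real Set Filter Topology MeasureTheory ProbabilityTheory
open scoped ENNReal FourierTransform

noncomputable section

namespace ERT

/-- The Euclidean plane. -/
abbrev Plane : Type := EuclideanSpace ℝ (Fin 2)

/-- The point `θ` of the unit circle with polar angle `φ`. -/
def dir (φ : ℝ) : Plane := !₂[Real.cos φ, Real.sin φ]

/-- The unit vector `θ^⊥`: the rotation of `θ` by a right angle. -/
def dirPerp (φ : ℝ) : Plane := !₂[-Real.sin φ, Real.cos φ]

/-- The exponential Radon transform: the integral of `e^{μ x·θ^⊥} f(x)` over the line
`x·θ = s`, parametrized by arc length as `x = s θ + t θ^⊥`, so that `x·θ^⊥ = t`. -/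
def expRadon (μ : ℝ) (f : Plane → ℝ) (z : ℝ × ℝ) : ℝ :=
  ∫ t : ℝ, Real.exp (μ * t) * f (z.2 • dir z.1 + t • dirPerp z.1)

/-- The cylinder `S¹ × [-1,1]`, in the coordinates (polar angle of `θ`, `s`). -/
def obsCylinder : Set (ℝ × ℝ) := Ico 0 (2 * π) ×ˢ Icc (-1) 1

/-- The uniform distribution on the cylinder. -/
def design : Measure (ℝ × ℝ) := ProbabilityTheory.cond volume obsCylinder

/-- One observation `((θ, s), Y)`. -/
abbrev Obs : Type := (ℝ × ℝ) × ℝ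

/-- The law of one observation: `(θ, s)` is uniform on the cylinder and
`Y = T_μ f (θ, s) + ε`, with `ε ~ N(0, σ²)` independent of `(θ, s)`. -/
def obsLaw (μ σ : ℝ) (f : Plane → ℝ) : Measure Obs :=
  (design.prod (gaussianReal 0 (Real.toNNReal (σ ^ 2)))).map
    (fun w : (ℝ × ℝ) × ℝ => (w.1, expRadon μ f w.1 + w.2))

/-- The joint law of `n` independent observations. -/
def sampleLaw (μ σ : ℝ) (n : ℕ) (f : Plane → ℝ) : Measure (Fin n → Obs) :=
  Measure.pi (fun _ : Fin n => obsLaw μ σ f)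

/-- The estimators of the value `f(x₀)` from `n` observations: measurable functions of the data. -/
abbrev EstimatorAt (n : ℕ) : Type := {T : (Fin n → Obs) → ℝ // Measurable T}

/-- An estimator for every sample size. -/
abbrev Estimator : Type := (n : ℕ) → EstimatorAt n

/-- The pointwise mean squared error `E_f (T - f(x₀))²`. -/
def risk (μ σ : ℝ) (x₀ : Plane) {n : ℕ} (T : EstimatorAt n) (f : Plane → ℝ) : ℝ≥0∞ :=
  ∫⁻ d, ENNReal.ofReal ((T.1 d - f x₀) ^ 2) ∂(sampleLaw μ σ n f)

/-- The maximum risk of an estimator over a class `F` of functions. -/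
def maxRisk (μ σ : ℝ) (x₀ : Plane) (F : Set (Plane → ℝ)) {n : ℕ} (T : EstimatorAt n) : ℝ≥0∞ :=
  ⨆ f ∈ F, risk μ σ x₀ T f

/-- The minimax risk over a class `F` of functions. -/
def minimaxRisk (μ σ : ℝ) (x₀ : Plane) (F : Set (Plane → ℝ)) (n : ℕ) : ℝ≥0∞ :=
  ⨅ T : EstimatorAt n, maxRisk μ σ x₀ F T

/-- Minimax optimality of an estimator on a class `F`: its maximum risk and the minimax risk are
both of the order `Ψ_n²` (for large `n`), for some positive sequence `Ψ_n → 0`. -/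
def IsMinimaxOptimal (μ σ : ℝ) (x₀ : Plane) (F : Set (Plane → ℝ)) (T : Estimator) : Prop :=
  ∃ Ψ : ℕ → ℝ, (∀ n, 0 < Ψ n) ∧ Tendsto Ψ atTop (𝓝 0) ∧
    ∃ C₁ C₂ : ℝ, 0 < C₁ ∧ 0 < C₂ ∧ ∀ᶠ n in atTop,
      ENNReal.ofReal (C₁ * Ψ n ^ 2) ≤ minimaxRisk μ σ x₀ F n ∧
      maxRisk μ σ x₀ F (T n) ≤ ENNReal.ofReal (C₂ * Ψ n ^ 2)

/-- The class `B(L)`: functions supported in the closed unit disc, continuous almost everywhere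
and bounded by `L`. -/
def boundedClass (L : ℝ) : Set (Plane → ℝ) :=
  {f | tsupport f ⊆ Metric.closedBall 0 1 ∧ (∀ᵐ x, ContinuousAt f x) ∧ ∀ x, |f x| ≤ L}

/-- The unitary Fourier transform `(2π)⁻¹ ∫ e^{-i x·ξ} f(x) dx`, through Mathlib's transform
`𝓕 f (w) = ∫ e^{-2πi x·w} f(x) dx`. -/
def fourierU (f : Plane → ℝ) (ξ : Plane) : ℂ :=
  (((2 * π)⁻¹ : ℝ) : ℂ) * 𝓕 (fun x : Plane => (f x : ℂ)) ((2 * π)⁻¹ • ξ)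

/-- The Sobolev ball `H(β, C)`, for `β > 1`. By Sobolev embedding its elements are continuous
functions up to null sets; they are represented by the continuous representative, so that the
value at a point makes sense. -/
def sobolevBall (β C : ℝ) : Set (Plane → ℝ) :=
  {f | Continuous f ∧ Integrable f ∧
    ∫⁻ ξ : Plane, ENNReal.ofReal ((1 + ‖ξ‖ ^ 2) ^ β * ‖fourierU f ξ‖ ^ 2) ≤ ENNReal.ofReal C}

/-- The class `H(β, C) ∩ B(L)`. -/
def smoothClass (C L β : ℝ) : Set (Plane → ℝ) := sobolevBall β C ∩ boundedClass L

/-- The estimator `T` attains the rates `ρ_{n,β}` uniformly over the grids: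
`limsup_n sup_{β ∈ B_n} sup_{f ∈ H(β) ∩ B(L)} ρ_{n,β}^{-2} E_f (T_n - f(x₀))² < ∞`. -/
def AttainsRate (μ σ C L : ℝ) (x₀ : Plane) (B : ℕ → Finset ℝ) (ρ : ℕ → ℝ → ℝ)
    (T : Estimator) : Prop :=
  limsup (fun n : ℕ => ⨆ β ∈ B n, ⨆ f ∈ smoothClass C L β,
    ENNReal.ofReal ((ρ n β ^ 2)⁻¹) * risk μ σ x₀ (T n) f) atTop < ⊤

/-- Every smoothness that occurs in some grid stays in the grids from some sample size on. This is
the case when `B_n` consists of the first `N_n → ∞` terms of one fixed sequence. -/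
def IsPersistent (B : ℕ → Finset ℝ) : Prop :=
  ∀ m, ∀ b ∈ B m, ∀ᶠ n in atTop, b ∈ B n

/-- `ψ_{n,β}` is an adaptive rate of convergence on the classes `H(β) ∩ B(L)`, `β ∈ B_n`.
The smoothness `β''` at which a competing rate loses is a fixed number when the grids are
persistent; for grids whose points move with `n`, it is a point of `B_n` for each `n`. -/
def IsAdaptiveRate (μ σ C L : ℝ) (x₀ : Plane) (B : ℕ → Finset ℝ) (ψ : ℕ → ℝ → ℝ) : Prop :=
  (∃ T : Estimator, AttainsRate μ σ C L x₀ B ψ T) ∧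
  ∀ (γ : ℕ → ℝ → ℝ) (T : Estimator),
    (∀ n, ∀ β ∈ B n, 0 < γ n β) → AttainsRate μ σ C L x₀ B γ T →
    ∀ β' : ℝ, (∀ᶠ n in atTop, β' ∈ B n) →
      Tendsto (fun n => γ n β' / ψ n β') atTop (𝓝 0) →
      ∃ β'' : ℕ → ℝ, (∀ᶠ n in atTop, β'' n ∈ B n) ∧
        (IsPersistent B → ∃ b, ∀ n, β'' n = b) ∧
        Tendsto (fun n => γ n β' / ψ n β' * (γ n (β'' n) / ψ n (β'' n))) atTop atTop

/-- The minimax rate `n^{-(β-1)/(2β+1)}` for known smoothness `β`. -/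
def minimaxRate (n : ℕ) (β : ℝ) : ℝ := (n : ℝ) ^ (-((β - 1) / (2 * β + 1)))

/-- The rate `(log n / n)^{(β-1)/(2β+1)}`. -/
def logRate (n : ℕ) (β : ℝ) : ℝ := (Real.log n / n) ^ ((β - 1) / (2 * β + 1))

end ERT

end

/-!
The proof has an upper bound (an estimator that adapts to the smoothness at the price of a
logarithm) and a lower bound (a trade-off between the risk at the zero function and the maximum
risk over a smoothness class).

**Inversion.** The exponential Radon transform is inverted up to a frequency cut-off `R` by
integration against a weight on the cylinder, namely `weight μ x₀ R (φ, s) = 4π e^{-μ x₀·θ^⊥}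
k_R(x₀·θ - s)`, where `k_R` is the filter `∫_0^R ρ cos(√((2πρ)² + μ²) s) dρ`. That `∫ weight · T_μ
f` equals the part of `f(x₀)` carried by the frequencies of norm at most `R`
(`integral_weight_mul_expRadon`) comes down to the identity `integral_circle_exp_mul_cos`: the
circular mean of `e^{-m z·θ^⊥} cos(√(r² + m²) z·θ)` does not depend on `m`, because its
`m`-derivative is the mean of an angular derivative. The weight has second moment `O(R³)` under
the design and is `O(R²)`; the frequencies beyond `R` contribute `O(R^{-(β-1)})` on the Sobolev
ball, uniformly for `β ≥ β₁` (`tailMass_le`).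

**Upper bounds.** The linear estimator `n⁻¹ ∑ weight(θ_i, s_i) Y_i` estimates the low-pass part of
`f(x₀)` without bias, and its exponential moments are of sub-Gaussian type in the range needed
(`lintegral_excess_sq_le`). The cut-off `n^{1/(2β+1)}` gives the bound `minimaxRisk_le` for the
minimax risk at known smoothness. For adaptation, the increments of these estimators between
dyadic cut-offs are soft-thresholded at `√(log n)` times their noise level and added up. The error
of one thresholded increment is at most the minimum of the increment of the signal and twice the
threshold, plus an excess of the noise with negligible second moment; splitting the sum at the
cut-off `(n / log n)^{1/(2β+1)}` yields the rate `logRate` for all `β ≥ β₁` at once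
(`risk_adaptiveEst_le_logRate`).

**Lower bound.** A bump `a h^{β-1} g((x - x₀)/h)` lies in the class of smoothness `β`, and its
exponential Radon transform is `O(h^β)` and lives in a strip of width `2h`, so the likelihood
ratio of the sample against the zero function has second moment at most `e^{O(n h^{2β+1})}`. The
Cauchy-Schwarz inequality (the constrained risk inequality of Brown and Low,
`apply_le_of_risk_le`) gives, for every `h`, the trade-off `exists_tradeoff`: `a h^{β-1} ≤ A₁ + A₀
e^{c n h^{2β+1}}`, where `A₁²` bounds the risk over the class and `A₀²` the risk at zero. The zero
function lies in all classes. At `h = n^{-1/(2β+1)}` the trade-off bounds `A₁` below by the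
minimax rate; at `h = (κ log n / n)^{1/(2β+1)}` it shows that an estimator beating `logRate` at
`β'` has a risk at zero with `A₀ ≥ logRate n β' · n^{-cκ}` up to a constant. For `κ` small this
exceeds `logRate n β''`, for `β'' ≥ β' + 1`, by a power of `n`, which no power of `log n`
compensates (`tendsto_div_logRate_mul_div_logRate`). Both negative statements on optimal
adaptation follow, since `minimaxRate` beats `logRate` by a power of `log n` at every smoothness.
-/

noncomputable section

namespace ERT

/-! ### Rotated frames, polar coordinates and the design measure -/

section

@[fun_prop]
lemma continuous_dir : Continuous dir := by
  unfold dir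
  exact (PiLp.continuous_toLp 2 _).comp (by fun_prop)

@[fun_prop]
lemma continuous_dirPerp : Continuous dirPerp := by
  unfold dirPerp
  exact (PiLp.continuous_toLp 2 _).comp (by fun_prop)

lemma inner_dir (φ : ℝ) (z : Plane) :
    inner ℝ (dir φ) z = Real.cos φ * z 0 + Real.sin φ * z 1 := by
  simp [dir, PiLp.inner_apply, Fin.sum_univ_two, mul_comm]

lemma inner_dirPerp (φ : ℝ) (z : Plane) :
    inner ℝ (dirPerp φ) z = -Real.sin φ * z 0 + Real.cos φ * z 1 := by
  simp [dirPerp, PiLp.inner_apply, Fin.sum_univ_two, mul_comm]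

lemma norm_dir (φ : ℝ) : ‖dir φ‖ = 1 := by
  simp [dir, EuclideanSpace.norm_eq, Fin.sum_univ_two]

lemma norm_dirPerp (φ : ℝ) : ‖dirPerp φ‖ = 1 := by
  simp [dirPerp, EuclideanSpace.norm_eq, Fin.sum_univ_two]

lemma inner_dir_dirPerp (φ : ℝ) : inner ℝ (dir φ) (dirPerp φ) = 0 := by
  rw [inner_dir]; simp [dirPerp]; ring

lemma inner_dir_frame (φ s t : ℝ) : inner ℝ (dir φ) (s • dir φ + t • dirPerp φ) = s := by
  simp [inner_add_right, inner_smul_right, inner_dir_dirPerp, norm_dir]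

lemma inner_dirPerp_frame (φ s t : ℝ) :
    inner ℝ (dirPerp φ) (s • dir φ + t • dirPerp φ) = t := by
  rw [inner_add_right, inner_smul_right, inner_smul_right, real_inner_comm, inner_dir_dirPerp]
  simp [norm_dirPerp]

lemma abs_inner_dir_le (φ : ℝ) (z : Plane) : |inner ℝ (dir φ) z| ≤ ‖z‖ := by
  simpa [norm_dir] using abs_real_inner_le_norm (dir φ) z

lemma abs_inner_dirPerp_le (φ : ℝ) (z : Plane) : |inner ℝ (dirPerp φ) z| ≤ ‖z‖ := by
  simpa [norm_dirPerp] using abs_real_inner_le_norm (dirPerp φ) z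

lemma abs_le_norm_frame (φ s t : ℝ) : |s| ≤ ‖s • dir φ + t • dirPerp φ‖ := by
  simpa [inner_dir_frame] using abs_inner_dir_le φ (s • dir φ + t • dirPerp φ)

lemma abs_le_norm_frame' (φ s t : ℝ) : |t| ≤ ‖s • dir φ + t • dirPerp φ‖ := by
  simpa [inner_dirPerp_frame] using abs_inner_dirPerp_le φ (s • dir φ + t • dirPerp φ)

lemma orthonormal_frame (φ : ℝ) : Orthonormal ℝ ![dir φ, dirPerp φ] := by
  constructor
  · intro i; fin_cases i <;> simp [norm_dir, norm_dirPerp]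
  · intro i j hij
    fin_cases i <;> fin_cases j <;> simp_all [inner_dir_dirPerp, real_inner_comm]

/-- The coordinates `(t₁, t₂) ↦ t₁ e₁ + t₂ e₂` of the plane preserve the volume. -/
lemma measurePreserving_plane :
    MeasurePreserving (fun p : ℝ × ℝ => (!₂[p.1, p.2] : Plane)) volume volume :=
  (PiLp.volume_preserving_toLp (Fin 2)).comp (volume_preserving_finTwoArrow ℝ).symm

lemma measurableEmbedding_plane :
    MeasurableEmbedding (fun p : ℝ × ℝ => (!₂[p.1, p.2] : Plane)) :=
  (MeasurableEquiv.toLp 2 (Fin 2 → ℝ)).measurableEmbedding.comp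
    (MeasurableEquiv.finTwoArrow (α := ℝ)).symm.measurableEmbedding

/-- The orthonormal coordinates `(s, t) ↦ s θ + t θ^⊥` preserve the volume. -/
lemma measurePreserving_frame (φ : ℝ) :
    MeasurePreserving (fun p : ℝ × ℝ => p.1 • dir φ + p.2 • dirPerp φ) volume volume := by
  let b := (basisOfOrthonormalOfCardEqFinrank (orthonormal_frame φ) (by simp)).toOrthonormalBasis
    (by simpa using orthonormal_frame φ)
  have h := b.measurePreserving_repr_symm.comp measurePreserving_plane
  refine ⟨by fun_prop, ?_⟩
  rw [← h.map_eq]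
  congr 1
  ext1 p
  simp [b, Fin.sum_univ_two]

lemma measurableEmbedding_frame (φ : ℝ) :
    MeasurableEmbedding (fun p : ℝ × ℝ => p.1 • dir φ + p.2 • dirPerp φ) := by
  refine Continuous.measurableEmbedding (by fun_prop) ?_
  intro p q h
  have h1 := congrArg (inner ℝ (dir φ)) h
  have h2 := congrArg (inner ℝ (dirPerp φ)) h
  simp only [inner_dir_frame, inner_dirPerp_frame] at h1 h2
  exact Prod.ext h1 h2

/-- Mathlib's polar coordinates `(r, φ)` of the plane give the point `r • dir φ`. -/
lemma polarCoord_symm_plane (p : ℝ × ℝ) :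
    (!₂[(polarCoord.symm p).1, (polarCoord.symm p).2] : Plane) = p.1 • dir p.2 := by
  ext i; fin_cases i <;> simp [dir, polarCoord]

/-- Polar coordinates in the plane for lower integrals. -/
lemma lintegral_polar {F : Plane → ℝ≥0∞} (hF : Measurable F) :
    ∫⁻ w, F w = ∫⁻ r in Ioi (0 : ℝ), ∫⁻ φ in Ioo (-π) π, ENNReal.ofReal r * F (r • dir φ) := by
  rw [← measurePreserving_plane.lintegral_comp_emb measurableEmbedding_plane,
    ← lintegral_comp_polarCoord_symm, polarCoord_target, Measure.volume_eq_prod]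
  simp only [polarCoord_symm_plane, smul_eq_mul]
  rw [setLIntegral_prod]
  refine Measurable.aemeasurable ?_
  have : Measurable fun p : ℝ × ℝ => p.1 • dir p.2 := by
    exact Continuous.measurable (by fun_prop)
  exact (by fun_prop : Measurable fun p : ℝ × ℝ => ENNReal.ofReal p.1).mul (hF.comp this)

lemma norm_smul_dir {r : ℝ} (hr : 0 ≤ r) (φ : ℝ) : ‖r • dir φ‖ = r := by
  rw [norm_smul, norm_dir, mul_one, Real.norm_of_nonneg hr]

/-- Polar coordinates for integrals over a centred disc. -/
lemma setIntegral_ball_polar {F : Plane → ℝ} (hF : Continuous F) {R : ℝ} (hR : 0 ≤ R) :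
    ∫ w in Metric.closedBall (0 : Plane) R, F w =
      ∫ r in (0)..R, ∫ φ in (-π)..π, r * F (r • dir φ) := by
  rw [← integral_indicator measurableSet_closedBall,
    ← measurePreserving_plane.integral_comp measurableEmbedding_plane,
    ← integral_comp_polarCoord_symm, polarCoord_target, Measure.volume_eq_prod]
  simp only [polarCoord_symm_plane, smul_eq_mul]
  have hsub : Ioc 0 R ×ˢ Ioo (-π) π ⊆ Ioi (0 : ℝ) ×ˢ Ioo (-π) π :=
    prod_mono Ioc_subset_Ioi_self subset_rfl
  rw [setIntegral_eq_of_subset_of_forall_sdiff_eq_zero (s := Ioc 0 R ×ˢ Ioo (-π) π)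
    (measurableSet_Ioi.prod measurableSet_Ioo) hsub,
    setIntegral_congr_fun (g := fun p : ℝ × ℝ => p.1 * F (p.1 • dir p.2))
    (measurableSet_Ioc.prod measurableSet_Ioo), setIntegral_prod,
    intervalIntegral.integral_of_le hR]
  · refine setIntegral_congr_fun measurableSet_Ioc fun r _ => ?_
    rw [intervalIntegral.integral_of_le (by linarith [Real.pi_pos]), integral_Ioc_eq_integral_Ioo]
  · rw [← Measure.volume_eq_prod]
    refine IntegrableOn.mono_set (t := Icc 0 R ×ˢ Icc (-π) π) ?_
      (prod_mono Ioc_subset_Icc_self Ioo_subset_Icc_self)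
    exact ContinuousOn.integrableOn_compact (isCompact_Icc.prod isCompact_Icc)
      (by fun_prop)
  · rintro ⟨r, φ⟩ ⟨hr, -⟩
    simp only [mem_Ioc] at hr
    simp only
    rw [indicator_of_mem]
    simpa [norm_smul_dir hr.1.le] using hr.2
  · rintro ⟨r, φ⟩ ⟨⟨hr, hφ⟩, hn⟩
    have hr0 : 0 < r := hr
    have : ¬ r ≤ R := fun h => hn ⟨⟨hr0, h⟩, hφ⟩
    simp only
    rw [indicator_of_notMem, mul_zero]
    simpa [norm_smul_dir hr0.le] using this

/-! ### The design -/

lemma volume_obsCylinder : volume obsCylinder = ENNReal.ofReal (4 * π) := by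
  rw [obsCylinder, Measure.volume_eq_prod, Measure.prod_prod, Real.volume_Ico, Real.volume_Icc,
    ← ENNReal.ofReal_mul (by linarith [Real.pi_pos])]
  congr 1; ring

lemma volume_obsCylinder_ne_zero : volume obsCylinder ≠ 0 := by
  rw [volume_obsCylinder]; simp [Real.pi_pos]

lemma volume_obsCylinder_ne_top : volume obsCylinder ≠ ⊤ := by
  rw [volume_obsCylinder]; exact ENNReal.ofReal_ne_top

instance : IsProbabilityMeasure design :=
  cond_isProbabilityMeasure_of_finite volume_obsCylinder_ne_zero volume_obsCylinder_ne_top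

lemma design_eq : design = (ENNReal.ofReal (4 * π))⁻¹ • volume.restrict obsCylinder := by
  rw [design, ProbabilityTheory.cond, volume_obsCylinder]

lemma integral_design (g : ℝ × ℝ → ℝ) :
    ∫ z, g z ∂design = (4 * π)⁻¹ * ∫ z in obsCylinder, g z := by
  rw [design_eq, integral_smul_measure, smul_eq_mul, ENNReal.toReal_inv,
    ENNReal.toReal_ofReal (by positivity)]

lemma integral_design_iterated {g : ℝ × ℝ → ℝ} (hg : IntegrableOn g obsCylinder) :
    ∫ z, g z ∂design = (4 * π)⁻¹ * ∫ φ in Ico 0 (2 * π), ∫ s in Icc (-1 : ℝ) 1, g (φ, s) := by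
  rw [integral_design, obsCylinder, Measure.volume_eq_prod, setIntegral_prod]
  rwa [← Measure.volume_eq_prod]

/-! ### The exponential Radon transform -/

/-- The functions to which the Radon transform is applied: continuous and supported in the closed
unit disc. -/
structure IsDiscFunction (f : Plane → ℝ) : Prop where
  continuous : Continuous f
  support : ∀ x, 1 < ‖x‖ → f x = 0

lemma IsDiscFunction.hasCompactSupport {f : Plane → ℝ} (hf : IsDiscFunction f) :
    HasCompactSupport f :=
  HasCompactSupport.intro (isCompact_closedBall 0 1) fun x hx => hf.support x (by simpa using hx)

lemma IsDiscFunction.integrable {f : Plane → ℝ} (hf : IsDiscFunction f) : Integrable f :=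
  hf.continuous.integrable_of_hasCompactSupport hf.hasCompactSupport

lemma isDiscFunction_zero : IsDiscFunction 0 := ⟨continuous_zero, fun _ _ => rfl⟩

variable {f : Plane → ℝ} {μ : ℝ}

lemma expRadon_zero : expRadon μ 0 = 0 := by
  ext z; simp [expRadon]

lemma expRadon_eq_setIntegral (hf : IsDiscFunction f) (z : ℝ × ℝ) :
    expRadon μ f z =
      ∫ t in Icc (-1 : ℝ) 1, Real.exp (μ * t) * f (z.2 • dir z.1 + t • dirPerp z.1) := by
  rw [expRadon, setIntegral_eq_integral_of_forall_compl_eq_zero]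
  intro t ht
  rw [hf.support, mul_zero]
  refine lt_of_lt_of_le ?_ (abs_le_norm_frame' z.1 z.2 t)
  rw [mem_Icc, ← abs_le] at ht
  exact not_le.1 ht

lemma expRadon_eq_zero (hf : IsDiscFunction f) {z : ℝ × ℝ} (hz : 1 < |z.2|) :
    expRadon μ f z = 0 := by
  rw [expRadon, integral_eq_zero_of_ae]
  filter_upwards with t
  rw [hf.support _ (hz.trans_le (abs_le_norm_frame _ _ _))]
  simp

lemma abs_expRadon_le {L : ℝ} (hf : IsDiscFunction f) (hL : ∀ x, |f x| ≤ L) (z : ℝ × ℝ) :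
    |expRadon μ f z| ≤ 2 * (Real.exp |μ| * L) := by
  rw [expRadon_eq_setIntegral hf]
  have h0 : 0 ≤ L := (abs_nonneg _).trans (hL 0)
  have hb : ∀ t ∈ Icc (-1 : ℝ) 1,
      ‖Real.exp (μ * t) * f (z.2 • dir z.1 + t • dirPerp z.1)‖ ≤ Real.exp |μ| * L := by
    intro t ht
    rw [mem_Icc, ← abs_le] at ht
    rw [norm_mul, Real.norm_of_nonneg (Real.exp_pos _).le]
    gcongr
    · refine (le_abs_self _).trans ?_
      rw [abs_mul]; nlinarith [abs_nonneg μ]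
    · exact hL _
  refine (norm_setIntegral_le_of_norm_le_const measure_Icc_lt_top hb).trans ?_
  rw [Measure.real, Real.volume_Icc, ENNReal.toReal_ofReal (by norm_num)]
  linarith

lemma continuous_expRadon (hf : IsDiscFunction f) : Continuous (expRadon μ f) := by
  have : expRadon μ f = fun z : ℝ × ℝ =>
      ∫ t in Icc (-1 : ℝ) 1, Real.exp (μ * t) * f (z.2 • dir z.1 + t • dirPerp z.1) := by
    ext z; exact expRadon_eq_setIntegral hf z
  rw [this]
  have hc := hf.continuous
  exact continuous_parametric_integral_of_continuous (by fun_prop) isCompact_Icc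

/-- Integration of the Radon transform at angle `φ` against a function of `s`: the lines
`x·θ = s` sweep out the plane. -/
lemma integral_mul_expRadon (hf : IsDiscFunction f) (φ : ℝ) {u : ℝ → ℝ} (hu : Continuous u) :
    ∫ s in Icc (-1 : ℝ) 1, u s * expRadon μ f (φ, s) =
      ∫ y : Plane, u (inner ℝ (dir φ) y) * (Real.exp (μ * inner ℝ (dirPerp φ) y) * f y) := by
  have hc := hf.continuous
  have hcs : HasCompactSupport fun y : Plane =>
      u (inner ℝ (dir φ) y) * (Real.exp (μ * inner ℝ (dirPerp φ) y) * f y) :=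
    (hf.hasCompactSupport.mul_left).mul_left
  have hint := Continuous.integrable_of_hasCompactSupport (μ := volume) (by fun_prop) hcs
  rw [setIntegral_eq_integral_of_forall_compl_eq_zero,
    ← (measurePreserving_frame φ).integral_comp (measurableEmbedding_frame φ),
    Measure.volume_eq_prod, integral_prod]
  · refine integral_congr_ae (.of_forall fun s => ?_)
    simp only [inner_dir_frame, inner_dirPerp_frame, expRadon]
    rw [integral_const_mul]
  · rw [← Measure.volume_eq_prod]
    exact ((measurePreserving_frame φ).integrable_comp_emb (measurableEmbedding_frame φ)).2 hint
  · intro s hs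
    rw [expRadon_eq_zero hf, mul_zero]
    rw [mem_Icc, ← abs_le] at hs
    exact not_le.1 hs

end

/-! ### The filter of the inversion formula -/

/-- The shifted frequency `√((2πρ)² + μ²)`. -/
def shiftFreq (μ ρ : ℝ) : ℝ := Real.sqrt ((2 * π * ρ) ^ 2 + μ ^ 2)

/-- The filter of the inversion formula for the exponential Radon transform, with frequencies cut
off at `R`. Frequencies below `|μ|` do not occur, as `√((2πρ)² + μ²) ≥ |μ|`. -/
def filterKernel (μ R s : ℝ) : ℝ := ∫ ρ in (0)..R, ρ * Real.cos (shiftFreq μ ρ * s)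

@[fun_prop]
lemma continuous_shiftFreq (μ : ℝ) : Continuous (shiftFreq μ) := by
  unfold shiftFreq; fun_prop

@[fun_prop]
lemma continuous_filterKernel (μ R : ℝ) : Continuous (filterKernel μ R) := by
  unfold filterKernel
  exact intervalIntegral.continuous_parametric_intervalIntegral_of_continuous' (by fun_prop) _ _

lemma shiftFreq_pos (μ : ℝ) {ρ : ℝ} (hρ : 0 < ρ) : 0 < shiftFreq μ ρ :=
  Real.sqrt_pos.2 (by positivity)

lemma shiftFreq_le {μ R : ℝ} (hR : 1 ≤ R) : shiftFreq μ R ≤ (2 * π + |μ|) * R := by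
  refine Real.sqrt_le_iff.2 ⟨by positivity, ?_⟩
  have h1 : |μ| ≤ |μ| * R := le_mul_of_one_le_right (abs_nonneg _) hR
  have h2 : μ ^ 2 ≤ (|μ| * R) ^ 2 := by rw [← sq_abs]; gcongr
  have h3 : 0 ≤ 2 * π * R * (|μ| * R) := by positivity
  nlinarith

lemma shiftFreq_mono {μ a b : ℝ} (ha : 0 ≤ a) (hab : a ≤ b) : shiftFreq μ a ≤ shiftFreq μ b := by
  unfold shiftFreq; gcongr

lemma filterKernel_zero (μ s : ℝ) : filterKernel μ 0 s = 0 := by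
  simp [filterKernel]

lemma abs_filterKernel_le {μ R : ℝ} (hR : 0 ≤ R) (s : ℝ) : |filterKernel μ R s| ≤ R ^ 2 := by
  have : ∀ ρ ∈ uIoc 0 R, ‖ρ * Real.cos (shiftFreq μ ρ * s)‖ ≤ R := by
    intro ρ hρ
    rw [uIoc_of_le hR] at hρ
    rw [norm_mul, Real.norm_of_nonneg hρ.1.le]
    calc ρ * ‖Real.cos (shiftFreq μ ρ * s)‖ ≤ R * 1 := by
          gcongr
          · exact hρ.2
          · exact Real.abs_cos_le_one _
      _ = R := mul_one R
  refine (intervalIntegral.norm_integral_le_of_norm_le_const this).trans ?_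
  rw [sub_zero, abs_of_nonneg hR, sq]

lemma hasDerivAt_shiftFreq (μ : ℝ) {ρ : ℝ} (hρ : 0 < ρ) :
    HasDerivAt (shiftFreq μ) ((2 * π) ^ 2 * ρ / shiftFreq μ ρ) ρ := by
  have h : HasDerivAt (fun ρ : ℝ => (2 * π * ρ) ^ 2 + μ ^ 2) (2 * (2 * π * ρ) * (2 * π)) ρ := by
    have := (((hasDerivAt_id ρ).const_mul (2 * π)).pow 2).add_const (μ ^ 2)
    simpa using this
  refine HasDerivAt.congr_deriv (h.sqrt (by positivity)) ?_
  have := (shiftFreq_pos μ hρ).ne'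
  rw [show Real.sqrt ((2 * π * ρ) ^ 2 + μ ^ 2) = shiftFreq μ ρ from rfl]
  field_simp

/-- Integration by parts in the frequency gives the decay of the filter. -/
lemma abs_mul_filterKernel_le {μ R : ℝ} (hR : 0 ≤ R) (s : ℝ) :
    |s * filterKernel μ R s| ≤ shiftFreq μ R := by
  rcases eq_or_ne s 0 with rfl | hs
  · simp [shiftFreq]
  set b := shiftFreq μ R
  set a := shiftFreq μ 0
  have ha : 0 ≤ a := Real.sqrt_nonneg _
  have hab : a ≤ b := shiftFreq_mono le_rfl hR
  have key : filterKernel μ R s = ((2 * π) ^ 2)⁻¹ *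
      (b * Real.sin (b * s) / s + Real.cos (b * s) / s ^ 2
        - (a * Real.sin (a * s) / s + Real.cos (a * s) / s ^ 2)) := by
    have := intervalIntegral.integral_eq_sub_of_hasDerivAt_of_le (a := 0) (b := R)
      (f := fun ρ => ((2 * π) ^ 2)⁻¹ * (shiftFreq μ ρ * Real.sin (shiftFreq μ ρ * s) / s
        + Real.cos (shiftFreq μ ρ * s) / s ^ 2))
      (f' := fun ρ => ρ * Real.cos (shiftFreq μ ρ * s)) hR (by fun_prop) ?_
      ((by fun_prop : Continuous fun ρ => ρ * Real.cos (shiftFreq μ ρ * s)).intervalIntegrable _ _)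
    · rw [filterKernel, this]; ring
    · intro ρ hρ
      have h1 := hasDerivAt_shiftFreq μ hρ.1
      have h0 := (shiftFreq_pos μ hρ.1).ne'
      have h2 := h1.mul_const s
      have h3 := ((h1.mul h2.sin).div_const s).add (h2.cos.div_const (s ^ 2))
      refine HasDerivAt.congr_deriv (h3.const_mul ((2 * π) ^ 2)⁻¹) ?_
      field_simp
      ring
  have hcos : |Real.cos (b * s) - Real.cos (a * s)| ≤ (b - a) * |s| := by
    rw [← abs_of_nonneg (sub_nonneg.2 hab), ← abs_mul, sub_mul]
    exact Real.abs_cos_sub_cos_le _ _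
  have h4 : (2 * π) ^ 2 * (s * filterKernel μ R s) = b * Real.sin (b * s) - a * Real.sin (a * s)
      + (Real.cos (b * s) - Real.cos (a * s)) / s := by
    rw [key]; field_simp; ring
  have h5 : (2 * π) ^ 2 * |s * filterKernel μ R s| ≤ 2 * b := by
    rw [← abs_of_nonneg (by positivity : 0 ≤ (2 * π) ^ 2), ← abs_mul, h4]
    have e1 : |b * Real.sin (b * s)| ≤ b := by
      rw [abs_mul, abs_of_nonneg (ha.trans hab)]
      exact mul_le_of_le_one_right (ha.trans hab) (Real.abs_sin_le_one _)
    have e2 : |a * Real.sin (a * s)| ≤ a := by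
      rw [abs_mul, abs_of_nonneg ha]
      exact mul_le_of_le_one_right ha (Real.abs_sin_le_one _)
    have e3 : |(Real.cos (b * s) - Real.cos (a * s)) / s| ≤ b - a := by
      rw [abs_div, div_le_iff₀ (abs_pos.2 hs)]; exact hcos
    refine (abs_add_le _ _).trans ?_
    have := abs_sub (b * Real.sin (b * s)) (a * Real.sin (a * s))
    linarith
  have hpi : (2 : ℝ) ≤ (2 * π) ^ 2 := by nlinarith [Real.pi_gt_three]
  nlinarith [abs_nonneg (s * filterKernel μ R s)]

/-- Pointwise bound on the filter: `O(R²)` near the origin, `O(R / |s|)` away from it. -/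
lemma filterKernel_sq_le {μ R : ℝ} (hR : 1 ≤ R) (s : ℝ) :
    filterKernel μ R s ^ 2 ≤ (1 + (2 * π + |μ|) ^ 2) * R ^ 4 * (1 + (R * s) ^ 2)⁻¹ := by
  have h0 : 0 ≤ R := by linarith
  have h1 : filterKernel μ R s ^ 2 ≤ R ^ 4 := by
    have h := abs_filterKernel_le h0 s (μ := μ)
    have := sq_le_sq' (by linarith [neg_abs_le (filterKernel μ R s)]) ((le_abs_self _).trans h)
    calc _ ≤ _ := this
      _ = R ^ 4 := by ring
  have h2 : (s * filterKernel μ R s) ^ 2 ≤ ((2 * π + |μ|) * R) ^ 2 := by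
    rw [← sq_abs]
    gcongr
    exact (abs_mul_filterKernel_le h0 s).trans (shiftFreq_le hR)
  rw [← div_eq_mul_inv, le_div_iff₀ (by positivity)]
  have h3 : R ^ 2 * (s * filterKernel μ R s) ^ 2 ≤ R ^ 2 * ((2 * π + |μ|) * R) ^ 2 := by gcongr
  nlinarith

/-! ### The inversion identity -/

lemma hasDerivAt_inner_dir (z : Plane) (φ : ℝ) :
    HasDerivAt (fun φ => (inner ℝ (dir φ) z : ℝ)) (inner ℝ (dirPerp φ) z) φ := by
  simp only [inner_dir, inner_dirPerp]
  exact ((Real.hasDerivAt_cos φ).mul_const _).add ((Real.hasDerivAt_sin φ).mul_const _)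

lemma hasDerivAt_inner_dirPerp (z : Plane) (φ : ℝ) :
    HasDerivAt (fun φ => (inner ℝ (dirPerp φ) z : ℝ)) (-inner ℝ (dir φ) z) φ := by
  simp only [inner_dir, inner_dirPerp]
  refine HasDerivAt.congr_deriv (((Real.hasDerivAt_sin φ).neg.mul_const (z 0)).add
    ((Real.hasDerivAt_cos φ).mul_const (z 1))) ?_
  ring

lemma dir_add_two_pi (φ : ℝ) : dir (φ + 2 * π) = dir φ := by simp [dir]

lemma dirPerp_add_two_pi (φ : ℝ) : dirPerp (φ + 2 * π) = dirPerp φ := by simp [dirPerp]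

/-- The circular mean of `e^{-m z·θ^⊥} cos(√(r² + m²) z·θ)` does not depend on `m`: its derivative
in `m` is the mean of a derivative in the angle. This is what replaces the projection theorem of
the classical Radon transform. -/
lemma integral_circle_exp_mul_cos (z : Plane) {r : ℝ} (hr : 0 < r) (m : ℝ) :
    ∫ φ in (-π)..π, Real.exp (-m * inner ℝ (dirPerp φ) z) *
        Real.cos (Real.sqrt (r ^ 2 + m ^ 2) * inner ℝ (dir φ) z) =
      ∫ φ in (-π)..π, Real.cos (r * inner ℝ (dir φ) z) := by
  set A : ℝ → ℝ := fun φ => inner ℝ (dir φ) z with hA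
  set B : ℝ → ℝ := fun φ => inner ℝ (dirPerp φ) z with hB
  set q : ℝ → ℝ := fun m => Real.sqrt (r ^ 2 + m ^ 2) with hq
  have hAc : Continuous A := by fun_prop
  have hBc : Continuous B := by fun_prop
  have hqc : Continuous q := by fun_prop
  have hq0 : ∀ m, 0 < q m := fun m => Real.sqrt_pos.2 (by positivity)
  let F : ℝ → ℝ → ℝ := fun m φ => Real.exp (-m * B φ) * Real.cos (q m * A φ)
  let F' : ℝ → ℝ → ℝ := fun m φ => -(q m)⁻¹ *
    (m * A φ * Real.exp (-m * B φ) * Real.sin (q m * A φ)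
      + q m * B φ * Real.exp (-m * B φ) * Real.cos (q m * A φ))
  have hFd : ∀ m φ, HasDerivAt (fun m => F m φ) (F' m φ) m := by
    intro m φ
    have h1 : HasDerivAt q (m / q m) m := by
      have h : HasDerivAt (fun m : ℝ => r ^ 2 + m ^ 2) (2 * m) m := by
        simpa using ((hasDerivAt_id m).pow 2).const_add (r ^ 2)
      refine HasDerivAt.congr_deriv (h.sqrt (by positivity)) ?_
      simp only [hq]; field_simp
    have h2 := ((hasDerivAt_id m).neg.mul_const (B φ)).exp.mul (h1.mul_const (A φ)).cos
    refine HasDerivAt.congr_deriv h2 ?_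
    simp only [F', id, Pi.neg_apply]
    have := (hq0 m).ne'
    field_simp
    ring
  have hF'c : Continuous (Function.uncurry F') := by
    have : ∀ p : ℝ × ℝ, q p.1 ≠ 0 := fun p => (hq0 _).ne'
    simp only [F', Function.uncurry_def]
    fun_prop (disch := assumption)
  have hzero : ∀ m, ∫ φ in (-π)..π, F' m φ = 0 := by
    intro m
    have hd : ∀ φ, HasDerivAt (fun φ => Real.exp (-m * B φ) * Real.sin (q m * A φ))
        (m * A φ * Real.exp (-m * B φ) * Real.sin (q m * A φ)
          + q m * B φ * Real.exp (-m * B φ) * Real.cos (q m * A φ)) φ := by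
      intro φ
      refine HasDerivAt.congr_deriv (((hasDerivAt_inner_dirPerp z φ).const_mul (-m)).exp.mul
        ((hasDerivAt_inner_dir z φ).const_mul (q m)).sin) ?_
      simp only [hA, hB]; ring
    rw [intervalIntegral.integral_const_mul,
      intervalIntegral.integral_eq_sub_of_hasDerivAt (fun φ _ => hd φ)
        (Continuous.intervalIntegrable (by fun_prop) _ _)]
    have e1 : A π = A (-π) := by
      have := dir_add_two_pi (-π)
      simp only [hA]; rw [← this]; ring_nf
    have e2 : B π = B (-π) := by
      have := dirPerp_add_two_pi (-π)
      simp only [hB]; rw [← this]; ring_nf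
    simp [e1, e2]
  have hFc : ∀ m, Continuous (F m) := fun m => by simp only [F]; fun_prop
  have hdiff : (∫ φ in (-π)..π, F m φ) - ∫ φ in (-π)..π, F 0 φ = 0 := by
    rw [← intervalIntegral.integral_sub ((hFc m).intervalIntegrable _ _)
      ((hFc 0).intervalIntegrable _ _)]
    have : ∀ φ, F m φ - F 0 φ = ∫ t in (0)..m, F' t φ := fun φ =>
      (intervalIntegral.integral_eq_sub_of_hasDerivAt (fun t _ => hFd t φ)
        ((hF'c.comp (by fun_prop : Continuous fun t => (t, φ))).intervalIntegrable _ _)).symm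
    simp only [this]
    rw [intervalIntegral_intervalIntegral_swap]
    · simp [hzero]
    · exact ((hF'c.comp continuous_swap).continuousOn.integrableOn_compact
        (isCompact_uIcc.prod isCompact_uIcc)).mono_set
          (prod_mono uIoc_subset_uIcc uIoc_subset_uIcc)
  have : q 0 = r := by simp [hq, Real.sqrt_sq hr.le]
  simpa [F, this] using sub_eq_zero.1 hdiff

/-- The backprojection of the filter is the ideal low-pass kernel of the plane. -/
lemma backprojection_filterKernel (μ : ℝ) {R : ℝ} (hR : 0 ≤ R) (z : Plane) :
    ∫ φ in Ico 0 (2 * π), Real.exp (-μ * inner ℝ (dirPerp φ) z) *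
        filterKernel μ R (inner ℝ (dir φ) z) =
      ∫ w in Metric.closedBall (0 : Plane) R, Real.cos (2 * π * inner ℝ w z) := by
  set A : ℝ → ℝ := fun φ => inner ℝ (dir φ) z with hA
  set B : ℝ → ℝ := fun φ => inner ℝ (dirPerp φ) z with hB
  have hAc : Continuous A := by fun_prop
  have hBc : Continuous B := by fun_prop
  have hper : Function.Periodic (fun φ => Real.exp (-μ * B φ) * filterKernel μ R (A φ))
      (2 * π) := by
    intro φ
    simp only [hA, hB, dir_add_two_pi, dirPerp_add_two_pi]
  have e1 : ∫ φ in Ico 0 (2 * π), Real.exp (-μ * B φ) * filterKernel μ R (A φ) =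
      ∫ φ in (-π)..π, Real.exp (-μ * B φ) * filterKernel μ R (A φ) := by
    rw [integral_Ico_eq_integral_Ioc, ← intervalIntegral.integral_of_le (by positivity)]
    have := hper.intervalIntegral_add_eq 0 (-π)
    rw [zero_add] at this
    rw [this]
    congr 1; ring
  rw [e1, setIntegral_ball_polar (by fun_prop) hR]
  have e2 : ∀ φ, Real.exp (-μ * B φ) * filterKernel μ R (A φ) =
      ∫ ρ in (0)..R, ρ * (Real.exp (-μ * B φ) * Real.cos (shiftFreq μ ρ * A φ)) := by
    intro φ
    rw [filterKernel, ← intervalIntegral.integral_const_mul]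
    refine intervalIntegral.integral_congr fun ρ _ => ?_
    ring
  simp only [e2]
  rw [intervalIntegral_intervalIntegral_swap]
  · refine intervalIntegral.integral_congr_ae ?_
    filter_upwards with ρ hρ
    rw [uIoc_of_le hR] at hρ
    have hρ0 : 0 < 2 * π * ρ := by have := hρ.1; positivity
    rw [intervalIntegral.integral_const_mul, intervalIntegral.integral_const_mul]
    congr 1
    have := integral_circle_exp_mul_cos z hρ0 μ
    simp only [shiftFreq, hA, hB, inner_smul_left]
    rw [this]
    simp [mul_assoc]
  · refine (Continuous.continuousOn (by fun_prop)).integrableOn_compact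
        (isCompact_uIcc.prod isCompact_uIcc) |>.mono_set
          (prod_mono uIoc_subset_uIcc uIoc_subset_uIcc)

/-! ### Inversion weights -/

section

variable {f : Plane → ℝ} {μ : ℝ} {x₀ : Plane}

/-- The weight on the cylinder against which `T_μ f` integrates to the low-pass part of `f` at
`x₀`. -/
def weight (μ : ℝ) (x₀ : Plane) (R : ℝ) (z : ℝ × ℝ) : ℝ :=
  4 * π * (Real.exp (-μ * inner ℝ (dirPerp z.1) x₀) *
    filterKernel μ R (inner ℝ (dir z.1) x₀ - z.2))

@[fun_prop]
lemma continuous_weight (μ : ℝ) (x₀ : Plane) (R : ℝ) : Continuous (weight μ x₀ R) := by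
  unfold weight; fun_prop

lemma integrableOn_obsCylinder {g : ℝ × ℝ → ℝ} (hg : Continuous g) : IntegrableOn g obsCylinder :=
  (hg.continuousOn.integrableOn_compact ((isCompact_Icc (a := 0) (b := 2 * π)).prod
    (isCompact_Icc (a := (-1 : ℝ)) (b := 1)))).mono_set (prod_mono Ico_subset_Icc_self subset_rfl)

lemma integrable_design {g : ℝ × ℝ → ℝ} (hg : Continuous g) : Integrable g design := by
  rw [design_eq]
  exact (integrableOn_obsCylinder hg).integrable.smul_measure
    (ENNReal.inv_ne_top.2 (by simp [Real.pi_pos]))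

/-- The real part of the integrand `e^{2πi⟨w, x₀⟩} 𝓕 f (w)` of the inversion formula at `x₀`. -/
def spectrum (f : Plane → ℝ) (x₀ w : Plane) : ℝ :=
  (Complex.exp (↑(2 * π * inner ℝ w x₀) * Complex.I) • 𝓕 (fun x : Plane => (f x : ℂ)) w).re

lemma abs_spectrum_le (f : Plane → ℝ) (x₀ w : Plane) :
    |spectrum f x₀ w| ≤ ‖𝓕 (fun x : Plane => (f x : ℂ)) w‖ := by
  refine (Complex.abs_re_le_norm _).trans ?_
  rw [norm_smul, Complex.norm_exp_ofReal_mul_I, one_mul]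

lemma continuous_fourier_of_integrable (hf : Integrable f) :
    Continuous (𝓕 (fun x : Plane => (f x : ℂ))) :=
  VectorFourier.fourierIntegral_continuous Real.continuous_fourierChar
    (by exact continuous_inner) hf.ofReal

lemma continuous_spectrum (hf : Integrable f) (x₀ : Plane) : Continuous (spectrum f x₀) := by
  have := continuous_fourier_of_integrable hf
  unfold spectrum
  fun_prop

lemma spectrum_eq_integral (hf : Integrable f) (x₀ w : Plane) :
    spectrum f x₀ w = ∫ y, f y * Real.cos (2 * π * inner ℝ w (x₀ - y)) := by
  have hint : Integrable fun y : Plane =>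
      Complex.exp (↑(2 * π * inner ℝ w (x₀ - y)) * Complex.I) * (f y : ℂ) := by
    refine hf.ofReal.bdd_mul (c := 1) ?_ ?_
    · exact Continuous.aestronglyMeasurable (by fun_prop)
    · exact .of_forall fun y => by rw [Complex.norm_exp_ofReal_mul_I]
  have h1 : Complex.exp (↑(2 * π * inner ℝ w x₀) * Complex.I) •
      𝓕 (fun x : Plane => (f x : ℂ)) w =
      ∫ y, Complex.exp (↑(2 * π * inner ℝ w (x₀ - y)) * Complex.I) * (f y : ℂ) := by
    rw [Real.fourier_eq', smul_eq_mul, ← integral_const_mul]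
    refine integral_congr_ae (.of_forall fun y => ?_)
    simp only [smul_eq_mul]
    rw [← mul_assoc, ← Complex.exp_add, inner_sub_right, real_inner_comm w y]
    congr 2
    push_cast; ring
  rw [spectrum, h1, ← RCLike.re_eq_complex_re, ← integral_re hint]
  refine integral_congr_ae (.of_forall fun y => ?_)
  simp only [RCLike.re_eq_complex_re, Complex.re_mul_ofReal, Complex.exp_ofReal_mul_I_re]
  ring

/-- The part of `f(x₀)` carried by the frequencies of norm at most `R`. -/
def lowPass (f : Plane → ℝ) (x₀ : Plane) (R : ℝ) : ℝ :=
  ∫ w in Metric.closedBall (0 : Plane) R, spectrum f x₀ w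

lemma lowPass_eq_integral (hf : Integrable f) (x₀ : Plane) (R : ℝ) :
    lowPass f x₀ R = ∫ y, f y *
      ∫ w in Metric.closedBall (0 : Plane) R, Real.cos (2 * π * inner ℝ w (x₀ - y)) := by
  have hfin : IsFiniteMeasure ((volume : Measure Plane).restrict (Metric.closedBall 0 R)) :=
    ⟨by rw [Measure.restrict_apply_univ]; exact measure_closedBall_lt_top⟩
  simp only [lowPass, spectrum_eq_integral hf]
  rw [integral_integral_swap]
  · simp only [integral_const_mul]
  · have h1 : Integrable (fun p : Plane × Plane => f p.2)
        ((volume.restrict (Metric.closedBall 0 R)).prod volume) := hf.comp_snd _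
    refine (h1.mul_bdd (c := 1) ?_ ?_ : Integrable (fun p : Plane × Plane =>
      f p.2 * Real.cos (2 * π * inner ℝ p.1 (x₀ - p.2))) _)
    · exact Continuous.aestronglyMeasurable (by fun_prop)
    · exact .of_forall fun p => Real.abs_cos_le_one _

/-- The weights invert the exponential Radon transform up to the frequency cut-off. -/
lemma integral_weight_mul_expRadon (hf : IsDiscFunction f) (x₀ : Plane) {R : ℝ} (hR : 0 ≤ R) :
    ∫ z, weight μ x₀ R z * expRadon μ f z ∂design = lowPass f x₀ R := by
  have hc := hf.continuous
  have hcT := continuous_expRadon (μ := μ) hf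
  rw [integral_design_iterated (integrableOn_obsCylinder (by fun_prop)),
    lowPass_eq_integral hf.integrable, ← integral_const_mul]
  have e1 : ∀ φ : ℝ, (4 * π)⁻¹ *
      ∫ s in Icc (-1 : ℝ) 1, weight μ x₀ R (φ, s) * expRadon μ f (φ, s) =
      ∫ y : Plane, f y * (Real.exp (-μ * inner ℝ (dirPerp φ) (x₀ - y)) *
        filterKernel μ R (inner ℝ (dir φ) (x₀ - y))) := by
    intro φ
    rw [integral_mul_expRadon hf φ (u := fun s => weight μ x₀ R (φ, s)) (by fun_prop),
      ← integral_const_mul]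
    refine integral_congr_ae (.of_forall fun y => ?_)
    simp only [weight, inner_sub_right]
    rw [mul_sub, sub_eq_add_neg (-μ * inner ℝ (dirPerp φ) x₀), Real.exp_add, neg_mul μ
      (inner ℝ (dirPerp φ) y), neg_neg]
    field_simp
  simp only [e1]
  rw [integral_integral_swap]
  · simp only [integral_const_mul, backprojection_filterKernel μ hR]
  · have hcont : Continuous (Function.uncurry fun (φ : ℝ) (y : Plane) =>
        f y * (Real.exp (-μ * inner ℝ (dirPerp φ) (x₀ - y)) *
          filterKernel μ R (inner ℝ (dir φ) (x₀ - y)))) := by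
      unfold Function.uncurry
      fun_prop
    have h2 : IntegrableOn (Function.uncurry fun (φ : ℝ) (y : Plane) =>
        f y * (Real.exp (-μ * inner ℝ (dirPerp φ) (x₀ - y)) *
          filterKernel μ R (inner ℝ (dir φ) (x₀ - y)))) (Ico 0 (2 * π) ×ˢ univ) := by
      refine IntegrableOn.of_forall_sdiff_eq_zero (s := Icc 0 (2 * π) ×ˢ Metric.closedBall 0 1)
        ?_ (measurableSet_Ico.prod MeasurableSet.univ) ?_
      · exact hcont.continuousOn.integrableOn_compact
          (isCompact_Icc.prod (isCompact_closedBall _ _))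
      · rintro ⟨φ, y⟩ ⟨⟨hφ, -⟩, hn⟩
        have : ¬ ‖y‖ ≤ 1 := fun h => hn ⟨Ico_subset_Icc_self hφ, by simpa using h⟩
        simp [Function.uncurry, hf.support y (not_le.1 this)]
    rw [IntegrableOn, Measure.volume_eq_prod, ← Measure.prod_restrict, Measure.restrict_univ] at h2
    exact h2

lemma abs_weight_le (hx₀ : ‖x₀‖ ≤ 1) {R : ℝ} (hR : 0 ≤ R) (z : ℝ × ℝ) :
    |weight μ x₀ R z| ≤ 4 * π * Real.exp |μ| * R ^ 2 := by
  have h1 : Real.exp (-μ * inner ℝ (dirPerp z.1) x₀) ≤ Real.exp |μ| := by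
    refine Real.exp_le_exp.2 ((le_abs_self _).trans ?_)
    rw [abs_mul, abs_neg]
    exact mul_le_of_le_one_right (abs_nonneg _) ((abs_inner_dirPerp_le _ _).trans hx₀)
  rw [weight, abs_mul (4 * π), abs_mul (Real.exp _),
    abs_of_pos (by positivity : (0 : ℝ) < 4 * π), Real.abs_exp,
    mul_assoc (4 * π)]
  gcongr
  exact abs_filterKernel_le hR _

/-- A constant for the second moment of the inversion weights. -/
def weightConst (μ : ℝ) : ℝ :=
  8 * π ^ 3 * Real.exp |μ| ^ 2 * (1 + (2 * π + |μ|) ^ 2)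

lemma weightConst_pos (μ : ℝ) : 0 < weightConst μ := by unfold weightConst; positivity

lemma setIntegral_filterKernel_sq_le (μ a : ℝ) {R : ℝ} (hR : 1 ≤ R) :
    ∫ s in Icc (-1 : ℝ) 1, filterKernel μ R (a - s) ^ 2 ≤
      (1 + (2 * π + |μ|) ^ 2) * R ^ 3 * π := by
  have hR0 : 0 < R := by linarith
  set c := (1 + (2 * π + |μ|) ^ 2)
  have hi : Integrable fun x : ℝ => (1 + (R * x) ^ 2)⁻¹ :=
    integrable_inv_one_add_sq.comp_mul_left' hR0.ne'
  have hi2 : Integrable fun s : ℝ => c * R ^ 4 * (1 + (R * (a - s)) ^ 2)⁻¹ :=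
    (hi.comp_sub_left a).const_mul _
  calc ∫ s in Icc (-1 : ℝ) 1, filterKernel μ R (a - s) ^ 2
      ≤ ∫ s in Icc (-1 : ℝ) 1, c * R ^ 4 * (1 + (R * (a - s)) ^ 2)⁻¹ := by
        refine setIntegral_mono_on ?_ hi2.integrableOn measurableSet_Icc
          fun s _ => filterKernel_sq_le hR _
        exact (Continuous.continuousOn (by fun_prop)).integrableOn_compact isCompact_Icc
    _ ≤ ∫ s : ℝ, c * R ^ 4 * (1 + (R * (a - s)) ^ 2)⁻¹ :=
        setIntegral_le_integral hi2 (.of_forall fun s => by positivity)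
    _ = c * R ^ 4 * (R⁻¹ * π) := by
        rw [integral_const_mul, integral_sub_left_eq_self (fun x : ℝ => (1 + (R * x) ^ 2)⁻¹),
          Measure.integral_comp_mul_left (fun x : ℝ => (1 + x ^ 2)⁻¹), smul_eq_mul,
          integral_univ_inv_one_add_sq, abs_of_pos (by positivity)]
    _ = c * R ^ 3 * π := by field_simp

lemma integral_weight_sq_le (hx₀ : ‖x₀‖ ≤ 1) {R : ℝ} (hR : 1 ≤ R) :
    ∫ z, weight μ x₀ R z ^ 2 ∂design ≤ weightConst μ * R ^ 3 := by
  rw [integral_design_iterated (integrableOn_obsCylinder (by fun_prop))]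
  have h0 : 0 < R := by linarith
  set K := 16 * π ^ 2 * Real.exp |μ| ^ 2 * ((1 + (2 * π + |μ|) ^ 2) * R ^ 3 * π) with hK
  have h1 : ∀ φ ∈ Ico 0 (2 * π), ‖∫ s in Icc (-1 : ℝ) 1, weight μ x₀ R (φ, s) ^ 2‖ ≤ K := by
    intro φ _
    rw [Real.norm_of_nonneg (integral_nonneg fun _ => sq_nonneg _)]
    have h2 : ∀ s, weight μ x₀ R (φ, s) ^ 2 = 16 * π ^ 2 *
        Real.exp (-μ * inner ℝ (dirPerp φ) x₀) ^ 2 *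
          filterKernel μ R (inner ℝ (dir φ) x₀ - s) ^ 2 := fun s => by
      simp only [weight]; ring
    simp only [h2]
    rw [integral_const_mul, hK]
    gcongr
    · refine (le_abs_self _).trans ?_
      rw [abs_mul, abs_neg]
      exact mul_le_of_le_one_right (abs_nonneg _) ((abs_inner_dirPerp_le _ _).trans hx₀)
    · exact setIntegral_filterKernel_sq_le _ _ hR
  have h3 := norm_setIntegral_le_of_norm_le_const (μ := (volume : Measure ℝ)) (s := Ico 0 (2 * π))
    measure_Ico_lt_top h1
  rw [Measure.real, Real.volume_Ico, sub_zero, ENNReal.toReal_ofReal (by positivity)] at h3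
  refine (mul_le_mul_of_nonneg_left ((le_abs_self _).trans h3) (by positivity)).trans
    (le_of_eq ?_)
  rw [hK, weightConst]
  field_simp
  norm_num

end

/-! ### Fourier tails of Sobolev functions -/

section

variable {f : Plane → ℝ} {x₀ : Plane}

lemma lintegral_comp_smul_plane {F : Plane → ℝ≥0∞} (hF : Measurable F) {c : ℝ} (hc : 0 < c) :
    ∫⁻ w, F (c • w) = ENNReal.ofReal ((c ^ 2)⁻¹) * ∫⁻ w, F w := by
  rw [← lintegral_map hF (measurable_const_smul c), Measure.map_addHaar_smul _ hc.ne',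
    lintegral_smul_measure, smul_eq_mul, finrank_euclideanSpace, Fintype.card_fin,
    abs_of_pos (by positivity)]

/-- The Sobolev energy in the frequency variable of Mathlib's Fourier transform. -/
lemma lintegral_sobolev_eq (hf : Integrable f) (β : ℝ) :
    ∫⁻ ξ : Plane, ENNReal.ofReal ((1 + ‖ξ‖ ^ 2) ^ β * ‖fourierU f ξ‖ ^ 2) =
      ∫⁻ w : Plane, ENNReal.ofReal ((1 + (2 * π * ‖w‖) ^ 2) ^ β *
        ‖𝓕 (fun x : Plane => (f x : ℂ)) w‖ ^ 2) := by
  have hg := continuous_fourier_of_integrable hf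
  have h1 : ∀ ξ : Plane, ENNReal.ofReal ((1 + ‖ξ‖ ^ 2) ^ β * ‖fourierU f ξ‖ ^ 2) =
      ENNReal.ofReal (((2 * π) ^ 2)⁻¹) *
      (fun w : Plane => ENNReal.ofReal ((1 + (2 * π * ‖w‖) ^ 2) ^ β *
        ‖𝓕 (fun x : Plane => (f x : ℂ)) w‖ ^ 2)) ((2 * π)⁻¹ • ξ) := by
    intro ξ
    simp only
    rw [← ENNReal.ofReal_mul (by positivity), fourierU, norm_mul, norm_smul, Complex.norm_real,
      Real.norm_of_nonneg (by positivity : 0 ≤ (2 * π)⁻¹)]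
    congr 1
    rw [← mul_assoc (2 * π), mul_inv_cancel₀ (by positivity), one_mul, mul_pow, inv_pow]
    ring
  have hm : Measurable fun w : Plane => ENNReal.ofReal ((1 + (2 * π * ‖w‖) ^ 2) ^ β *
      ‖𝓕 (fun x : Plane => (f x : ℂ)) w‖ ^ 2) := by
    have := hg.measurable
    fun_prop
  rw [lintegral_congr h1, lintegral_const_mul' _ _ ENNReal.ofReal_ne_top,
    lintegral_comp_smul_plane hm (by positivity), ← mul_assoc,
    ← ENNReal.ofReal_mul (by positivity), ← mul_inv, ← mul_pow,
    mul_inv_cancel₀ (by positivity)]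
  simp

lemma lintegral_compl_closedBall_le {β R : ℝ} (hβ : 1 < β) (hR : 0 < R) :
    ∫⁻ w in (Metric.closedBall (0 : Plane) R)ᶜ, ENNReal.ofReal ((1 + (2 * π * ‖w‖) ^ 2) ^ (-β)) ≤
      ENNReal.ofReal (π / (β - 1) * (R ^ (-(β - 1))) ^ 2) := by
  have hmeas : Measurable fun w : Plane => ENNReal.ofReal ((1 + (2 * π * ‖w‖) ^ 2) ^ (-β)) := by
    fun_prop
  rw [← lintegral_indicator measurableSet_closedBall.compl,
    lintegral_polar (hmeas.indicator measurableSet_closedBall.compl)]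
  have hpt : ∀ r ∈ Ioi (0 : ℝ), ∫⁻ φ in Ioo (-π) π, ENNReal.ofReal r *
      (Metric.closedBall (0 : Plane) R)ᶜ.indicator
        (fun w => ENNReal.ofReal ((1 + (2 * π * ‖w‖) ^ 2) ^ (-β))) (r • dir φ) ≤
      (Ioi R).indicator (fun r => ENNReal.ofReal (2 * π) * ENNReal.ofReal (r ^ (1 - 2 * β))) r := by
    intro r hr
    have hr0 : 0 < r := hr
    by_cases hrR : R < r
    · rw [indicator_of_mem (by exact hrR)]
      calc _ ≤ ∫⁻ φ in Ioo (-π) π, ENNReal.ofReal (r ^ (1 - 2 * β)) := by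
            refine lintegral_mono fun φ => ?_
            rw [indicator_of_mem (by simpa [norm_smul_dir hr0.le] using hrR),
              ← ENNReal.ofReal_mul hr0.le, norm_smul_dir hr0.le]
            refine ENNReal.ofReal_le_ofReal ?_
            have h1 : (1 + (2 * π * r) ^ 2) ^ (-β) ≤ (r ^ 2) ^ (-β) := by
              refine Real.rpow_le_rpow_of_nonpos (by positivity) ?_ (by linarith)
              have : (1 : ℝ) ≤ (2 * π) ^ 2 := by nlinarith [Real.pi_gt_three]
              rw [mul_pow]; nlinarith [sq_nonneg r]
            have h2 : r * (r ^ 2) ^ (-β) = r ^ (1 - 2 * β) := by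
              rw [← Real.rpow_natCast r 2, ← Real.rpow_mul hr0.le]
              nth_rewrite 1 [← Real.rpow_one r]
              rw [← Real.rpow_add hr0]
              congr 1; push_cast; ring
            rw [← h2]; gcongr
        _ = _ := by
            rw [lintegral_const, Measure.restrict_apply_univ, Real.volume_Ioo, mul_comm]
            congr 2; ring
    · rw [indicator_of_notMem (by exact hrR)]
      refine le_of_eq (lintegral_eq_zero_of_ae_eq_zero (.of_forall fun φ => ?_))
      simp only
      rw [indicator_of_notMem (by simpa [norm_smul_dir hr0.le] using hrR), mul_zero]
      rfl
  refine (setLIntegral_mono' measurableSet_Ioi hpt).trans ?_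
  rw [setLIntegral_indicator measurableSet_Ioi, inter_eq_left.2 (Ioi_subset_Ioi hR.le),
    lintegral_const_mul' _ _ ENNReal.ofReal_ne_top,
    ← ofReal_integral_eq_lintegral_ofReal
      (integrableOn_Ioi_rpow_of_lt (by linarith) hR)
      ((ae_restrict_mem measurableSet_Ioi).mono fun r hr =>
        Real.rpow_nonneg (hR.le.trans (le_of_lt hr)) _),
    integral_Ioi_rpow_of_lt (by linarith) hR, ← ENNReal.ofReal_mul (by positivity)]
  refine ENNReal.ofReal_le_ofReal (le_of_eq ?_)
  rw [← Real.rpow_natCast (R ^ (-(β - 1))), ← Real.rpow_mul hR.le]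
  have h1 : 1 - 2 * β + 1 = -(β - 1) * ((2 : ℕ) : ℝ) := by push_cast; ring
  have h2 : β - 1 ≠ 0 := by linarith
  rw [h1]
  push_cast
  field_simp

/-- The constant in the bound on Fourier tails; it is uniform over smoothness at least `β`. -/
def biasConst (C β : ℝ) : ℝ := Real.sqrt (π * C / (β - 1))

/-- Fourier tails of a Sobolev function, by the Cauchy-Schwarz inequality. -/
lemma lintegral_fourier_tail_le {C β R : ℝ} (hC : 0 ≤ C) (hβ : 1 < β) (hR : 0 < R)
    (hf : f ∈ sobolevBall β C) :
    ∫⁻ w in (Metric.closedBall (0 : Plane) R)ᶜ, ‖𝓕 (fun x : Plane => (f x : ℂ)) w‖ₑ ≤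
      ENNReal.ofReal (biasConst C β * R ^ (-(β - 1))) := by
  have hg := (continuous_fourier_of_integrable hf.2.1).measurable
  set g := 𝓕 (fun x : Plane => (f x : ℂ))
  have hpos : ∀ w : Plane, 0 < 1 + (2 * π * ‖w‖) ^ 2 := fun w => by positivity
  have hsob := hf.2.2
  rw [lintegral_sobolev_eq hf.2.1] at hsob
  have hsplit : ∀ w : Plane, ‖g w‖ₑ =
      ((fun w : Plane => ENNReal.ofReal ((1 + (2 * π * ‖w‖) ^ 2) ^ (β / 2) * ‖g w‖)) *
        fun w : Plane => ENNReal.ofReal ((1 + (2 * π * ‖w‖) ^ 2) ^ (-β / 2))) w := by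
    intro w
    rw [Pi.mul_apply, ← ENNReal.ofReal_mul (by positivity), mul_right_comm,
      ← Real.rpow_add (hpos w), ← ofReal_norm]
    congr 1
    ring_nf
    simp
  simp only [hsplit]
  refine (ENNReal.lintegral_mul_le_Lp_mul_Lq _ Real.HolderConjugate.two_two
    (Measurable.aemeasurable (by fun_prop)) (Measurable.aemeasurable (by fun_prop))).trans ?_
  have e1 : ∀ w : Plane, ENNReal.ofReal ((1 + (2 * π * ‖w‖) ^ 2) ^ (β / 2) * ‖g w‖) ^ (2 : ℝ) =
      ENNReal.ofReal ((1 + (2 * π * ‖w‖) ^ 2) ^ β * ‖g w‖ ^ 2) := by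
    intro w
    rw [ENNReal.ofReal_rpow_of_nonneg (by positivity) (by norm_num),
      Real.mul_rpow (by positivity) (by positivity), ← Real.rpow_mul (hpos w).le]
    norm_num
  have e2 : ∀ w : Plane, ENNReal.ofReal ((1 + (2 * π * ‖w‖) ^ 2) ^ (-β / 2)) ^ (2 : ℝ) =
      ENNReal.ofReal ((1 + (2 * π * ‖w‖) ^ 2) ^ (-β)) := by
    intro w
    rw [ENNReal.ofReal_rpow_of_nonneg (by positivity) (by norm_num),
      ← Real.rpow_mul (hpos w).le]
    norm_num
  simp only [e1, e2]
  have h1 := (setLIntegral_le_lintegral (Metric.closedBall (0 : Plane) R)ᶜ _).trans hsob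
  have h2 := lintegral_compl_closedBall_le hβ hR
  have hb : 0 < β - 1 := by linarith
  calc _ ≤ ENNReal.ofReal C ^ (1 / 2 : ℝ) *
        ENNReal.ofReal (π / (β - 1) * (R ^ (-(β - 1))) ^ 2) ^ (1 / 2 : ℝ) := by gcongr
    _ = _ := by
      rw [ENNReal.ofReal_rpow_of_nonneg hC (by norm_num),
        ENNReal.ofReal_rpow_of_nonneg (by positivity) (by norm_num),
        ← ENNReal.ofReal_mul (by positivity), ← Real.sqrt_eq_rpow, ← Real.sqrt_eq_rpow,
        Real.sqrt_mul (by positivity), Real.sqrt_sq (by positivity), ← mul_assoc,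
        ← Real.sqrt_mul hC, biasConst]
      congr 3
      ring_nf

lemma integrable_fourier {C β : ℝ} (hC : 0 ≤ C) (hβ : 1 < β) (hf : f ∈ sobolevBall β C) :
    Integrable (𝓕 (fun x : Plane => (f x : ℂ))) := by
  have hg := continuous_fourier_of_integrable hf.2.1
  rw [← integrableOn_univ, ← union_compl_self (Metric.closedBall (0 : Plane) 1)]
  refine IntegrableOn.union (hg.continuousOn.integrableOn_compact (isCompact_closedBall _ _)) ?_
  refine ⟨hg.aestronglyMeasurable, ?_⟩
  exact (lintegral_fourier_tail_le hC hβ one_pos hf).trans_lt ENNReal.ofReal_lt_top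

lemma integrable_spectrum {C β : ℝ} (hC : 0 ≤ C) (hβ : 1 < β) (hf : f ∈ sobolevBall β C)
    (x₀ : Plane) : Integrable (spectrum f x₀) :=
  (integrable_fourier hC hβ hf).mono (continuous_spectrum hf.2.1 x₀).aestronglyMeasurable
    (.of_forall fun w => abs_spectrum_le f x₀ w)

lemma integral_spectrum {C β : ℝ} (hC : 0 ≤ C) (hβ : 1 < β) (hf : f ∈ sobolevBall β C)
    (x₀ : Plane) : ∫ w, spectrum f x₀ w = f x₀ := by
  have hg := integrable_fourier hC hβ hf
  have hc : Continuous fun x : Plane => (f x : ℂ) := Complex.continuous_ofReal.comp hf.1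
  have h := congrFun (hc.fourierInv_fourier_eq hf.2.1.ofReal hg) x₀
  rw [Real.fourierInv_eq'] at h
  have hint : Integrable fun w : Plane =>
      Complex.exp (↑(2 * π * inner ℝ w x₀) * Complex.I) • 𝓕 (fun x : Plane => (f x : ℂ)) w := by
    simp only [smul_eq_mul]
    refine hg.bdd_mul (c := 1) ?_ ?_
    · exact Continuous.aestronglyMeasurable (by fun_prop)
    · exact .of_forall fun y => by rw [Complex.norm_exp_ofReal_mul_I]
  have h2 := congrArg Complex.re h
  rw [← RCLike.re_eq_complex_re, ← integral_re hint] at h2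
  simpa [spectrum] using h2

/-- The total mass of the frequencies of norm larger than `R` in the inversion formula at `x₀`. -/
def tailMass (f : Plane → ℝ) (x₀ : Plane) (R : ℝ) : ℝ :=
  ∫ w in (Metric.closedBall (0 : Plane) R)ᶜ, |spectrum f x₀ w|

lemma tailMass_le {C β₁ β R : ℝ} (hC : 0 ≤ C) (hβ₁ : 1 < β₁) (hβ : β₁ ≤ β) (hR : 0 < R)
    (hf : f ∈ sobolevBall β C) (x₀ : Plane) :
    tailMass f x₀ R ≤ biasConst C β₁ * R ^ (-(β - 1)) := by
  have hβ' : 1 < β := hβ₁.trans_le hβ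
  have h1 : tailMass f x₀ R ≤ biasConst C β * R ^ (-(β - 1)) := by
    have hint := (integrable_fourier hC hβ' hf).norm.integrableOn
      (s := (Metric.closedBall (0 : Plane) R)ᶜ)
    refine (setIntegral_mono (integrable_spectrum hC hβ' hf x₀).abs.integrableOn hint
      (fun w => abs_spectrum_le f x₀ w)).trans ?_
    rw [integral_norm_eq_lintegral_enorm (integrable_fourier hC hβ' hf).1.restrict]
    exact ENNReal.toReal_le_of_le_ofReal
      (mul_nonneg (Real.sqrt_nonneg _) (Real.rpow_nonneg hR.le _))
      (lintegral_fourier_tail_le hC hβ' hR hf)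
  refine h1.trans ?_
  unfold biasConst
  have : 0 < β₁ - 1 := by linarith
  gcongr

lemma abs_lowPass_sub_lowPass_le {C β R R' : ℝ} (hC : 0 ≤ C) (hβ : 1 < β) (hR : R ≤ R')
    (hf : f ∈ sobolevBall β C) (x₀ : Plane) :
    |lowPass f x₀ R' - lowPass f x₀ R| ≤ tailMass f x₀ R - tailMass f x₀ R' := by
  have hi := integrable_spectrum hC hβ hf x₀
  have hsub : Metric.closedBall (0 : Plane) R ⊆ Metric.closedBall 0 R' :=
    Metric.closedBall_subset_closedBall hR
  have e1 : lowPass f x₀ R' - lowPass f x₀ R =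
      ∫ w in Metric.closedBall (0 : Plane) R' \ Metric.closedBall 0 R, spectrum f x₀ w := by
    rw [setIntegral_sdiff measurableSet_closedBall hi.integrableOn hsub]; rfl
  have e2 : tailMass f x₀ R - tailMass f x₀ R' =
      ∫ w in Metric.closedBall (0 : Plane) R' \ Metric.closedBall 0 R, |spectrum f x₀ w| := by
    have : Metric.closedBall (0 : Plane) R' \ Metric.closedBall 0 R =
        (Metric.closedBall (0 : Plane) R)ᶜ \ (Metric.closedBall (0 : Plane) R')ᶜ := by
      ext; simp [and_comm]
    rw [this, setIntegral_sdiff measurableSet_closedBall.compl hi.abs.integrableOn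
      (compl_subset_compl.2 hsub)]; rfl
  rw [e1, e2]
  exact abs_integral_le_integral_abs

lemma abs_lowPass_sub_le {C β : ℝ} (hC : 0 ≤ C) (hβ : 1 < β) (hf : f ∈ sobolevBall β C)
    (x₀ : Plane) (R : ℝ) : |lowPass f x₀ R - f x₀| ≤ tailMass f x₀ R := by
  have hi := integrable_spectrum hC hβ hf x₀
  rw [← integral_spectrum hC hβ hf x₀, ← integral_add_compl (measurableSet_closedBall
    (x := (0 : Plane)) (ε := R)) hi, lowPass, sub_add_cancel_left, abs_neg]
  exact abs_integral_le_integral_abs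

lemma tailMass_nonneg (f : Plane → ℝ) (x₀ : Plane) (R : ℝ) : 0 ≤ tailMass f x₀ R :=
  integral_nonneg fun _ => abs_nonneg _

end

/-! ### The observations -/

section

variable {f : Plane → ℝ} {μ σ : ℝ}

lemma measurable_observation (hf : IsDiscFunction f) :
    Measurable fun w : (ℝ × ℝ) × ℝ => (w.1, expRadon μ f w.1 + w.2) := by
  have := (continuous_expRadon (μ := μ) hf).measurable
  fun_prop

lemma isProbabilityMeasure_obsLaw (σ : ℝ) (hf : IsDiscFunction f) :
    IsProbabilityMeasure (obsLaw μ σ f) :=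
  Measure.isProbabilityMeasure_map (measurable_observation hf).aemeasurable

lemma lintegral_obsLaw (hf : IsDiscFunction f) {g : Obs → ℝ≥0∞} (hg : Measurable g) :
    ∫⁻ o, g o ∂obsLaw μ σ f = ∫⁻ z, ∫⁻ e, g (z, expRadon μ f z + e)
      ∂gaussianReal 0 (Real.toNNReal (σ ^ 2)) ∂design := by
  rw [obsLaw, lintegral_map hg (measurable_observation hf),
    lintegral_prod]
  exact (hg.comp (measurable_observation hf)).aemeasurable

/-- Fubini for a product of functions of independent observations. -/
lemma lintegral_pi_prod {ι Ω : Type*} [Fintype ι] [MeasurableSpace Ω] (ν : Measure Ω)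
    [IsProbabilityMeasure ν] {g : ι → Ω → ℝ≥0∞} (hg : ∀ i, Measurable (g i)) :
    ∫⁻ d, ∏ i, g i (d i) ∂Measure.pi (fun _ : ι => ν) = ∏ i, ∫⁻ o, g i o ∂ν := by
  have h := lintegral_prod_eq_prod_lintegral_of_indepFun Finset.univ
    (fun (i : ι) (d : ι → Ω) => g i (d i))
    (iIndepFun_pi (μ := fun _ : ι => ν) fun i => (hg i).aemeasurable)
    fun i => (hg i).comp (measurable_pi_apply i)
  rw [h]
  refine Finset.prod_congr rfl fun i _ => ?_
  exact (measurePreserving_eval (fun _ : ι => ν) i).lintegral_comp (hg i)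

/-! ### Linear estimators and their exponential moments -/

/-- The linear estimator `n⁻¹ ∑ w(θ_i, s_i) Y_i`. -/
def linEst (w : ℝ × ℝ → ℝ) (n : ℕ) (d : Fin n → Obs) : ℝ :=
  (n : ℝ)⁻¹ * ∑ i, w (d i).1 * (d i).2

lemma measurable_linEst {w : ℝ × ℝ → ℝ} (hw : Measurable w) (n : ℕ) :
    Measurable (linEst w n) := by
  unfold linEst
  fun_prop

/-- The constant in the exponential moment bound for linear estimators, when `|T_μ f| ≤ M`. -/
def mgfConst (σ M : ℝ) : ℝ := σ ^ 2 / 2 + (M + σ ^ 2 / 2) ^ 2 * Real.exp (M + σ ^ 2 / 2)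

lemma exp_le_one_add_add_sq_mul_exp (x : ℝ) : Real.exp x ≤ 1 + x + x ^ 2 * Real.exp |x| := by
  have h := Complex.norm_exp_sub_sum_le_norm_mul_exp (x : ℂ) 2
  rw [Finset.sum_range_succ, Finset.sum_range_one] at h
  have h2 : Complex.exp x - ((x : ℂ) ^ 0 / (Nat.factorial 0 : ℂ) + (x : ℂ) ^ 1 /
      (Nat.factorial 1 : ℂ)) = ((Real.exp x - (1 + x) : ℝ) : ℂ) := by
    push_cast; simp
  rw [h2, Complex.norm_real, Complex.norm_real, Real.norm_eq_abs, Real.norm_eq_abs, sq_abs] at h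
  linarith [le_abs_self (Real.exp x - (1 + x))]

lemma lintegral_exp_gaussianReal (t : ℝ) (v : NNReal) :
    ∫⁻ e, ENNReal.ofReal (Real.exp (t * e)) ∂gaussianReal 0 v =
      ENNReal.ofReal (Real.exp (v * t ^ 2 / 2)) := by
  rw [← ofReal_integral_eq_lintegral_ofReal (integrable_exp_mul_gaussianReal t)
    (.of_forall fun _ => (Real.exp_pos _).le)]
  have := congrFun (mgf_fun_id_gaussianReal (μ := 0) (v := v)) t
  simp only [mgf, zero_mul, zero_add] at this
  rw [this]

/-- The exponential moment of one weighted observation. The constraint `|t| W ≤ 1` keeps the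
exponent bounded, so that the quadratic term carries the second moment `v` of the weight and not
its supremum `W`. -/
lemma lintegral_exp_obsLaw_le (hf : IsDiscFunction f) {M : ℝ} (hM : ∀ z, |expRadon μ f z| ≤ M)
    {w : ℝ × ℝ → ℝ} (hw : Continuous w) {W v : ℝ} (hW : ∀ z, |w z| ≤ W)
    (hv : ∫ z, w z ^ 2 ∂design ≤ v) {t : ℝ} (ht : |t| * W ≤ 1) :
    ∫⁻ o, ENNReal.ofReal (Real.exp (t * (w o.1 * o.2 - ∫ z, w z * expRadon μ f z ∂design)))
      ∂obsLaw μ σ f ≤ ENNReal.ofReal (Real.exp (mgfConst σ M * t ^ 2 * v)) := by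
  have hT := continuous_expRadon (μ := μ) hf
  have hwm := hw.measurable
  have hM0 : 0 ≤ M := (abs_nonneg _).trans (hM 0)
  set b := ∫ z, w z * expRadon μ f z ∂design with hb
  set m := M + σ ^ 2 / 2 with hm
  have hm0 : 0 ≤ m := by positivity
  have htw : ∀ z, |t * w z| ≤ 1 := fun z => by
    rw [abs_mul]
    exact (mul_le_mul_of_nonneg_left (hW z) (abs_nonneg t)).trans ht
  rw [lintegral_obsLaw hf (by fun_prop)]
  have hreal : ∀ z, Real.exp (t * (w z * expRadon μ f z) + σ ^ 2 * (t * w z) ^ 2 / 2) ≤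
      1 + t * (w z * expRadon μ f z) + mgfConst σ M * t ^ 2 * w z ^ 2 := by
    intro z
    set T := expRadon μ f z
    set x := t * (w z * T) + σ ^ 2 * (t * w z) ^ 2 / 2 with hx
    have hq : (t * w z) ^ 2 ≤ |t * w z| := by
      rw [← sq_abs]; nlinarith [htw z, abs_nonneg (t * w z)]
    have hxabs : |x| ≤ m * |t * w z| := by
      rw [hx, hm, add_mul]
      refine (abs_add_le _ _).trans (add_le_add ?_ ?_)
      · rw [← mul_assoc, abs_mul, mul_comm M]
        gcongr
        exact hM z
      · rw [abs_of_nonneg (by positivity)]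
        nlinarith [sq_nonneg σ]
    have hx1 : |x| ≤ m := hxabs.trans (mul_le_of_le_one_right hm0 (htw z))
    have hx2 : x ^ 2 ≤ m ^ 2 * (t * w z) ^ 2 := by
      rw [← sq_abs x, ← sq_abs (t * w z), ← mul_pow]; gcongr
    have h3 : x ^ 2 * Real.exp |x| ≤ m ^ 2 * (t * w z) ^ 2 * Real.exp m := by gcongr
    have h4 := exp_le_one_add_add_sq_mul_exp x
    have h5 : mgfConst σ M * t ^ 2 * w z ^ 2 =
        σ ^ 2 * (t * w z) ^ 2 / 2 + m ^ 2 * (t * w z) ^ 2 * Real.exp m := by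
      rw [mgfConst]; ring
    linarith
  have hinner : ∀ z, ∫⁻ e, ENNReal.ofReal (Real.exp (t * (w z * (expRadon μ f z + e) - b)))
      ∂gaussianReal 0 (Real.toNNReal (σ ^ 2)) ≤
      ENNReal.ofReal (Real.exp (-t * b)) * ENNReal.ofReal
        (1 + t * (w z * expRadon μ f z) + mgfConst σ M * t ^ 2 * w z ^ 2) := by
    intro z
    set T := expRadon μ f z
    have h1 : ∀ e, ENNReal.ofReal (Real.exp (t * (w z * (T + e) - b))) =
        ENNReal.ofReal (Real.exp (-t * b)) * (ENNReal.ofReal (Real.exp (t * (w z * T))) *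
          ENNReal.ofReal (Real.exp (t * w z * e))) := by
      intro e
      rw [← ENNReal.ofReal_mul (by positivity), ← ENNReal.ofReal_mul (by positivity),
        ← Real.exp_add, ← Real.exp_add]
      congr 2; ring
    simp only [h1]
    rw [lintegral_const_mul' _ _ ENNReal.ofReal_ne_top,
      lintegral_const_mul' _ _ ENNReal.ofReal_ne_top, lintegral_exp_gaussianReal,
      ← ENNReal.ofReal_mul (by positivity), ← Real.exp_add, Real.coe_toNNReal _ (sq_nonneg σ)]
    gcongr
    exact hreal z
  refine (lintegral_mono hinner).trans ?_
  have hi1 : Integrable (fun z => w z * expRadon μ f z) design := integrable_design (by fun_prop)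
  have hi2 : Integrable (fun z => w z ^ 2) design := integrable_design (by fun_prop)
  have hA : 0 ≤ mgfConst σ M := by unfold mgfConst; positivity
  have hint : ∫⁻ z, ENNReal.ofReal
      (1 + t * (w z * expRadon μ f z) + mgfConst σ M * t ^ 2 * w z ^ 2) ∂design ≤
      ENNReal.ofReal (1 + t * b + mgfConst σ M * t ^ 2 * v) := by
    rw [← ofReal_integral_eq_lintegral_ofReal]
    · refine ENNReal.ofReal_le_ofReal ?_
      have hi3 : Integrable (fun z => 1 + t * (w z * expRadon μ f z)) design :=
        (integrable_const _).add (hi1.const_mul _)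
      rw [integral_add hi3 (hi2.const_mul _),
        integral_add (integrable_const _) (hi1.const_mul _), integral_const_mul,
        integral_const_mul, integral_const, probReal_univ, one_smul]
      gcongr
    · exact ((integrable_const _).add (hi1.const_mul _)).add (hi2.const_mul _)
    · exact .of_forall fun z => (Real.exp_pos _).le.trans (hreal z)
  rw [lintegral_const_mul' _ _ ENNReal.ofReal_ne_top]
  calc _ ≤ ENNReal.ofReal (Real.exp (-t * b)) *
        ENNReal.ofReal (Real.exp (t * b + mgfConst σ M * t ^ 2 * v)) := by
        gcongr
        refine hint.trans (ENNReal.ofReal_le_ofReal ?_)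
        have := Real.add_one_le_exp (t * b + mgfConst σ M * t ^ 2 * v)
        linarith
    _ = _ := by
        rw [← ENNReal.ofReal_mul (by positivity), ← Real.exp_add]
        congr 2; ring

lemma lintegral_exp_linEst_le (hf : IsDiscFunction f) {M : ℝ} (hM : ∀ z, |expRadon μ f z| ≤ M)
    {w : ℝ × ℝ → ℝ} (hw : Continuous w) {W v : ℝ} (hW : ∀ z, |w z| ≤ W)
    (hv : ∫ z, w z ^ 2 ∂design ≤ v) {n : ℕ} (hn : 0 < n) {t : ℝ} (ht : |t| * W ≤ n) :
    ∫⁻ d, ENNReal.ofReal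
      (Real.exp (t * (linEst w n d - ∫ z, w z * expRadon μ f z ∂design))) ∂sampleLaw μ σ n f ≤
      ENNReal.ofReal (Real.exp (mgfConst σ M * t ^ 2 * (v / n))) := by
  have := isProbabilityMeasure_obsLaw (μ := μ) σ hf
  have hn0 : (0 : ℝ) < n := by exact_mod_cast hn
  set b := ∫ z, w z * expRadon μ f z ∂design with hb
  have h1 : ∀ d : Fin n → Obs, ENNReal.ofReal (Real.exp (t * (linEst w n d - b))) =
      ∏ i, ENNReal.ofReal (Real.exp (t / n * (w (d i).1 * (d i).2 - b))) := by
    intro d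
    rw [← ENNReal.ofReal_prod_of_nonneg fun _ _ => (Real.exp_pos _).le, ← Real.exp_sum,
      ← Finset.mul_sum, Finset.sum_sub_distrib, linEst]
    congr 2
    simp only [Finset.sum_const, Finset.card_univ, Fintype.card_fin, nsmul_eq_mul]
    field_simp
  simp only [h1]
  have hwm := hw.measurable
  rw [sampleLaw, lintegral_pi_prod (obsLaw μ σ f) (g := fun (_ : Fin n) (o : Obs) =>
    ENNReal.ofReal (Real.exp (t / n * (w o.1 * o.2 - b)))) (fun _ => by fun_prop)]
  simp only [Finset.prod_const, Finset.card_univ, Fintype.card_fin]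
  have ht' : |t / n| * W ≤ 1 := by
    rw [abs_div, abs_of_pos hn0, div_mul_eq_mul_div, div_le_one hn0]; exact ht
  calc _ ≤ ENNReal.ofReal (Real.exp (mgfConst σ M * (t / n) ^ 2 * v)) ^ n := by
        gcongr
        exact lintegral_exp_obsLaw_le hf hM hw hW hv ht'
    _ = _ := by
        rw [← ENNReal.ofReal_pow (by positivity), ← Real.exp_nat_mul]
        congr 2
        field_simp

/-- The mean squared excess of the error of a linear estimator over a threshold `τ`, from
`(|x| - τ)₊² ≤ 2 t⁻² e^{-tτ} (e^{tx} + e^{-tx})`. -/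
lemma lintegral_excess_sq_le (hf : IsDiscFunction f) {M : ℝ} (hM : ∀ z, |expRadon μ f z| ≤ M)
    {w : ℝ × ℝ → ℝ} (hw : Continuous w) {W v : ℝ} (hW : ∀ z, |w z| ≤ W)
    (hv : ∫ z, w z ^ 2 ∂design ≤ v) {n : ℕ} (hn : 0 < n) {t : ℝ} (ht0 : 0 < t) (ht : t * W ≤ n)
    (τ : ℝ) :
    ∫⁻ d, ENNReal.ofReal
      (max (|linEst w n d - ∫ z, w z * expRadon μ f z ∂design| - τ) 0 ^ 2) ∂sampleLaw μ σ n f ≤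
      ENNReal.ofReal (4 / t ^ 2 * Real.exp (mgfConst σ M * t ^ 2 * (v / n) - t * τ)) := by
  set b := ∫ z, w z * expRadon μ f z ∂design with hb
  have hpt : ∀ x : ℝ, max (|x| - τ) 0 ^ 2 ≤
      2 / t ^ 2 * Real.exp (-(t * τ)) * (Real.exp (t * x) + Real.exp (-t * x)) := by
    intro x
    rcases le_total (|x| - τ) 0 with h | h
    · rw [max_eq_right h, zero_pow two_ne_zero]; positivity
    · rw [max_eq_left h]
      have h1 : (t * (|x| - τ)) ^ 2 / 2 ≤ Real.exp (t * (|x| - τ)) := by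
        have := Real.quadratic_le_exp_of_nonneg (mul_nonneg ht0.le h)
        nlinarith [mul_nonneg ht0.le h]
      have h2 : Real.exp (t * |x|) ≤ Real.exp (t * x) + Real.exp (-t * x) := by
        rcases abs_cases x with ⟨hx, _⟩ | ⟨hx, _⟩ <;> rw [hx]
        · linarith [Real.exp_pos (-t * x)]
        · rw [mul_neg, ← neg_mul]; linarith [Real.exp_pos (t * x)]
      have h3 : Real.exp (t * (|x| - τ)) = Real.exp (-(t * τ)) * Real.exp (t * |x|) := by
        rw [← Real.exp_add]; congr 1; ring
      calc (|x| - τ) ^ 2 = 2 / t ^ 2 * ((t * (|x| - τ)) ^ 2 / 2) := by field_simp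
        _ ≤ 2 / t ^ 2 * (Real.exp (-(t * τ)) * (Real.exp (t * x) + Real.exp (-t * x))) := by
          gcongr
          rw [h3] at h1
          exact h1.trans (by gcongr)
        _ = _ := by ring
  have hm := measurable_linEst hw.measurable n
  have e1 := lintegral_exp_linEst_le (σ := σ) hf hM hw hW hv hn (t := t)
    (by rwa [abs_of_pos ht0])
  have e2 := lintegral_exp_linEst_le (σ := σ) hf hM hw hW hv hn (t := -t)
    (by rwa [abs_neg, abs_of_pos ht0])
  rw [neg_sq] at e2
  calc _ ≤ ∫⁻ d, ENNReal.ofReal (2 / t ^ 2 * Real.exp (-(t * τ))) *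
        (ENNReal.ofReal (Real.exp (t * (linEst w n d - b))) +
          ENNReal.ofReal (Real.exp (-t * (linEst w n d - b)))) ∂sampleLaw μ σ n f := by
        refine lintegral_mono fun d => ?_
        rw [← ENNReal.ofReal_add (by positivity) (by positivity),
          ← ENNReal.ofReal_mul (by positivity)]
        exact ENNReal.ofReal_le_ofReal (hpt _)
    _ ≤ ENNReal.ofReal (2 / t ^ 2 * Real.exp (-(t * τ))) *
        (ENNReal.ofReal (Real.exp (mgfConst σ M * t ^ 2 * (v / n))) +
          ENNReal.ofReal (Real.exp (mgfConst σ M * t ^ 2 * (v / n)))) := by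
        rw [lintegral_const_mul' _ _ ENNReal.ofReal_ne_top, lintegral_add_left (by fun_prop)]
        gcongr
    _ = _ := by
        rw [← ENNReal.ofReal_add (by positivity) (by positivity),
          ← ENNReal.ofReal_mul (by positivity), sub_eq_add_neg, Real.exp_add]
        congr 1; ring

end

/-! ### Estimation at known smoothness -/

section

variable {f : Plane → ℝ} {μ σ C L β : ℝ} {x₀ : Plane}

lemma isDiscFunction_of_mem (hf : f ∈ smoothClass C L β) : IsDiscFunction f := by
  refine ⟨hf.1.1, fun x hx => image_eq_zero_of_notMem_tsupport fun h => ?_⟩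
  have := hf.2.1 h
  rw [mem_closedBall_zero_iff] at this
  linarith

lemma abs_expRadon_le_of_mem (hf : f ∈ smoothClass C L β) (z : ℝ × ℝ) :
    |expRadon μ f z| ≤ 2 * (Real.exp |μ| * L) :=
  abs_expRadon_le (isDiscFunction_of_mem hf) hf.2.2.2 z

/-- The constant `4π e^{|μ|}`: the inversion weight with cut-off `R` is bounded by its product with
`R²`. -/
def weightBound (μ : ℝ) : ℝ := 4 * π * Real.exp |μ|

lemma weightBound_pos (μ : ℝ) : 0 < weightBound μ := by unfold weightBound; positivity

/-- A constant `V` such that `V R³` bounds the second moment of the weights at scale `R`. The second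
summand makes `V` also large enough for the exponent `t` of the exponential moments to satisfy its
constraint `t sup|w| ≤ n`. -/
def noiseConst (μ : ℝ) : ℝ := 4 * weightConst μ + 8 * weightBound μ ^ 2

lemma noiseConst_pos (μ : ℝ) : 0 < noiseConst μ := by
  have := weightConst_pos μ
  unfold noiseConst; positivity

lemma mgfConst_nonneg (σ M : ℝ) : 0 ≤ mgfConst σ M := by
  unfold mgfConst; positivity

/-- The risk of the linear estimator with cut-off `R`: a stochastic part of order `R³ / n` and a
squared bias of order `R^{-2(β-1)}`. -/
lemma risk_linEst_le (hx₀ : ‖x₀‖ ≤ 1) (hC : 0 ≤ C) (hβ : 1 < β)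
    (hf : f ∈ smoothClass C L β) {n : ℕ} (hn : 0 < n) {R : ℝ} (hR : 1 ≤ R) (hRn : R ≤ n) :
    risk μ σ x₀ (⟨linEst (weight μ x₀ R) n,
      measurable_linEst (continuous_weight μ x₀ R).measurable n⟩ : EstimatorAt n) f ≤
      ENNReal.ofReal ((8 * Real.exp (mgfConst σ (2 * (Real.exp |μ| * L))) * noiseConst μ +
        2 * biasConst C β ^ 2) * (R ^ 3 / n + (R ^ (-(β - 1))) ^ 2)) := by
  have hd := isDiscFunction_of_mem hf
  have hR0 : 0 < R := by linarith
  have hn0 : (0 : ℝ) < n := by exact_mod_cast hn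
  have hV := noiseConst_pos μ
  set A := mgfConst σ (2 * (Real.exp |μ| * L)) with hA
  set v := noiseConst μ * R ^ 3 with hv
  have hv0 : 0 < v := by positivity
  -- the excess bound is used at threshold zero, where `t` balances `4 / t²` and `e^{A t² v / n}`
  set t := Real.sqrt (n / v) with ht
  have ht0 : 0 < t := Real.sqrt_pos.2 (by positivity)
  have ht2 : t ^ 2 = n / v := Real.sq_sqrt (by positivity)
  have hw := continuous_weight μ x₀ R
  have hsq : ∫ z, weight μ x₀ R z ^ 2 ∂design ≤ v := by
    refine (integral_weight_sq_le hx₀ hR).trans ?_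
    rw [hv, noiseConst]
    gcongr
    linarith [weightConst_pos μ, sq_nonneg (weightBound μ)]
  have htW : t * (weightBound μ * R ^ 2) ≤ n := by
    refine le_of_sq_le_sq ?_ hn0.le
    rw [mul_pow, ht2, div_mul_eq_mul_div, div_le_iff₀ hv0]
    have : (weightBound μ * R ^ 2) ^ 2 ≤ n * v := by
      calc (weightBound μ * R ^ 2) ^ 2 = R * (weightBound μ ^ 2 * R ^ 3) := by ring
        _ ≤ n * (noiseConst μ * R ^ 3) := by
          gcongr
          unfold noiseConst
          linarith [weightConst_pos μ, sq_nonneg (weightBound μ)]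
    nlinarith
  have hnoise := lintegral_excess_sq_le (μ := μ) (σ := σ) hd (abs_expRadon_le_of_mem hf) hw
    (fun z => abs_weight_le hx₀ hR0.le z) hsq hn ht0 htW 0
  have hb : |lowPass f x₀ R - f x₀| ≤ biasConst C β * R ^ (-(β - 1)) :=
    (abs_lowPass_sub_le hC hβ hf.1 x₀ R).trans (tailMass_le hC hβ le_rfl hR0 hf.1 x₀)
  rw [integral_weight_mul_expRadon hd x₀ hR0.le] at hnoise
  have hpt : ∀ d : Fin n → Obs, (linEst (weight μ x₀ R) n d - f x₀) ^ 2 ≤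
      2 * (max (|linEst (weight μ x₀ R) n d - lowPass f x₀ R| - 0) 0) ^ 2 +
        2 * (biasConst C β * R ^ (-(β - 1))) ^ 2 := by
    intro d
    rw [sub_zero, max_eq_left (abs_nonneg _), sq_abs]
    have h1 : (lowPass f x₀ R - f x₀) ^ 2 ≤ (biasConst C β * R ^ (-(β - 1))) ^ 2 := by
      rw [← sq_abs]; gcongr
    nlinarith [sq_nonneg ((linEst (weight μ x₀ R) n d - lowPass f x₀ R) -
      (lowPass f x₀ R - f x₀))]
  have hprob := isProbabilityMeasure_obsLaw (μ := μ) σ hd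
  have hprob' : IsProbabilityMeasure (sampleLaw μ σ n f) := by unfold sampleLaw; infer_instance
  calc risk μ σ x₀ _ f ≤ ∫⁻ d, (ENNReal.ofReal 2 * ENNReal.ofReal
        ((max (|linEst (weight μ x₀ R) n d - lowPass f x₀ R| - 0) 0) ^ 2) +
          ENNReal.ofReal (2 * (biasConst C β * R ^ (-(β - 1))) ^ 2)) ∂sampleLaw μ σ n f := by
        refine lintegral_mono fun d => ?_
        rw [← ENNReal.ofReal_mul (by norm_num), ← ENNReal.ofReal_add (by positivity)
          (by positivity)]
        exact ENNReal.ofReal_le_ofReal (hpt d)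
    _ ≤ ENNReal.ofReal 2 * ENNReal.ofReal (4 / t ^ 2 * Real.exp (A * t ^ 2 * (v / n) - t * 0)) +
          ENNReal.ofReal (2 * (biasConst C β * R ^ (-(β - 1))) ^ 2) := by
        rw [lintegral_add_right _ measurable_const, lintegral_const, measure_univ, mul_one,
          lintegral_const_mul' _ _ ENNReal.ofReal_ne_top]
        gcongr
    _ ≤ _ := by
        rw [← ENNReal.ofReal_mul (by norm_num), ← ENNReal.ofReal_add (by positivity)
          (by positivity)]
        refine ENNReal.ofReal_le_ofReal ?_
        have e1 : A * t ^ 2 * (v / n) - t * 0 = A := by rw [ht2]; field_simp; ring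
        have e2 : 4 / t ^ 2 = 4 * (noiseConst μ * (R ^ 3 / n)) := by
          rw [ht2, hv]; field_simp
        rw [e1, e2, mul_pow]
        have h3 : 0 ≤ R ^ 3 / n := by positivity
        have h4 : 0 ≤ Real.exp A * noiseConst μ * (R ^ (-(β - 1))) ^ 2 := by positivity
        have h5 : 0 ≤ biasConst C β ^ 2 * (R ^ 3 / n) := by positivity
        nlinarith

/-- For known smoothness `β`, the rate `n^{-(β-1)/(2β+1)}` is attained. -/
lemma minimaxRisk_le (hx₀ : ‖x₀‖ ≤ 1) (hC : 0 ≤ C) (hβ : 1 < β) :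
    ∃ K : ℝ, 0 < K ∧ ∀ n : ℕ, 0 < n →
      minimaxRisk μ σ x₀ (smoothClass C L β) n ≤ ENNReal.ofReal (K * minimaxRate n β ^ 2) := by
  have hV := noiseConst_pos μ
  refine ⟨2 * (8 * Real.exp (mgfConst σ (2 * (Real.exp |μ| * L))) * noiseConst μ +
        2 * biasConst C β ^ 2), by positivity, fun n hn => ?_⟩
  have hn1 : (1 : ℝ) ≤ n := by exact_mod_cast hn
  have hn0 : (0 : ℝ) < n := by linarith
  have hp : 0 < 2 * β + 1 := by linarith
  set R := (n : ℝ) ^ (1 / (2 * β + 1)) with hR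
  have hR1 : 1 ≤ R := Real.one_le_rpow hn1 (by positivity)
  have hRn : R ≤ n := by
    conv_rhs => rw [← Real.rpow_one (n : ℝ)]
    exact Real.rpow_le_rpow_of_exponent_le hn1 (by rw [div_le_one hp]; linarith)
  have e1 : (R ^ (-(β - 1))) ^ 2 = minimaxRate n β ^ 2 := by
    rw [hR, ← Real.rpow_mul hn0.le, minimaxRate]; congr 2; ring
  have e2 : R ^ 3 / n = minimaxRate n β ^ 2 := by
    rw [hR, minimaxRate, ← Real.rpow_natCast, ← Real.rpow_natCast, ← Real.rpow_mul hn0.le,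
      ← Real.rpow_mul hn0.le]
    nth_rewrite 2 [← Real.rpow_one (n : ℝ)]
    rw [← Real.rpow_sub hn0]
    congr 1
    push_cast
    field_simp
    ring
  refine (iInf_le _ (⟨linEst (weight μ x₀ R) n,
    measurable_linEst (continuous_weight μ x₀ R).measurable n⟩ : EstimatorAt n)).trans ?_
  refine iSup₂_le fun f hf => (risk_linEst_le hx₀ hC hβ hf hn hR1 hRn).trans ?_
  refine ENNReal.ofReal_le_ofReal (le_of_eq ?_)
  rw [e1, e2]; ring

/-! ### The adaptive estimator -/

/-- Soft thresholding at level `τ`. -/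
def soft (τ y : ℝ) : ℝ := max (y - τ) 0 - max (-y - τ) 0

@[fun_prop]
lemma continuous_soft (τ : ℝ) : Continuous (soft τ) := by unfold soft; fun_prop

/-- The error of soft thresholding: it never exceeds the signal nor twice the threshold, up to the
excess of the noise over the threshold. -/
lemma abs_soft_sub_le {τ : ℝ} (hτ : 0 ≤ τ) (y θ : ℝ) :
    |soft τ y - θ| ≤ min |θ| (2 * τ) + max (|y - θ| - τ) 0 := by
  rw [← min_add_add_right, le_min_iff]
  unfold soft
  have h1 := le_max_left (|y - θ| - τ) 0
  have h2 := le_max_right (|y - θ| - τ) 0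
  have h3 := le_abs_self (y - θ)
  have h4 := neg_abs_le (y - θ)
  have h5 := le_abs_self θ
  have h6 := neg_abs_le θ
  constructor <;> rw [abs_le] <;> constructor <;>
    rcases max_cases (y - τ) 0 with ⟨a, _⟩ | ⟨a, _⟩ <;>
    rcases max_cases (-y - τ) 0 with ⟨b, _⟩ | ⟨b, _⟩ <;> rw [a, b] <;> linarith

/-- The dyadic frequency scales `0, 1, 2, 4, …`. -/
def scale : ℕ → ℝ
  | 0 => 0
  | j + 1 => 2 ^ j

lemma scale_nonneg (j : ℕ) : 0 ≤ scale j := by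
  cases j <;> simp [scale]

lemma scale_mono_succ (j : ℕ) : scale j ≤ scale (j + 1) := by
  cases j with
  | zero => simp [scale]
  | succ j => simp only [scale]; rw [pow_succ]; linarith [pow_pos (two_pos (α := ℝ)) j]

/-- The inversion weight for the frequencies between two consecutive scales. -/
def incWeight (μ : ℝ) (x₀ : Plane) (j : ℕ) (z : ℝ × ℝ) : ℝ :=
  weight μ x₀ (scale (j + 1)) z - weight μ x₀ (scale j) z

@[fun_prop]
lemma continuous_incWeight (μ : ℝ) (x₀ : Plane) (j : ℕ) : Continuous (incWeight μ x₀ j) := by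
  unfold incWeight; fun_prop

lemma abs_incWeight_le (hx₀ : ‖x₀‖ ≤ 1) (j : ℕ) (z : ℝ × ℝ) :
    |incWeight μ x₀ j z| ≤ 2 * weightBound μ * 4 ^ j := by
  have h1 := abs_weight_le (μ := μ) hx₀ (scale_nonneg (j + 1)) z
  have h2 := abs_weight_le (μ := μ) hx₀ (scale_nonneg j) z
  have h3 : scale j ^ 2 ≤ scale (j + 1) ^ 2 :=
    pow_le_pow_left₀ (scale_nonneg j) (scale_mono_succ j) 2
  have h4 : scale (j + 1) ^ 2 = 4 ^ j := by
    simp only [scale]; rw [← pow_mul, mul_comm, pow_mul]; norm_num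
  rw [h4] at h1 h3
  change |weight μ x₀ (scale (j + 1)) z - weight μ x₀ (scale j) z| ≤ _
  have h5 := abs_sub (weight μ x₀ (scale (j + 1)) z) (weight μ x₀ (scale j) z)
  have h6 := mul_le_mul_of_nonneg_left h3 (weightBound_pos μ).le
  unfold weightBound at *
  linarith

lemma integral_weight_scale_sq_le (hx₀ : ‖x₀‖ ≤ 1) (j : ℕ) :
    ∫ z, weight μ x₀ (scale j) z ^ 2 ∂design ≤ weightConst μ * scale j ^ 3 := by
  cases j with
  | zero => simp [scale, weight, filterKernel_zero]
  | succ j => exact integral_weight_sq_le hx₀ (one_le_pow₀ (by norm_num))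

lemma integral_incWeight_sq_le (hx₀ : ‖x₀‖ ≤ 1) (j : ℕ) :
    ∫ z, incWeight μ x₀ j z ^ 2 ∂design ≤ noiseConst μ * 8 ^ j := by
  have h1 := integral_weight_scale_sq_le (μ := μ) hx₀ (j + 1)
  have h2 := integral_weight_scale_sq_le (μ := μ) hx₀ j
  have h3 : scale j ^ 3 ≤ scale (j + 1) ^ 3 :=
    pow_le_pow_left₀ (scale_nonneg j) (scale_mono_succ j) 3
  have h4 : scale (j + 1) ^ 3 = 8 ^ j := by
    simp only [scale]; rw [← pow_mul, mul_comm, pow_mul]; norm_num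
  rw [h4] at h1 h3
  have hi1 : Integrable (fun z => weight μ x₀ (scale (j + 1)) z ^ 2) design :=
    integrable_design (by fun_prop)
  have hi2 : Integrable (fun z => weight μ x₀ (scale j) z ^ 2) design :=
    integrable_design (by fun_prop)
  calc ∫ z, incWeight μ x₀ j z ^ 2 ∂design
      ≤ ∫ z, (2 * weight μ x₀ (scale (j + 1)) z ^ 2 + 2 * weight μ x₀ (scale j) z ^ 2)
          ∂design := by
        refine integral_mono (integrable_design (by fun_prop))
          ((hi1.const_mul 2).add (hi2.const_mul 2)) fun z => ?_
        simp only [incWeight]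
        nlinarith [sq_nonneg (weight μ x₀ (scale (j + 1)) z + weight μ x₀ (scale j) z)]
    _ = 2 * ∫ z, weight μ x₀ (scale (j + 1)) z ^ 2 ∂design +
          2 * ∫ z, weight μ x₀ (scale j) z ^ 2 ∂design := by
        rw [integral_add (hi1.const_mul 2) (hi2.const_mul 2), integral_const_mul,
          integral_const_mul]
    _ ≤ noiseConst μ * 8 ^ j := by
        have h6 := mul_le_mul_of_nonneg_left h3 (weightConst_pos μ).le
        have h7 : 0 ≤ weightBound μ ^ 2 * 8 ^ j := by positivity
        unfold noiseConst
        linarith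

lemma integral_incWeight_mul_expRadon (hf : IsDiscFunction f) (x₀ : Plane) (j : ℕ) :
    ∫ z, incWeight μ x₀ j z * expRadon μ f z ∂design =
      lowPass f x₀ (scale (j + 1)) - lowPass f x₀ (scale j) := by
  have hT := continuous_expRadon (μ := μ) hf
  simp only [incWeight, sub_mul]
  rw [integral_sub (integrable_design (by fun_prop)) (integrable_design (by fun_prop)),
    integral_weight_mul_expRadon hf x₀ (scale_nonneg _),
    integral_weight_mul_expRadon hf x₀ (scale_nonneg _)]

/-- The noise level `√(V 8^j log n / n)` of the `j`-th increment: a bound for its standard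
deviation, times `√(log n)`. -/
def noiseLevel (μ : ℝ) (n j : ℕ) : ℝ := Real.sqrt (noiseConst μ * 8 ^ j * Real.log n / n)

/-- The factor of the noise level used as threshold. The summand `2` leaves a mean squared excess of
order `n⁻²`. -/
def thresholdConst (μ σ L : ℝ) : ℝ := mgfConst σ (2 * (Real.exp |μ| * L)) + 2

/-- The adaptive estimator: the increments of the low-pass estimators between dyadic scales are
soft-thresholded and added up to a scale of order `n^{1/3}`. It does not involve the smoothness. -/
def adaptiveEst (μ σ L : ℝ) (x₀ : Plane) : Estimator := fun n =>
  ⟨fun d => ∑ j ∈ Finset.range (Nat.log 8 n),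
    soft (thresholdConst μ σ L * noiseLevel μ n j) (linEst (incWeight μ x₀ j) n d), by
    refine Finset.measurable_sum _ fun j _ => (continuous_soft _).measurable.comp ?_
    exact measurable_linEst (continuous_incWeight μ x₀ j).measurable n⟩

/-- The noise in an increment rarely exceeds its threshold. -/
lemma lintegral_increment_excess_le (hx₀ : ‖x₀‖ ≤ 1) (hf : f ∈ smoothClass C L β)
    {n j : ℕ} (hn : 3 ≤ n) (hj : 8 ^ j ≤ n) :
    ∫⁻ d, ENNReal.ofReal (max (|linEst (incWeight μ x₀ j) n d -
        (lowPass f x₀ (scale (j + 1)) - lowPass f x₀ (scale j))| -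
        thresholdConst μ σ L * noiseLevel μ n j) 0 ^ 2) ∂sampleLaw μ σ n f ≤
      ENNReal.ofReal (4 * noiseConst μ / (n : ℝ) ^ 2) := by
  have hd := isDiscFunction_of_mem hf
  have hn0 : (0 : ℝ) < n := by positivity
  have hn3 : (3 : ℝ) ≤ n := by exact_mod_cast hn
  have hV := noiseConst_pos μ
  have hj' : (8 : ℝ) ^ j ≤ n := by exact_mod_cast hj
  set l := Real.log n with hl
  have hl1 : 1 ≤ l := by
    rw [hl, Real.le_log_iff_exp_le hn0]
    linarith [Real.exp_one_lt_d9]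
  set v := noiseConst μ * 8 ^ j with hv
  have hv0 : 0 < v := by positivity
  set t := Real.sqrt (n * l / v) with ht
  have ht0 : 0 < t := Real.sqrt_pos.2 (by positivity)
  have ht2 : t ^ 2 = n * l / v := Real.sq_sqrt (by positivity)
  have hsqrt : l ≤ 2 * Real.sqrt n := by
    have h1 := Real.log_le_sub_one_of_pos (Real.sqrt_pos.2 hn0)
    rw [Real.log_sqrt hn0.le] at h1
    linarith
  have h2j : (2 : ℝ) ^ j ≤ Real.sqrt n := by
    refine Real.le_sqrt_of_sq_le ?_
    refine le_trans ?_ hj'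
    rw [← pow_mul, mul_comm, pow_mul]
    exact pow_le_pow_left₀ (by norm_num) (by norm_num) j
  have htW : t * (2 * weightBound μ * 4 ^ j) ≤ n := by
    refine le_of_sq_le_sq ?_ hn0.le
    rw [mul_pow, ht2, div_mul_eq_mul_div, div_le_iff₀ hv0]
    have h16 : ((4 : ℝ) ^ j) ^ 2 = 8 ^ j * 2 ^ j := by
      rw [← pow_mul, mul_comm, pow_mul, ← mul_pow]; norm_num
    have hll : l * 2 ^ j ≤ 2 * n := by
      calc l * 2 ^ j ≤ 2 * Real.sqrt n * Real.sqrt n := by gcongr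
        _ = 2 * n := by rw [mul_assoc, Real.mul_self_sqrt hn0.le]
    calc n * l * (2 * weightBound μ * 4 ^ j) ^ 2
        = n * (4 * weightBound μ ^ 2) * 8 ^ j * (l * 2 ^ j) := by
          rw [mul_pow, h16]; ring
      _ ≤ n * (4 * weightBound μ ^ 2) * 8 ^ j * (2 * n) := by gcongr
      _ = (n : ℝ) ^ 2 * ((8 * weightBound μ ^ 2) * 8 ^ j) := by ring
      _ ≤ (n : ℝ) ^ 2 * v := by
          rw [hv]; gcongr; unfold noiseConst; linarith [weightConst_pos μ]
  have h := lintegral_excess_sq_le (μ := μ) (σ := σ) hd (abs_expRadon_le_of_mem hf)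
    (continuous_incWeight μ x₀ j) (abs_incWeight_le hx₀ j) (integral_incWeight_sq_le hx₀ j)
    (by omega : 0 < n) ht0 htW (thresholdConst μ σ L * noiseLevel μ n j)
  rw [integral_incWeight_mul_expRadon hd] at h
  refine h.trans (ENNReal.ofReal_le_ofReal ?_)
  -- the threshold is such that the exponent equals `-2 log n`
  have htn : t * noiseLevel μ n j = l := by
    rw [ht, noiseLevel, ← Real.sqrt_mul (by positivity)]
    rw [show n * l / v * (noiseConst μ * 8 ^ j * Real.log n / n) = l ^ 2 by
      rw [← hv, ← hl]; field_simp]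
    exact Real.sqrt_sq (by linarith)
  have hexp : mgfConst σ (2 * (Real.exp |μ| * L)) * t ^ 2 * (v / n) -
      t * (thresholdConst μ σ L * noiseLevel μ n j) = -2 * l := by
    rw [mul_left_comm t, htn, ht2, thresholdConst]
    field_simp
    ring
  have he : Real.exp (-2 * l) = ((n : ℝ) ^ 2)⁻¹ := by
    rw [show -2 * l = -(l + l) by ring, Real.exp_neg, Real.exp_add, hl, Real.exp_log hn0, sq]
  rw [← hv, hexp, he, ht2, div_eq_mul_inv (4 * noiseConst μ)]
  gcongr
  rw [div_le_iff₀ (by positivity), mul_div_assoc', le_div_iff₀ hv0]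
  have : v ≤ noiseConst μ * n := by rw [hv]; gcongr
  nlinarith [mul_pos hV hn0]

/-- The deterministic part of the error of the adaptive estimator: thresholds up to an arbitrary
scale `k`, signal beyond it. -/
lemma sum_min_add_tailMass_le (hC : 0 ≤ C) (hβ : 1 < β) (hf : f ∈ sobolevBall β C)
    (x₀ : Plane) (τ : ℕ → ℝ) {k J : ℕ} (hk : k ≤ J) :
    ∑ j ∈ Finset.range J,
        min |lowPass f x₀ (scale (j + 1)) - lowPass f x₀ (scale j)| (2 * τ j) +
      tailMass f x₀ (scale J) ≤ 2 * ∑ j ∈ Finset.range k, τ j + tailMass f x₀ (scale k) := by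
  induction J, hk using Nat.le_induction with
  | base =>
    rw [Finset.mul_sum]
    gcongr
    exact min_le_right _ _
  | succ J _ ih =>
    rw [Finset.sum_range_succ]
    have h1 := abs_lowPass_sub_lowPass_le hC hβ (scale_mono_succ J) hf x₀
    have h2 := min_le_left |lowPass f x₀ (scale (J + 1)) - lowPass f x₀ (scale J)| (2 * τ J)
    linarith

lemma lowPass_zero (hf : IsDiscFunction f) (x₀ : Plane) : lowPass f x₀ 0 = 0 := by
  rw [← integral_weight_mul_expRadon (μ := 0) hf x₀ le_rfl]
  simp [weight, filterKernel_zero]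

/-- The error of the adaptive estimator, split into a deterministic part and the excesses of the
noise in the increments. -/
lemma abs_adaptiveEst_sub_le (hC : 0 ≤ C) (hβ : 1 < β) (hf : f ∈ smoothClass C L β)
    {n : ℕ} (d : Fin n → Obs) {k : ℕ} (hk : k ≤ Nat.log 8 n) :
    |(adaptiveEst μ σ L x₀ n).1 d - f x₀| ≤
      (2 * ∑ j ∈ Finset.range k, thresholdConst μ σ L * noiseLevel μ n j +
        tailMass f x₀ (scale k)) +
      ∑ j ∈ Finset.range (Nat.log 8 n), max (|linEst (incWeight μ x₀ j) n d -
        (lowPass f x₀ (scale (j + 1)) - lowPass f x₀ (scale j))| -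
        thresholdConst μ σ L * noiseLevel μ n j) 0 := by
  set J := Nat.log 8 n
  have hsum : ∑ j ∈ Finset.range J, (lowPass f x₀ (scale (j + 1)) - lowPass f x₀ (scale j)) =
      lowPass f x₀ (scale J) := by
    rw [Finset.sum_range_sub (fun j => lowPass f x₀ (scale j))]
    simp [scale, lowPass_zero (isDiscFunction_of_mem hf)]
  have hthr : ∀ j, 0 ≤ thresholdConst μ σ L * noiseLevel μ n j := fun j => by
    have := mgfConst_nonneg σ (2 * (Real.exp |μ| * L))
    unfold thresholdConst noiseLevel
    positivity
  have hdec : (adaptiveEst μ σ L x₀ n).1 d - f x₀ =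
      ∑ j ∈ Finset.range J, (soft (thresholdConst μ σ L * noiseLevel μ n j)
        (linEst (incWeight μ x₀ j) n d) -
          (lowPass f x₀ (scale (j + 1)) - lowPass f x₀ (scale j))) +
      (lowPass f x₀ (scale J) - f x₀) := by
    rw [Finset.sum_sub_distrib, hsum]
    simp only [adaptiveEst, J]
    ring
  have hdet := sum_min_add_tailMass_le hC hβ hf.1 x₀
    (fun j => thresholdConst μ σ L * noiseLevel μ n j) hk
  rw [hdec]
  refine (abs_add_le _ _).trans ?_
  have h1 := abs_lowPass_sub_le hC hβ hf.1 x₀ (scale J)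
  have h2 := (Finset.abs_sum_le_sum_abs (fun j => soft (thresholdConst μ σ L * noiseLevel μ n j)
        (linEst (incWeight μ x₀ j) n d) -
          (lowPass f x₀ (scale (j + 1)) - lowPass f x₀ (scale j))) (Finset.range J)).trans
    (Finset.sum_le_sum fun j _ => abs_soft_sub_le (hthr j) _ _)
  rw [Finset.sum_add_distrib] at h2
  linarith

/-- The risk of the adaptive estimator at an arbitrary scale `k`, which may be chosen according to
the smoothness. -/
lemma risk_adaptiveEst_le (hx₀ : ‖x₀‖ ≤ 1) (hC : 0 ≤ C) (hβ : 1 < β)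
    (hf : f ∈ smoothClass C L β) {n : ℕ} (hn : 3 ≤ n) {k : ℕ} (hk : k ≤ Nat.log 8 n) :
    risk μ σ x₀ (adaptiveEst μ σ L x₀ n) f ≤
      ENNReal.ofReal (2 * (2 * ∑ j ∈ Finset.range k, thresholdConst μ σ L * noiseLevel μ n j +
        tailMass f x₀ (scale k)) ^ 2 + 8 * noiseConst μ / n) := by
  set D := 2 * ∑ j ∈ Finset.range k, thresholdConst μ σ L * noiseLevel μ n j +
        tailMass f x₀ (scale k) with hD
  set J := Nat.log 8 n with hJ
  have hn0 : (0 : ℝ) < n := by positivity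
  have hV := noiseConst_pos μ
  have hJn : 8 ^ J ≤ n := Nat.pow_log_le_self 8 (by omega)
  set e : ℕ → (Fin n → Obs) → ℝ := fun j d => max (|linEst (incWeight μ x₀ j) n d -
        (lowPass f x₀ (scale (j + 1)) - lowPass f x₀ (scale j))| -
        thresholdConst μ σ L * noiseLevel μ n j) 0 with he
  have hem : ∀ j, Measurable (e j) := fun j => by
    have := measurable_linEst (continuous_incWeight μ x₀ j).measurable n
    simp only [he]; fun_prop
  have hpt : ∀ d : Fin n → Obs, ((adaptiveEst μ σ L x₀ n).1 d - f x₀) ^ 2 ≤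
      2 * D ^ 2 + 2 * J * ∑ j ∈ Finset.range J, e j d ^ 2 := by
    intro d
    have h1 := abs_adaptiveEst_sub_le (σ := σ) (μ := μ) (x₀ := x₀) hC hβ hf d hk
    have h2 : ((adaptiveEst μ σ L x₀ n).1 d - f x₀) ^ 2 ≤
        (D + ∑ j ∈ Finset.range J, e j d) ^ 2 := by
      rw [← sq_abs]; exact pow_le_pow_left₀ (abs_nonneg _) h1 2
    have h3 := sq_sum_le_card_mul_sum_sq (s := Finset.range J) (f := fun j => e j d)
    rw [Finset.card_range] at h3
    nlinarith [sq_nonneg (D - ∑ j ∈ Finset.range J, e j d)]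
  have hprob := isProbabilityMeasure_obsLaw (μ := μ) σ (isDiscFunction_of_mem hf)
  have hprob' : IsProbabilityMeasure (sampleLaw μ σ n f) := by unfold sampleLaw; infer_instance
  calc risk μ σ x₀ (adaptiveEst μ σ L x₀ n) f
      ≤ ∫⁻ d, (ENNReal.ofReal (2 * D ^ 2) + ENNReal.ofReal (2 * J) *
          ∑ j ∈ Finset.range J, ENNReal.ofReal (e j d ^ 2)) ∂sampleLaw μ σ n f := by
        refine lintegral_mono fun d => ?_
        rw [← ENNReal.ofReal_sum_of_nonneg fun _ _ => sq_nonneg _,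
          ← ENNReal.ofReal_mul (by positivity),
          ← ENNReal.ofReal_add (by positivity)
            (mul_nonneg (by positivity) (Finset.sum_nonneg fun _ _ => sq_nonneg _))]
        exact ENNReal.ofReal_le_ofReal (hpt d)
    _ = ENNReal.ofReal (2 * D ^ 2) + ENNReal.ofReal (2 * J) *
          ∑ j ∈ Finset.range J, ∫⁻ d, ENNReal.ofReal (e j d ^ 2) ∂sampleLaw μ σ n f := by
        rw [lintegral_add_left measurable_const, lintegral_const, measure_univ, mul_one,
          lintegral_const_mul' _ _ ENNReal.ofReal_ne_top, lintegral_finsetSum]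
        intro j _
        have := hem j
        fun_prop
    _ ≤ ENNReal.ofReal (2 * D ^ 2) + ENNReal.ofReal (2 * J) *
          ∑ j ∈ Finset.range J, ENNReal.ofReal (4 * noiseConst μ / (n : ℝ) ^ 2) := by
        gcongr with j hj
        refine lintegral_increment_excess_le hx₀ hf hn ?_
        exact (Nat.pow_le_pow_right (by norm_num) (Finset.mem_range.1 hj).le).trans hJn
    _ ≤ _ := by
        rw [← ENNReal.ofReal_sum_of_nonneg fun _ _ => by positivity,
          ← ENNReal.ofReal_mul (by positivity), ← ENNReal.ofReal_add (by positivity)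
          (mul_nonneg (by positivity) (Finset.sum_nonneg fun _ _ => by positivity))]
        refine ENNReal.ofReal_le_ofReal ?_
        rw [Finset.sum_const, Finset.card_range, nsmul_eq_mul]
        have hJ2 : (J : ℝ) ^ 2 ≤ n := by
          have h1 : J ^ 2 ≤ 8 ^ J := by
            calc J ^ 2 ≤ (2 ^ J) ^ 2 := Nat.pow_le_pow_left Nat.lt_two_pow_self.le 2
              _ = 4 ^ J := by rw [← pow_mul, mul_comm, pow_mul]; norm_num
              _ ≤ 8 ^ J := Nat.pow_le_pow_left (by norm_num) J
          exact_mod_cast h1.trans hJn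
        have h2 : 2 * (J : ℝ) * (J * (4 * noiseConst μ / (n : ℝ) ^ 2)) =
            8 * noiseConst μ * (J : ℝ) ^ 2 / (n : ℝ) ^ 2 := by ring
        rw [h2]
        have h3 : 8 * noiseConst μ * (J : ℝ) ^ 2 / (n : ℝ) ^ 2 ≤ 8 * noiseConst μ / n := by
          rw [div_le_div_iff₀ (by positivity) hn0]
          calc 8 * noiseConst μ * (J : ℝ) ^ 2 * n ≤ 8 * noiseConst μ * n * n := by gcongr
            _ = 8 * noiseConst μ * (n : ℝ) ^ 2 := by ring
        linarith

end

/-! ### The adaptive estimator attains the logarithmic rate -/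

section

variable {f : Plane → ℝ} {μ σ C L β β₁ : ℝ} {x₀ : Plane}

lemma sum_pow_le_two_mul {q : ℝ} (hq : 2 ≤ q) (m : ℕ) :
    ∑ j ∈ Finset.range (m + 1), q ^ j ≤ 2 * q ^ m := by
  induction m with
  | zero => norm_num
  | succ m ih =>
    rw [Finset.sum_range_succ]
    have h : 0 < q ^ m := by positivity
    have h2 : q ^ (m + 1) = q ^ m * q := pow_succ q m
    nlinarith

lemma sum_noiseLevel_le (μ : ℝ) (n m : ℕ) :
    ∑ j ∈ Finset.range (m + 1), noiseLevel μ n j ≤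
      2 * Real.sqrt (noiseConst μ * 8 ^ m * (Real.log n / n)) := by
  have hV := noiseConst_pos μ
  have hl : 0 ≤ Real.log n := Real.log_natCast_nonneg n
  have hs : ∀ j : ℕ, Real.sqrt 8 ^ j = Real.sqrt (8 ^ j) := fun j => by
    rw [← Real.sqrt_sq (pow_nonneg (Real.sqrt_nonneg 8) j), ← pow_mul, mul_comm, pow_mul,
      Real.sq_sqrt (by norm_num)]
  have h1 : ∀ j, noiseLevel μ n j =
      Real.sqrt (noiseConst μ * (Real.log n / n)) * Real.sqrt 8 ^ j := by
    intro j
    rw [noiseLevel, hs, ← Real.sqrt_mul (by positivity)]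
    congr 1; ring
  have h8 : (2 : ℝ) ≤ Real.sqrt 8 := Real.le_sqrt_of_sq_le (by norm_num)
  simp only [h1]
  rw [← Finset.mul_sum]
  refine (mul_le_mul_of_nonneg_left (sum_pow_le_two_mul h8 m) (Real.sqrt_nonneg _)).trans
    (le_of_eq ?_)
  rw [hs, mul_left_comm, ← Real.sqrt_mul (by positivity)]
  congr 2; ring

lemma one_le_log_natCast {n : ℕ} (hn : 3 ≤ n) : 1 ≤ Real.log n := by
  have hn3 : (3 : ℝ) ≤ n := by exact_mod_cast hn
  rw [Real.le_log_iff_exp_le (by linarith)]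
  linarith [Real.exp_one_lt_d9]

lemma logRate_eq_rpow_neg {n : ℕ} (hn : 3 ≤ n) (β : ℝ) :
    logRate n β = ((n : ℝ) / Real.log n) ^ (-((β - 1) / (2 * β + 1))) := by
  have := one_le_log_natCast hn
  rw [logRate, Real.rpow_neg (by positivity), ← Real.inv_rpow (by positivity), inv_div]

lemma logRate_pos {n : ℕ} (hn : 3 ≤ n) (β : ℝ) : 0 < logRate n β := by
  have := one_le_log_natCast hn
  unfold logRate
  have : (0 : ℝ) < n := by positivity
  positivity

lemma one_le_div_log {n : ℕ} (hn : 3 ≤ n) : 1 ≤ (n : ℝ) / Real.log n := by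
  have := one_le_log_natCast hn
  rw [one_le_div (by linarith)]
  exact Real.log_le_self (by positivity)

/-- The risk of the adaptive estimator, uniformly in the smoothness: the deterministic error is
split at the dyadic scale next to `(n / log n)^{1/(2β+1)}`. The condition `hbig` places this scale
among those of the estimator, for all `β ≥ β₁` at once. -/
lemma risk_adaptiveEst_le_logRate (hx₀ : ‖x₀‖ ≤ 1) (hC : 0 ≤ C) (hβ₁ : 1 < β₁) (hβ : β₁ ≤ β)
    (hf : f ∈ smoothClass C L β) {n : ℕ} (hn : 3 ≤ n)
    (hbig : 64 * (n : ℝ) ^ (3 / (2 * β₁ + 1)) ≤ n) :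
    risk μ σ x₀ (adaptiveEst μ σ L x₀ n) f ≤
      ENNReal.ofReal ((2 * (4 * thresholdConst μ σ L * Real.sqrt (8 * noiseConst μ) +
        biasConst C β₁) ^ 2 + 8 * noiseConst μ) * logRate n β ^ 2) := by
  have hβ' : 1 < β := hβ₁.trans_le hβ
  have hl := one_le_log_natCast hn
  have hy := one_le_div_log hn
  have hn0 : (0 : ℝ) < n := by positivity
  have hV := noiseConst_pos μ
  have hthr : 0 ≤ thresholdConst μ σ L := by
    have := mgfConst_nonneg σ (2 * (Real.exp |μ| * L))
    unfold thresholdConst; positivity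
  have hp : 0 < 2 * β + 1 := by linarith
  set y := (n : ℝ) / Real.log n with hydef
  have hy0 : 0 < y := by linarith
  set ψ := logRate n β with hψ
  have hψ0 : 0 < ψ := logRate_pos hn β
  set X := y ^ (1 / (2 * β + 1)) with hX
  have hX1 : 1 ≤ X := Real.one_le_rpow hy (by positivity)
  have hX0 : 0 < X := by linarith
  have hψy : ψ = y ^ (-((β - 1) / (2 * β + 1))) := logRate_eq_rpow_neg hn β
  have hXψ : X ^ (-(β - 1)) = ψ := by
    rw [hX, ← Real.rpow_mul hy0.le, hψy]; congr 1; ring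
  have hX3 : X ^ 3 = y ^ (3 / (2 * β + 1)) := by
    rw [hX, ← Real.rpow_natCast, ← Real.rpow_mul hy0.le]; congr 1; push_cast; ring
  have hψ2 : X ^ 3 * (Real.log n / n) = ψ ^ 2 := by
    rw [hX3, hψy, ← Real.rpow_natCast, ← Real.rpow_mul hy0.le, ← inv_div (n : ℝ), ← hydef,
      ← Real.rpow_neg_one y, ← Real.rpow_add hy0]
    congr 1; push_cast; field_simp; ring
  -- `scale (m + 2) = 2 ^ (m + 1)` is the first dyadic scale beyond `X`
  obtain ⟨m, hm1, hm2⟩ := exists_nat_pow_near hX1 (one_lt_two : (1 : ℝ) < 2)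
  have h8 : (8 : ℝ) ^ (m + 1) ≤ 8 * X ^ 3 := by
    have : (8 : ℝ) ^ (m + 1) = 8 * (2 ^ m) ^ 3 := by
      rw [← pow_mul, mul_comm m 3, pow_mul, pow_succ, mul_comm]; norm_num
    rw [this]; gcongr
  have hk : m + 1 + 1 ≤ Nat.log 8 n := by
    refine Nat.le_log_of_pow_le (by norm_num) ?_
    have h1 : X ^ 3 ≤ (n : ℝ) ^ (3 / (2 * β₁ + 1)) := by
      rw [hX3]
      calc y ^ (3 / (2 * β + 1)) ≤ y ^ (3 / (2 * β₁ + 1)) := by gcongr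
        _ ≤ (n : ℝ) ^ (3 / (2 * β₁ + 1)) := by
          refine Real.rpow_le_rpow hy0.le (div_le_self hn0.le hl) ?_
          have : 0 < 2 * β₁ + 1 := by linarith
          positivity
    have : (8 : ℝ) ^ (m + 1 + 1) ≤ n := by rw [pow_succ]; linarith
    exact_mod_cast this
  refine (risk_adaptiveEst_le hx₀ hC hβ' hf hn hk).trans (ENNReal.ofReal_le_ofReal ?_)
  have htail : tailMass f x₀ (scale (m + 1 + 1)) ≤ biasConst C β₁ * ψ := by
    refine (tailMass_le hC hβ₁ hβ (by simp only [scale]; positivity) hf.1 x₀).trans ?_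
    have hb : 0 ≤ biasConst C β₁ := Real.sqrt_nonneg _
    refine mul_le_mul_of_nonneg_left ?_ hb
    rw [← hXψ]
    exact Real.rpow_le_rpow_of_nonpos hX0 hm2.le (by linarith)
  have hnoise : ∑ j ∈ Finset.range (m + 1 + 1), noiseLevel μ n j ≤
      2 * (Real.sqrt (8 * noiseConst μ) * ψ) := by
    refine (sum_noiseLevel_le μ n (m + 1)).trans ?_
    rw [← Real.sqrt_sq hψ0.le, ← Real.sqrt_mul (by positivity), ← hψ2]
    gcongr 2 * √ ?_
    calc noiseConst μ * 8 ^ (m + 1) * (Real.log n / n)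
        ≤ noiseConst μ * (8 * X ^ 3) * (Real.log n / n) := by gcongr
      _ = _ := by ring
  have hD0 : 0 ≤ 2 * ∑ j ∈ Finset.range (m + 1 + 1), thresholdConst μ σ L * noiseLevel μ n j +
      tailMass f x₀ (scale (m + 1 + 1)) :=
    add_nonneg (mul_nonneg (by norm_num) (Finset.sum_nonneg fun j _ =>
      mul_nonneg hthr (Real.sqrt_nonneg _))) (tailMass_nonneg _ _ _)
  have hD : 2 * ∑ j ∈ Finset.range (m + 1 + 1), thresholdConst μ σ L * noiseLevel μ n j +
      tailMass f x₀ (scale (m + 1 + 1)) ≤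
      (4 * thresholdConst μ σ L * Real.sqrt (8 * noiseConst μ) + biasConst C β₁) * ψ := by
    rw [← Finset.mul_sum]
    have := mul_le_mul_of_nonneg_left hnoise hthr
    linarith
  have hn1 : 1 / (n : ℝ) ≤ ψ ^ 2 := by
    rw [← hψ2]
    calc 1 / (n : ℝ) ≤ 1 * (Real.log n / n) := by rw [one_mul]; gcongr
      _ ≤ X ^ 3 * (Real.log n / n) := by gcongr; exact one_le_pow₀ hX1
  have hD2 := pow_le_pow_left₀ hD0 hD 2
  have h9 := mul_le_mul_of_nonneg_left hn1 (by positivity : 0 ≤ 8 * noiseConst μ)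
  rw [mul_one_div] at h9
  rw [mul_pow] at hD2
  linarith

lemma eventually_const_mul_rpow_le {p : ℝ} (c : ℝ) (hp : p < 1) :
    ∀ᶠ n : ℕ in atTop, c * (n : ℝ) ^ p ≤ n := by
  have h1 : Tendsto (fun n : ℕ => (n : ℝ) ^ (1 - p)) atTop atTop :=
    (tendsto_rpow_atTop (by linarith)).comp tendsto_natCast_atTop_atTop
  filter_upwards [h1.eventually_ge_atTop c, eventually_gt_atTop 0] with n hn hn0
  have h0 : (0 : ℝ) < n := by exact_mod_cast hn0
  calc c * (n : ℝ) ^ p ≤ (n : ℝ) ^ (1 - p) * (n : ℝ) ^ p := by gcongr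
    _ = n := by rw [← Real.rpow_add h0]; simp

lemma attainsRate_of_eventually {B : ℕ → Finset ℝ} {ρ : ℕ → ℝ → ℝ} {T : Estimator} (K : ℝ)
    (h : ∀ᶠ n in atTop, ∀ β ∈ B n, 0 < ρ n β ∧
      ∀ f ∈ smoothClass C L β, risk μ σ x₀ (T n) f ≤ ENNReal.ofReal (K * ρ n β ^ 2)) :
    AttainsRate μ σ C L x₀ B ρ T := by
  refine lt_of_le_of_lt (limsup_le_of_le (a := ENNReal.ofReal K) (by isBoundedDefault) ?_)
    ENNReal.ofReal_lt_top
  filter_upwards [h] with n hn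
  refine iSup₂_le fun β hβ => iSup₂_le fun f hf => ?_
  obtain ⟨hρ, hr⟩ := hn β hβ
  refine (mul_le_mul_right (hr f hf) _).trans ?_
  rw [← ENNReal.ofReal_mul (by positivity)]
  refine ENNReal.ofReal_le_ofReal (le_of_eq ?_)
  field_simp

lemma attainsRate_adaptiveEst {B : ℕ → Finset ℝ} (hx₀ : ‖x₀‖ ≤ 1) (hC : 0 ≤ C) (hβ₁ : 1 < β₁)
    (hB : ∀ n, ∀ β ∈ B n, β₁ ≤ β) :
    AttainsRate μ σ C L x₀ B logRate (adaptiveEst μ σ L x₀) := by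
  refine attainsRate_of_eventually (2 * (4 * thresholdConst μ σ L *
    Real.sqrt (8 * noiseConst μ) + biasConst C β₁) ^ 2 + 8 * noiseConst μ) ?_
  have hp : 3 / (2 * β₁ + 1) < 1 := by rw [div_lt_one (by linarith)]; linarith
  filter_upwards [eventually_const_mul_rpow_le 64 hp, eventually_ge_atTop 3] with n hbig hn β hβ
  exact ⟨logRate_pos hn β, fun f hf =>
    risk_adaptiveEst_le_logRate hx₀ hC hβ₁ (hB n β hβ) hf hn hbig⟩

end

/-! ### The likelihood ratio against the zero function -/

section

variable {f : Plane → ℝ} {μ σ C L β : ℝ} {x₀ : Plane}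

/-- The likelihood ratio of one observation between `f` and the zero function. -/
def likelihoodRatio (μ σ : ℝ) (f : Plane → ℝ) (o : Obs) : ℝ≥0∞ :=
  ENNReal.ofReal (Real.exp ((o.2 * expRadon μ f o.1 - expRadon μ f o.1 ^ 2 / 2) / σ ^ 2))

lemma measurable_likelihoodRatio (hf : IsDiscFunction f) :
    Measurable (likelihoodRatio μ σ f) := by
  have := (continuous_expRadon (μ := μ) hf).measurable
  unfold likelihoodRatio
  fun_prop

/-- The translated Gaussian law has an exponential density. -/
lemma lintegral_gaussianReal_shift (hσ : 0 < σ) (m : ℝ) {g : ℝ → ℝ≥0∞} (hg : Measurable g) :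
    ∫⁻ e, g (m + e) ∂gaussianReal 0 (Real.toNNReal (σ ^ 2)) =
      ∫⁻ e, ENNReal.ofReal (Real.exp ((e * m - m ^ 2 / 2) / σ ^ 2)) * g e
        ∂gaussianReal 0 (Real.toNNReal (σ ^ 2)) := by
  have hv : Real.toNNReal (σ ^ 2) ≠ 0 := by simp [hσ.ne']
  have h1 := lintegral_map (μ := gaussianReal 0 (Real.toNNReal (σ ^ 2))) hg
    (measurable_const_add m)
  rw [← h1, gaussianReal_map_const_add, gaussianReal_of_var_ne_zero _ hv,
    gaussianReal_of_var_ne_zero _ hv,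
    lintegral_withDensity_eq_lintegral_mul _ (measurable_gaussianPDF _ _) hg,
    lintegral_withDensity_eq_lintegral_mul _ (measurable_gaussianPDF _ _) (by fun_prop)]
  refine lintegral_congr fun e => ?_
  simp only [Pi.mul_apply]
  rw [← mul_assoc, gaussianPDF, gaussianPDF, ← ENNReal.ofReal_mul (gaussianPDFReal_nonneg _ _ _),
    gaussianPDFReal, gaussianPDFReal, Real.coe_toNNReal _ (sq_nonneg σ),
    mul_assoc (Real.sqrt _)⁻¹, ← Real.exp_add]
  congr 4
  field_simp
  ring

lemma obsLaw_eq_withDensity (hσ : 0 < σ) (hf : IsDiscFunction f) :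
    obsLaw μ σ f = (obsLaw μ σ 0).withDensity (likelihoodRatio μ σ f) := by
  refine Measure.ext_of_lintegral _ fun g hg => ?_
  have hl := measurable_likelihoodRatio (μ := μ) (σ := σ) hf
  rw [lintegral_obsLaw hf hg, lintegral_withDensity_eq_lintegral_mul _ hl hg,
    lintegral_obsLaw isDiscFunction_zero (hl.mul hg)]
  refine lintegral_congr fun z => ?_
  rw [lintegral_gaussianReal_shift hσ (expRadon μ f z) (g := fun y => g (z, y)) (by fun_prop)]
  simp [expRadon_zero, likelihoodRatio]

lemma sampleLaw_eq_withDensity (hσ : 0 < σ) (hf : IsDiscFunction f) (n : ℕ) :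
    sampleLaw μ σ n f =
      (sampleLaw μ σ n 0).withDensity fun d => ∏ i, likelihoodRatio μ σ f (d i) := by
  have hl := measurable_likelihoodRatio (μ := μ) (σ := σ) hf
  have hp := isProbabilityMeasure_obsLaw (μ := μ) σ hf
  have hp0 := isProbabilityMeasure_obsLaw (μ := μ) σ isDiscFunction_zero
  refine Measure.pi_eq fun s hs => ?_
  rw [withDensity_apply _ (MeasurableSet.univ_pi hs),
    ← lintegral_indicator (MeasurableSet.univ_pi hs)]
  have h1 : ∀ d : Fin n → Obs, (univ.pi s).indicator
      (fun d => ∏ i, likelihoodRatio μ σ f (d i)) d =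
      ∏ i, (s i).indicator (likelihoodRatio μ σ f) (d i) := by
    intro d
    by_cases hd : d ∈ univ.pi s
    · rw [indicator_of_mem hd]
      exact Finset.prod_congr rfl fun i _ => (indicator_of_mem (hd i (mem_univ i)) _).symm
    · rw [indicator_of_notMem hd]
      simp only [Set.mem_pi, mem_univ, true_implies, not_forall] at hd
      obtain ⟨i, hi⟩ := hd
      exact (Finset.prod_eq_zero (Finset.mem_univ i) (indicator_of_notMem hi _)).symm
  simp only [h1]
  rw [sampleLaw, lintegral_pi_prod (obsLaw μ σ 0)
    (g := fun i => (s i).indicator (likelihoodRatio μ σ f)) fun i => hl.indicator (hs i)]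
  refine Finset.prod_congr rfl fun i _ => ?_
  rw [lintegral_indicator (hs i), obsLaw_eq_withDensity hσ hf, withDensity_apply _ (hs i)]

/-- The second moment of the likelihood ratio of one observation: given the design it equals
`e^{T²/σ²}` with `T = T_μ f`, which is at most `1 + 2 T²/σ²` for `|T| ≤ σ`. -/
lemma lintegral_likelihoodRatio_sq_le (hσ : 0 < σ) (hf : IsDiscFunction f)
    (hT : ∀ z, |expRadon μ f z| ≤ σ) {q : ℝ} (hq : ∫ z, expRadon μ f z ^ 2 ∂design ≤ q) :
    ∫⁻ o, likelihoodRatio μ σ f o ^ 2 ∂obsLaw μ σ 0 ≤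
      ENNReal.ofReal (Real.exp (2 * q / σ ^ 2)) := by
  have hl := measurable_likelihoodRatio (μ := μ) (σ := σ) hf
  have hTc := continuous_expRadon (μ := μ) hf
  rw [lintegral_obsLaw isDiscFunction_zero (hl.pow_const 2)]
  have hinner : ∀ z, ∫⁻ e, likelihoodRatio μ σ f (z, expRadon μ 0 z + e) ^ 2
      ∂gaussianReal 0 (Real.toNNReal (σ ^ 2)) ≤
      ENNReal.ofReal (1 + 2 / σ ^ 2 * expRadon μ f z ^ 2) := by
    intro z
    set T := expRadon μ f z with hTz
    have h1 : ∀ e : ℝ, likelihoodRatio μ σ f (z, expRadon μ 0 z + e) ^ 2 =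
        ENNReal.ofReal (Real.exp (-T ^ 2 / σ ^ 2)) *
          ENNReal.ofReal (Real.exp (2 * T / σ ^ 2 * e)) := by
      intro e
      rw [likelihoodRatio, ← ENNReal.ofReal_pow (by positivity),
        ← ENNReal.ofReal_mul (by positivity), ← Real.exp_nat_mul, ← Real.exp_add]
      simp only [expRadon_zero, Pi.zero_apply, zero_add, ← hTz]
      congr 2; push_cast; ring
    simp only [h1]
    rw [lintegral_const_mul' _ _ ENNReal.ofReal_ne_top, lintegral_exp_gaussianReal,
      ← ENNReal.ofReal_mul (by positivity), ← Real.exp_add, Real.coe_toNNReal _ (sq_nonneg σ)]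
    refine ENNReal.ofReal_le_ofReal ?_
    have h2 : -T ^ 2 / σ ^ 2 + σ ^ 2 * (2 * T / σ ^ 2) ^ 2 / 2 = T ^ 2 / σ ^ 2 := by
      field_simp; ring
    rw [h2]
    have h3 : T ^ 2 / σ ^ 2 ≤ 1 := by
      rw [div_le_one (by positivity), ← sq_abs]
      exact pow_le_pow_left₀ (abs_nonneg _) (hT z) 2
    have h4 : 0 ≤ T ^ 2 / σ ^ 2 := by positivity
    have h5 := Real.abs_exp_sub_one_le (x := T ^ 2 / σ ^ 2) (by rwa [abs_of_nonneg h4])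
    rw [abs_of_nonneg h4] at h5
    have h6 := (le_abs_self _).trans h5
    rw [div_mul_eq_mul_div, mul_div_assoc]
    linarith
  refine (lintegral_mono hinner).trans ?_
  have hi : Integrable (fun z => expRadon μ f z ^ 2) design := integrable_design (by fun_prop)
  have hi2 : Integrable (fun z => 1 + 2 / σ ^ 2 * expRadon μ f z ^ 2) design :=
    (integrable_const _).add (hi.const_mul _)
  rw [← ofReal_integral_eq_lintegral_ofReal hi2
    (.of_forall fun z => by positivity)]
  refine ENNReal.ofReal_le_ofReal ?_
  rw [integral_add (integrable_const _) (hi.const_mul _), integral_const_mul, integral_const,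
    probReal_univ, one_smul]
  have h7 := Real.add_one_le_exp (2 * q / σ ^ 2)
  have h8 := mul_le_mul_of_nonneg_left hq (by positivity : 0 ≤ 2 / σ ^ 2)
  have h9 : 2 / σ ^ 2 * q = 2 * q / σ ^ 2 := by ring
  linarith

/-- The constrained risk inequality of Brown and Low: an estimator with small risk at `0` has a
risk at `f` bounded below in terms of the second moment of the likelihood ratio. -/
lemma apply_le_of_risk_le (hσ : 0 < σ) (hf : IsDiscFunction f)
    (hT : ∀ z, |expRadon μ f z| ≤ σ) {q : ℝ} (hq : ∫ z, expRadon μ f z ^ 2 ∂design ≤ q)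
    {n : ℕ} (T : EstimatorAt n) {A₀ A₁ : ℝ} (hA₀ : 0 ≤ A₀) (hA₁ : 0 ≤ A₁)
    (h₁ : risk μ σ x₀ T f ≤ ENNReal.ofReal (A₁ ^ 2))
    (h₀ : risk μ σ x₀ T 0 ≤ ENNReal.ofReal (A₀ ^ 2)) :
    f x₀ ≤ A₁ + A₀ * Real.exp (n * q / σ ^ 2) := by
  have hl := measurable_likelihoodRatio (μ := μ) (σ := σ) hf
  have hp := isProbabilityMeasure_obsLaw (μ := μ) σ hf
  have hp0 := isProbabilityMeasure_obsLaw (μ := μ) σ isDiscFunction_zero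
  have hp' : IsProbabilityMeasure (sampleLaw μ σ n f) := by unfold sampleLaw; infer_instance
  have hTm := T.2
  set LR : (Fin n → Obs) → ℝ≥0∞ := fun d => ∏ i, likelihoodRatio μ σ f (d i) with hLR
  have hLRm : Measurable LR :=
    Finset.measurable_prod _ fun i _ => hl.comp (measurable_pi_apply i)
  have hsqrt : ∀ A : ℝ, 0 ≤ A → ENNReal.ofReal (A ^ 2) ^ (1 / 2 : ℝ) = ENNReal.ofReal A := by
    intro A hA
    rw [ENNReal.ofReal_rpow_of_nonneg (sq_nonneg _) (by norm_num), ← Real.sqrt_eq_rpow,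
      Real.sqrt_sq hA]
  have hpow : ∀ x : ℝ, ENNReal.ofReal |x| ^ (2 : ℝ) = ENNReal.ofReal (x ^ 2) := by
    intro x
    rw [ENNReal.ofReal_rpow_of_nonneg (abs_nonneg _) (by norm_num)]
    norm_num
  have hfirst : ∫⁻ d, ENNReal.ofReal |T.1 d - f x₀| ∂sampleLaw μ σ n f ≤ ENNReal.ofReal A₁ := by
    have h := ENNReal.lintegral_mul_le_Lp_mul_Lq (sampleLaw μ σ n f)
      Real.HolderConjugate.two_two (f := fun d => ENNReal.ofReal |T.1 d - f x₀|)
      (g := fun _ => 1) (Measurable.aemeasurable (by fun_prop)) aemeasurable_const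
    simp only [Pi.mul_def, mul_one, hpow, ENNReal.one_rpow, lintegral_const, measure_univ] at h
    refine h.trans ?_
    rw [← hsqrt A₁ hA₁]
    exact ENNReal.rpow_le_rpow h₁ (by norm_num)
  have hLR2 : ∫⁻ d, LR d ^ (2 : ℝ) ∂sampleLaw μ σ n 0 ≤
      ENNReal.ofReal (Real.exp (n * q / σ ^ 2) ^ 2) := by
    have h1 : ∀ d, LR d ^ (2 : ℝ) = ∏ i, likelihoodRatio μ σ f (d i) ^ 2 := by
      intro d
      rw [ENNReal.rpow_ofNat, hLR, Finset.prod_pow]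
    simp only [h1]
    rw [sampleLaw, lintegral_pi_prod (obsLaw μ σ 0)
      (g := fun (_ : Fin n) o => likelihoodRatio μ σ f o ^ 2) fun _ => hl.pow_const 2,
      Finset.prod_const, Finset.card_univ, Fintype.card_fin]
    calc _ ≤ ENNReal.ofReal (Real.exp (2 * q / σ ^ 2)) ^ n := by
          gcongr
          exact lintegral_likelihoodRatio_sq_le hσ hf hT hq
      _ = _ := by
          rw [← ENNReal.ofReal_pow (by positivity), ← Real.exp_nat_mul, ← Real.exp_nat_mul]
          congr 2; push_cast; ring
  have hsecond : ∫⁻ d, ENNReal.ofReal |T.1 d| ∂sampleLaw μ σ n f ≤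
      ENNReal.ofReal A₀ * ENNReal.ofReal (Real.exp (n * q / σ ^ 2)) := by
    rw [sampleLaw_eq_withDensity hσ hf, lintegral_withDensity_eq_lintegral_mul _ hLRm
      (by fun_prop), mul_comm LR]
    refine (ENNReal.lintegral_mul_le_Lp_mul_Lq _ Real.HolderConjugate.two_two
      (Measurable.aemeasurable (by fun_prop)) hLRm.aemeasurable).trans ?_
    rw [← hsqrt A₀ hA₀, ← hsqrt _ (Real.exp_pos (n * q / σ ^ 2)).le]
    simp only [hpow]
    gcongr
    simpa [risk] using h₀
  have hsum : ENNReal.ofReal (f x₀) ≤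
      ENNReal.ofReal (A₁ + A₀ * Real.exp (n * q / σ ^ 2)) := by
    calc ENNReal.ofReal (f x₀) = ∫⁻ _, ENNReal.ofReal (f x₀) ∂sampleLaw μ σ n f := by
          rw [lintegral_const, measure_univ, mul_one]
      _ ≤ ∫⁻ d, (ENNReal.ofReal |T.1 d - f x₀| + ENNReal.ofReal |T.1 d|)
            ∂sampleLaw μ σ n f := by
          refine lintegral_mono fun d => ?_
          rw [← ENNReal.ofReal_add (abs_nonneg _) (abs_nonneg _)]
          refine ENNReal.ofReal_le_ofReal ?_
          linarith [neg_abs_le (T.1 d - f x₀), le_abs_self (T.1 d)]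
      _ ≤ ENNReal.ofReal A₁ + ENNReal.ofReal A₀ * ENNReal.ofReal (Real.exp (n * q / σ ^ 2)) := by
          rw [lintegral_add_left (by fun_prop)]
          gcongr
      _ = _ := by
          rw [← ENNReal.ofReal_mul hA₀, ← ENNReal.ofReal_add hA₁ (by positivity)]
  exact (ENNReal.ofReal_le_ofReal_iff (by positivity)).1 hsum

end

/-! ### Localized alternatives -/

section

variable {μ σ C L β : ℝ} {x₀ : Plane}

/-- A smooth bump function on the plane, supported in the unit disc. -/
def planeBump : ContDiffBump (0 : Plane) := ⟨1 / 2, 1, by norm_num, by norm_num⟩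

/-- The alternative `a h^{β-1} g((x - x₀)/h)` to the zero function, with the bump function `g`. For
`h → 0` its Sobolev norm of order `β` stays bounded, the Sobolev exponent being shifted by half the
dimension. -/
def alternative (x₀ : Plane) (β a h : ℝ) (x : Plane) : ℝ :=
  a * h ^ (β - 1) * planeBump (h⁻¹ • (x - x₀))

lemma continuous_alternative (x₀ : Plane) (β a h : ℝ) : Continuous (alternative x₀ β a h) := by
  have := planeBump.continuous
  unfold alternative
  fun_prop

lemma planeBump_eq_zero {x : Plane} (hx : 1 ≤ ‖x‖) : planeBump x = 0 :=
  planeBump.zero_of_le_dist (by simpa [planeBump] using hx)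

lemma planeBump_zero : planeBump 0 = 1 :=
  planeBump.one_of_mem_closedBall (by simp [planeBump])

lemma alternative_apply (x₀ : Plane) (β a h : ℝ) : alternative x₀ β a h x₀ = a * h ^ (β - 1) := by
  simp [alternative, planeBump_zero]

lemma alternative_eq_zero {β a h : ℝ} (hh : 0 < h) {x : Plane} (hx : h ≤ ‖x - x₀‖) :
    alternative x₀ β a h x = 0 := by
  rw [alternative, planeBump_eq_zero, mul_zero]
  rw [norm_smul, norm_inv, Real.norm_of_nonneg hh.le, inv_mul_eq_div]
  exact (one_le_div hh).2 hx

lemma abs_alternative_le {a h : ℝ} (ha : 0 ≤ a) (hh : 0 < h) (x : Plane) :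
    |alternative x₀ β a h x| ≤ a * h ^ (β - 1) := by
  have h1 : 0 ≤ planeBump (h⁻¹ • (x - x₀)) := planeBump.nonneg
  have h2 : planeBump (h⁻¹ • (x - x₀)) ≤ 1 := planeBump.le_one
  rw [alternative, abs_of_nonneg (by positivity)]
  exact mul_le_of_le_one_right (by positivity) h2

lemma alternative_eq_zero_of_one_le {a h : ℝ} (hh : 0 < h) (hh1 : h ≤ 1 - ‖x₀‖) {x : Plane}
    (hx : 1 ≤ ‖x‖) : alternative x₀ β a h x = 0 := by
  refine alternative_eq_zero hh ?_
  have := norm_sub_norm_le x x₀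
  linarith

lemma isDiscFunction_alternative {a h : ℝ} (hh : 0 < h) (hh1 : h ≤ 1 - ‖x₀‖) :
    IsDiscFunction (alternative x₀ β a h) :=
  ⟨continuous_alternative x₀ β a h, fun _ hx => alternative_eq_zero_of_one_le hh hh1 hx.le⟩

/-- The exponential Radon transform of the alternative lives in a strip of width `2h` and has
height `O(h^β)`. -/
lemma abs_expRadon_alternative_le {a h : ℝ} (ha : 0 ≤ a) (hh : 0 < h) (hh1 : h ≤ 1 - ‖x₀‖)
    (z : ℝ × ℝ) :
    |expRadon μ (alternative x₀ β a h) z| ≤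
      (Icc (inner ℝ (dir z.1) x₀ - h) (inner ℝ (dir z.1) x₀ + h)).indicator
        (fun _ => 2 * a * Real.exp |μ| * h ^ β) z.2 := by
  obtain ⟨φ, s⟩ := z
  simp only
  set f := alternative x₀ β a h with hf
  by_cases hs : s ∈ Icc (inner ℝ (dir φ) x₀ - h) (inner ℝ (dir φ) x₀ + h)
  · rw [indicator_of_mem hs]
    set c : ℝ := inner ℝ (dirPerp φ) x₀ with hc
    have hzero : ∀ t ∉ Icc (c - h) (c + h),
        Real.exp (μ * t) * f (s • dir φ + t • dirPerp φ) = 0 := by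
      intro t ht
      rw [hf, alternative_eq_zero hh, mul_zero]
      have h1 := abs_inner_dirPerp_le φ (s • dir φ + t • dirPerp φ - x₀)
      rw [inner_sub_right, inner_dirPerp_frame, ← hc] at h1
      refine le_trans ?_ h1
      by_contra hlt
      rw [not_le, abs_lt] at hlt
      exact ht ⟨by linarith, by linarith⟩
    have hbound : ∀ t ∈ Icc (c - h) (c + h),
        ‖Real.exp (μ * t) * f (s • dir φ + t • dirPerp φ)‖ ≤
          Real.exp |μ| * (a * h ^ (β - 1)) := by
      intro t ht
      have hc1 : |c| ≤ ‖x₀‖ := abs_inner_dirPerp_le φ x₀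
      have hc2 := abs_le.1 hc1
      have ht1 : |t| ≤ 1 := abs_le.2 ⟨by linarith [ht.1], by linarith [ht.2]⟩
      rw [norm_mul, Real.norm_of_nonneg (Real.exp_pos _).le]
      gcongr
      · refine (le_abs_self _).trans ?_
        rw [abs_mul]
        exact mul_le_of_le_one_right (abs_nonneg _) ht1
      · exact abs_alternative_le ha hh _
    rw [expRadon, ← setIntegral_eq_integral_of_forall_compl_eq_zero hzero]
    refine (norm_setIntegral_le_of_norm_le_const measure_Icc_lt_top hbound).trans (le_of_eq ?_)
    rw [Measure.real, Real.volume_Icc, ENNReal.toReal_ofReal (by linarith)]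
    have : h ^ β = h ^ (β - 1) * h := by
      rw [← Real.rpow_add_one hh.ne']; congr 1; ring
    rw [this]; ring
  · rw [indicator_of_notMem hs, expRadon, integral_eq_zero_of_ae, abs_zero]
    filter_upwards with t
    rw [hf, alternative_eq_zero hh]
    · simp
    have h1 := abs_inner_dir_le φ (s • dir φ + t • dirPerp φ - x₀)
    rw [inner_sub_right, inner_dir_frame] at h1
    refine le_trans ?_ h1
    by_contra hlt
    rw [not_le, abs_lt] at hlt
    exact hs ⟨by linarith, by linarith⟩

lemma integral_expRadon_alternative_sq_le {a h : ℝ} (ha : 0 ≤ a) (hh : 0 < h)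
    (hh1 : h ≤ 1 - ‖x₀‖) :
    ∫ z, expRadon μ (alternative x₀ β a h) z ^ 2 ∂design ≤
      (2 * a * Real.exp |μ|) ^ 2 * h ^ (2 * β + 1) := by
  have hT := continuous_expRadon (μ := μ) (isDiscFunction_alternative (β := β) (a := a) hh hh1)
  rw [integral_design_iterated (integrableOn_obsCylinder (by fun_prop))]
  set K := (2 * a * Real.exp |μ| * h ^ β) ^ 2 with hK
  have h1 : ∀ φ ∈ Ico 0 (2 * π),
      ‖∫ s in Icc (-1 : ℝ) 1, expRadon μ (alternative x₀ β a h) (φ, s) ^ 2‖ ≤ 2 * h * K := by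
    intro φ _
    rw [Real.norm_of_nonneg (integral_nonneg fun _ => sq_nonneg _)]
    set I := Icc (inner ℝ (dir φ) x₀ - h) (inner ℝ (dir φ) x₀ + h)
    have hi : Integrable (I.indicator fun _ : ℝ => K) :=
      (integrable_indicator_iff measurableSet_Icc).2
        (integrableOn_const measure_Icc_lt_top.ne)
    calc ∫ s in Icc (-1 : ℝ) 1, expRadon μ (alternative x₀ β a h) (φ, s) ^ 2
        ≤ ∫ s in Icc (-1 : ℝ) 1, I.indicator (fun _ : ℝ => K) s := by
          refine setIntegral_mono
            ((Continuous.continuousOn (by fun_prop)).integrableOn_compact isCompact_Icc)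
            hi.integrableOn fun s => ?_
          have := abs_expRadon_alternative_le (μ := μ) (β := β) ha hh hh1 (φ, s)
          simp only at this ⊢
          rw [← sq_abs]
          by_cases hs : s ∈ I
          · rw [indicator_of_mem hs] at this ⊢
            exact pow_le_pow_left₀ (abs_nonneg _) this 2
          · rw [indicator_of_notMem hs] at this ⊢
            rw [le_antisymm this (abs_nonneg _)]; norm_num
      _ ≤ ∫ s : ℝ, I.indicator (fun _ : ℝ => K) s :=
          setIntegral_le_integral hi (.of_forall fun s =>
            indicator_nonneg (fun _ _ => sq_nonneg _) s)
      _ = 2 * h * K := by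
          rw [integral_indicator measurableSet_Icc, setIntegral_const, Measure.real,
            Real.volume_Icc, ENNReal.toReal_ofReal (by linarith), smul_eq_mul]
          ring
  have h3 := norm_setIntegral_le_of_norm_le_const (μ := (volume : Measure ℝ))
    (s := Ico 0 (2 * π)) measure_Ico_lt_top h1
  rw [Measure.real, Real.volume_Ico, sub_zero, ENNReal.toReal_ofReal (by positivity)] at h3
  refine (mul_le_mul_of_nonneg_left ((le_abs_self _).trans h3) (by positivity)).trans
    (le_of_eq ?_)
  have h4 : h ^ (2 * β + 1) = (h ^ β) ^ 2 * h := by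
    rw [Real.rpow_add_one hh.ne', two_mul, Real.rpow_add hh, sq]
  rw [hK, h4]
  field_simp
  norm_num

/-- The Fourier transform of the alternative, by translation and dilation. -/
lemma norm_fourier_alternative {a h : ℝ} (ha : 0 ≤ a) (hh : 0 < h) (w : Plane) :
    ‖𝓕 (fun x : Plane => (alternative x₀ β a h x : ℂ)) w‖ =
      a * h ^ (β - 1) * (h ^ 2 * ‖𝓕 (fun x : Plane => (planeBump x : ℂ)) (h • w)‖) := by
  rw [Real.fourier_eq', Real.fourier_eq']
  have h1 : ∀ x : Plane, Complex.exp (↑(-2 * π * inner ℝ x w) * Complex.I) •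
      (alternative x₀ β a h x : ℂ) =
      ((a * h ^ (β - 1) : ℝ) : ℂ) * (Complex.exp (↑(-2 * π * inner ℝ x₀ w) * Complex.I) *
        (fun u : Plane => Complex.exp (↑(-2 * π * inner ℝ u (h • w)) * Complex.I) •
          (planeBump u : ℂ)) (h⁻¹ • (x - x₀))) := by
    intro x
    have h2 : Complex.exp (↑(-2 * π * inner ℝ x w) * Complex.I) =
        Complex.exp (↑(-2 * π * inner ℝ x₀ w) * Complex.I) *
          Complex.exp (↑(-2 * π * inner ℝ (h⁻¹ • (x - x₀)) (h • w)) * Complex.I) := by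
      rw [← Complex.exp_add, ← add_mul, ← Complex.ofReal_add, real_inner_smul_left,
        real_inner_smul_right, inv_mul_cancel_left₀ hh.ne', inner_sub_left]
      congr 3
      ring
    simp only [smul_eq_mul, alternative, h2]
    push_cast
    ring
  have h3 := Measure.integral_comp_smul (volume : Measure Plane) (fun u : Plane =>
    Complex.exp (↑(-2 * π * inner ℝ u (h • w)) * Complex.I) • (planeBump u : ℂ)) h⁻¹
  have h4 := integral_sub_right_eq_self (μ := (volume : Measure Plane)) (fun y : Plane =>
    (fun u : Plane => Complex.exp (↑(-2 * π * inner ℝ u (h • w)) * Complex.I) •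
      (planeBump u : ℂ)) (h⁻¹ • y)) x₀
  simp only [h1]
  rw [integral_const_mul, integral_const_mul, h4, h3, norm_mul, norm_mul, norm_smul,
    Complex.norm_exp_ofReal_mul_I, Complex.norm_real, finrank_euclideanSpace, Fintype.card_fin,
    one_mul, Real.norm_of_nonneg (by positivity), inv_pow, inv_inv, abs_of_nonneg (by positivity),
    Real.norm_of_nonneg (by positivity)]

/-- The Sobolev energy of the bump function. -/
def bumpEnergy (β : ℝ) : ℝ≥0∞ := ∫⁻ w : Plane, ENNReal.ofReal
  ((1 + (2 * π * ‖w‖) ^ 2) ^ β * ‖𝓕 (fun x : Plane => (planeBump x : ℂ)) w‖ ^ 2)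

/-- The energy is finite, as the Fourier transform of the bump function is a Schwartz function. -/
lemma bumpEnergy_lt_top (hβ : 0 ≤ β) : bumpEnergy β < ⊤ := by
  have hcs : HasCompactSupport fun x : Plane => (planeBump x : ℂ) :=
    planeBump.hasCompactSupport.comp_left Complex.ofReal_zero
  have hcd : ContDiff ℝ ((⊤ : ℕ∞) : WithTop ℕ∞) fun x : Plane => (planeBump x : ℂ) :=
    Complex.ofRealCLM.contDiff.comp planeBump.contDiff
  obtain ⟨k, hk⟩ := exists_nat_ge (β + 2)
  obtain ⟨D, hD⟩ : ∃ D : ℝ, ∀ w : Plane,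
      (1 + ‖w‖) ^ k * ‖𝓕 (fun x : Plane => (planeBump x : ℂ)) w‖ ≤ D := by
    have h1 := fun w : Plane => SchwartzMap.one_add_le_sup_seminorm_apply (𝕜 := ℝ) (m := (k, 0))
      le_rfl le_rfl (𝓕 (hcs.toSchwartzMap hcd)) w
    simp only [norm_iteratedFDeriv_zero, SchwartzMap.fourier_coe] at h1
    exact ⟨_, h1⟩
  have hint : Integrable fun w : Plane => (2 * π) ^ (2 * β) * D ^ 2 * (1 + ‖w‖) ^ (-4 : ℝ) :=
    (integrable_one_add_norm (by rw [finrank_euclideanSpace, Fintype.card_fin]; norm_num)).const_mul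
      _
  refine lt_of_le_of_lt (lintegral_mono fun w => ENNReal.ofReal_le_ofReal ?_)
    hint.lintegral_lt_top
  set r := ‖w‖
  have hr : 0 ≤ r := norm_nonneg w
  have hr1 : 0 < 1 + r := by linarith
  set y := ‖𝓕 (fun x : Plane => (planeBump x : ℂ)) w‖
  have h1 : (1 + (2 * π * r) ^ 2) ^ β ≤ (2 * π) ^ (2 * β) * (1 + r) ^ (2 * β) := by
    rw [Real.rpow_mul (by positivity), Real.rpow_mul hr1.le,
      ← Real.mul_rpow (by positivity) (by positivity)]
    refine Real.rpow_le_rpow (by positivity) ?_ hβ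
    rw [show (2 : ℝ) = ((2 : ℕ) : ℝ) by norm_num, Real.rpow_natCast, Real.rpow_natCast]
    push_cast
    nlinarith [Real.pi_gt_three, mul_nonneg hr (sq_nonneg (2 * π))]
  have h2 : (1 + r) ^ (2 * β) * y ^ 2 ≤ D ^ 2 * (1 + r) ^ (-4 : ℝ) := by
    have h3 : ((1 + r) ^ k * y) ^ 2 ≤ D ^ 2 :=
      pow_le_pow_left₀ (by positivity) (hD w) 2
    have h4 : (1 + r) ^ (2 * β) ≤ ((1 + r) ^ k) ^ 2 * (1 + r) ^ (-4 : ℝ) := by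
      rw [← pow_mul, ← Real.rpow_natCast, ← Real.rpow_add hr1]
      refine Real.rpow_le_rpow_of_exponent_le (by linarith) ?_
      push_cast
      linarith
    calc (1 + r) ^ (2 * β) * y ^ 2 ≤ ((1 + r) ^ k) ^ 2 * (1 + r) ^ (-4 : ℝ) * y ^ 2 := by gcongr
      _ = ((1 + r) ^ k * y) ^ 2 * (1 + r) ^ (-4 : ℝ) := by ring
      _ ≤ _ := by gcongr
  calc _ ≤ (2 * π) ^ (2 * β) * (1 + r) ^ (2 * β) * y ^ 2 := by gcongr
    _ = (2 * π) ^ (2 * β) * ((1 + r) ^ (2 * β) * y ^ 2) := by ring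
    _ ≤ (2 * π) ^ (2 * β) * (D ^ 2 * (1 + r) ^ (-4 : ℝ)) := by gcongr
    _ = _ := by ring

lemma alternative_mem_smoothClass (hβ : 1 < β) {a h : ℝ} (ha : 0 ≤ a) (hh : 0 < h)
    (hh1 : h ≤ 1 - ‖x₀‖) (haL : a ≤ L) (haC : ENNReal.ofReal (a ^ 2) * bumpEnergy β ≤
      ENNReal.ofReal C) : alternative x₀ β a h ∈ smoothClass C L β := by
  have hd := isDiscFunction_alternative (x₀ := x₀) (β := β) (a := a) hh hh1
  have hle1 : h ≤ 1 := by linarith [norm_nonneg x₀]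
  refine ⟨⟨hd.continuous, hd.integrable, ?_⟩, ?_, .of_forall fun x => hd.continuous.continuousAt,
    fun x => (abs_alternative_le ha hh x).trans ?_⟩
  · rw [lintegral_sobolev_eq hd.integrable]
    refine le_trans ?_ haC
    set G : Plane → ℝ≥0∞ := fun w => ENNReal.ofReal
      ((1 + (2 * π * ‖w‖) ^ 2) ^ β * ‖𝓕 (fun x : Plane => (planeBump x : ℂ)) w‖ ^ 2) with hG
    have hGm : Measurable G := by
      have := (continuous_fourier_of_integrable (planeBump.integrable (μ := volume))).measurable
      simp only [hG]
      fun_prop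
    have hpt : ∀ w : Plane, ENNReal.ofReal ((1 + (2 * π * ‖w‖) ^ 2) ^ β *
        ‖𝓕 (fun x : Plane => (alternative x₀ β a h x : ℂ)) w‖ ^ 2) ≤
        ENNReal.ofReal (a ^ 2 * h ^ 2) * G (h • w) := by
      intro w
      rw [norm_fourier_alternative ha hh, hG, ← ENNReal.ofReal_mul (by positivity)]
      refine ENNReal.ofReal_le_ofReal ?_
      rw [norm_smul, Real.norm_of_nonneg hh.le]
      have h1 : (h ^ β) ^ 2 * (1 + (2 * π * ‖w‖) ^ 2) ^ β ≤
          (1 + (2 * π * (h * ‖w‖)) ^ 2) ^ β := by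
        rw [← Real.rpow_natCast (h ^ β), ← Real.rpow_mul hh.le, mul_comm β,
          Real.rpow_mul hh.le, ← Real.mul_rpow (by positivity) (by positivity)]
        refine Real.rpow_le_rpow (by positivity) ?_ (by linarith)
        rw [Real.rpow_natCast]
        nlinarith [pow_le_one₀ hh.le hle1 (n := 2)]
      have h2 : h ^ β = h ^ (β - 1) * h := by
        rw [← Real.rpow_add_one hh.ne']; congr 1; ring
      rw [h2] at h1
      calc _ = a ^ 2 * h ^ 2 * (((h ^ (β - 1) * h) ^ 2 * (1 + (2 * π * ‖w‖) ^ 2) ^ β) *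
            ‖𝓕 (fun x : Plane => (planeBump x : ℂ)) (h • w)‖ ^ 2) := by ring
        _ ≤ _ := by gcongr
    refine (lintegral_mono hpt).trans ?_
    rw [lintegral_const_mul' _ _ ENNReal.ofReal_ne_top, lintegral_comp_smul_plane hGm hh,
      ← mul_assoc, ← ENNReal.ofReal_mul (by positivity), mul_assoc,
      mul_inv_cancel₀ (by positivity), mul_one]
    rfl
  · refine closure_minimal (fun x hx => ?_) Metric.isClosed_closedBall
    rw [mem_closedBall_zero_iff]
    by_contra hlt
    exact hx (hd.support x (not_le.1 hlt))
  · refine le_trans ?_ haL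
    exact mul_le_of_le_one_right ha (Real.rpow_le_one hh.le hle1 (by linarith))

lemma zero_mem_smoothClass (hL : 0 ≤ L) : (0 : Plane → ℝ) ∈ smoothClass C L β := by
  refine ⟨⟨continuous_zero, integrable_zero _ _ _, ?_⟩, by simp,
    .of_forall fun x => continuous_zero.continuousAt, by simpa using hL⟩
  have : ∀ ξ : Plane, fourierU 0 ξ = 0 := fun ξ => by simp [fourierU, Real.fourier_eq']
  simp [this]

/-- The trade-off between the risk at the zero function and the maximum risk over a smoothness
class, at every bandwidth `h`. -/
lemma exists_tradeoff (hσ : 0 < σ) (hC : 0 < C) (hL : 0 < L) (hβ : 1 < β) :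
    ∃ a c : ℝ, 0 < a ∧ 0 < c ∧ ∀ h : ℝ, 0 < h → h ≤ 1 - ‖x₀‖ → ∀ (n : ℕ) (T : EstimatorAt n)
      (A₀ A₁ : ℝ), 0 ≤ A₀ → 0 ≤ A₁ → risk μ σ x₀ T 0 ≤ ENNReal.ofReal (A₀ ^ 2) →
      (∀ f ∈ smoothClass C L β, risk μ σ x₀ T f ≤ ENNReal.ofReal (A₁ ^ 2)) →
      a * h ^ (β - 1) ≤ A₁ + A₀ * Real.exp (c * (n * h ^ (2 * β + 1))) := by
  have hE := bumpEnergy_lt_top (β := β) (by linarith)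
  set E := (bumpEnergy β).toReal with hEdef
  have hE0 : 0 ≤ E := ENNReal.toReal_nonneg
  -- the three bounds: sup norm at most `L`, Radon transform at most `σ`, Sobolev energy at most `C`
  set a := min (min L (σ / (2 * Real.exp |μ|))) (Real.sqrt (C / (E + 1))) with ha
  have ha0 : 0 < a := by
    simp only [ha, lt_min_iff]
    exact ⟨⟨hL, by positivity⟩, Real.sqrt_pos.2 (by positivity)⟩
  have ha1 : a ≤ L := (min_le_left _ _).trans (min_le_left _ _)
  have ha2 : a ≤ σ / (2 * Real.exp |μ|) := (min_le_left _ _).trans (min_le_right _ _)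
  have ha3 : a ^ 2 ≤ C / (E + 1) := by
    rw [← Real.sq_sqrt (by positivity : 0 ≤ C / (E + 1))]
    exact pow_le_pow_left₀ ha0.le (min_le_right _ _) 2
  refine ⟨a, (2 * a * Real.exp |μ|) ^ 2 / σ ^ 2, ha0, by positivity, ?_⟩
  intro h hh hh1 n T A₀ A₁ hA₀ hA₁ h₀ h₁
  have hle1 : h ≤ 1 := by linarith [norm_nonneg x₀]
  have hd := isDiscFunction_alternative (x₀ := x₀) (β := β) (a := a) hh hh1
  have haC : ENNReal.ofReal (a ^ 2) * bumpEnergy β ≤ ENNReal.ofReal C := by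
    rw [← ENNReal.ofReal_toReal hE.ne, ← ENNReal.ofReal_mul (by positivity)]
    refine ENNReal.ofReal_le_ofReal ?_
    rw [le_div_iff₀ (by positivity)] at ha3
    nlinarith [sq_nonneg a]
  have hmem := alternative_mem_smoothClass (x₀ := x₀) (L := L) hβ ha0.le hh hh1 ha1 haC
  have hT : ∀ z, |expRadon μ (alternative x₀ β a h) z| ≤ σ := by
    intro z
    refine (abs_expRadon_alternative_le ha0.le hh hh1 z).trans
      ((indicator_le_self' (fun _ _ => by positivity) _).trans ?_)
    rw [le_div_iff₀ (by positivity)] at ha2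
    have := Real.rpow_le_one hh.le hle1 (by linarith : 0 ≤ β)
    calc 2 * a * Real.exp |μ| * h ^ β ≤ 2 * a * Real.exp |μ| * 1 := by gcongr
      _ ≤ σ := by linarith
  have key := apply_le_of_risk_le (x₀ := x₀) hσ hd hT
    (integral_expRadon_alternative_sq_le ha0.le hh hh1) T hA₀ hA₁ (h₁ _ hmem) h₀
  rw [alternative_apply] at key
  refine key.trans (le_of_eq ?_)
  congr 3
  ring

end

/-! ### Asymptotics of the trade-off -/

section

variable {μ σ C L β β' : ℝ} {x₀ : Plane}

lemma exists_risk_le_of_attainsRate {B : ℕ → Finset ℝ} {ρ : ℕ → ℝ → ℝ} {T : Estimator}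
    (hT : AttainsRate μ σ C L x₀ B ρ T) (hρ : ∀ᶠ n in atTop, ∀ β ∈ B n, 0 < ρ n β) :
    ∃ K : ℝ, 0 < K ∧ ∀ᶠ n in atTop, ∀ β ∈ B n, ∀ f ∈ smoothClass C L β,
      risk μ σ x₀ (T n) f ≤ ENNReal.ofReal (K * ρ n β ^ 2) := by
  obtain ⟨K, hK, -⟩ := ENNReal.lt_iff_exists_nnreal_btwn.1 hT
  refine ⟨K + 1, by positivity, ?_⟩
  filter_upwards [eventually_lt_of_limsup_lt hK, hρ] with n hn hρn β hβ f hf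
  have hpos : 0 < ρ n β ^ 2 := pow_pos (hρn β hβ) 2
  have h1 : ENNReal.ofReal ((ρ n β ^ 2)⁻¹) * risk μ σ x₀ (T n) f ≤ K :=
    (le_iSup₂_of_le (f := fun β _ => ⨆ f ∈ smoothClass C L β,
      ENNReal.ofReal ((ρ n β ^ 2)⁻¹) * risk μ σ x₀ (T n) f) β hβ
      (le_iSup₂_of_le f hf le_rfl)).trans hn.le
  calc risk μ σ x₀ (T n) f
      = ENNReal.ofReal (ρ n β ^ 2) *
          (ENNReal.ofReal ((ρ n β ^ 2)⁻¹) * risk μ σ x₀ (T n) f) := by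
        rw [← mul_assoc, ← ENNReal.ofReal_mul hpos.le, mul_inv_cancel₀ hpos.ne',
          ENNReal.ofReal_one, one_mul]
    _ ≤ ENNReal.ofReal (ρ n β ^ 2) * K := by gcongr
    _ = ENNReal.ofReal (ρ n β ^ 2) * ENNReal.ofReal K := by rw [ENNReal.ofReal_coe_nnreal]
    _ ≤ _ := by
        rw [← ENNReal.ofReal_mul hpos.le]
        exact ENNReal.ofReal_le_ofReal (by nlinarith)

lemma minimaxRate_pos {n : ℕ} (hn : 0 < n) (β : ℝ) : 0 < minimaxRate n β := by
  have : (0 : ℝ) < n := by exact_mod_cast hn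
  unfold minimaxRate
  positivity

lemma minimaxRate_div_logRate {n : ℕ} (hn : 3 ≤ n) (β : ℝ) :
    minimaxRate n β / logRate n β = Real.log n ^ (-((β - 1) / (2 * β + 1))) := by
  have hl := one_le_log_natCast hn
  have hn0 : (0 : ℝ) < n := by positivity
  rw [logRate_eq_rpow_neg hn, minimaxRate, ← Real.div_rpow hn0.le (by positivity), div_div_cancel₀]
  exact hn0.ne'

lemma exponent_pos (hβ : 1 < β) : 0 < (β - 1) / (2 * β + 1) :=
  div_pos (by linarith) (by linarith)

lemma exponent_mono (hβ : 1 < β) (h : β ≤ β') :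
    (β - 1) / (2 * β + 1) ≤ (β' - 1) / (2 * β' + 1) := by
  rw [div_le_div_iff₀ (by linarith) (by linarith)]
  nlinarith

lemma minimaxRate_div_logRate_le_one (hβ : 1 < β) {n : ℕ} (hn : 3 ≤ n) :
    minimaxRate n β / logRate n β ≤ 1 := by
  rw [minimaxRate_div_logRate hn]
  exact Real.rpow_le_one_of_one_le_of_nonpos (one_le_log_natCast hn)
    (by linarith [exponent_pos hβ])

lemma tendsto_log_natCast : Tendsto (fun n : ℕ => Real.log n) atTop atTop :=
  Real.tendsto_log_atTop.comp tendsto_natCast_atTop_atTop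

lemma tendsto_minimaxRate_div_logRate (hβ : 1 < β) :
    Tendsto (fun n => minimaxRate n β / logRate n β) atTop (𝓝 0) := by
  refine ((tendsto_rpow_neg_atTop (exponent_pos hβ)).comp tendsto_log_natCast).congr' ?_
  filter_upwards [eventually_ge_atTop 3] with n hn
  rw [minimaxRate_div_logRate hn]
  rfl

/-- A maximum risk of squared order `g` forces `g` to be at least of the order of the minimax
rate: the trade-off at the bandwidth `n^{-1/(2β+1)}`, at which the alternative cannot be told from
zero. -/
lemma eventually_minimaxRate_le (hσ : 0 < σ) (hC : 0 < C) (hL : 0 < L) (hx₀ : ‖x₀‖ < 1)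
    (hβ : 1 < β) {g : ℕ → ℝ} (hg : ∀ᶠ n in atTop, 0 < g n) {K : ℝ} (hK : 0 < K) {T : Estimator}
    (h : ∀ᶠ n in atTop, ∀ f ∈ smoothClass C L β,
      risk μ σ x₀ (T n) f ≤ ENNReal.ofReal (K * g n ^ 2)) :
    ∃ b : ℝ, 0 < b ∧ ∀ᶠ n in atTop, b * minimaxRate n β ≤ g n := by
  obtain ⟨a, c, ha, -, key⟩ := exists_tradeoff (μ := μ) (x₀ := x₀) hσ hC hL hβ
  have hp : 0 < 2 * β + 1 := by linarith
  have hK' := Real.sqrt_pos.2 hK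
  refine ⟨a / (Real.sqrt K * (1 + Real.exp c)), by positivity, ?_⟩
  have hlim : Tendsto (fun n : ℕ => (n : ℝ) ^ (-(1 / (2 * β + 1)))) atTop (𝓝 0) :=
    (tendsto_rpow_neg_atTop (by positivity)).comp tendsto_natCast_atTop_atTop
  filter_upwards [hg, h, eventually_gt_atTop 0,
    hlim.eventually_le_const (by linarith : 0 < 1 - ‖x₀‖)] with n hgn hn hn0 hle
  have hn0' : (0 : ℝ) < n := by exact_mod_cast hn0
  have hn' : ∀ f ∈ smoothClass C L β,
      risk μ σ x₀ (T n) f ≤ ENNReal.ofReal ((Real.sqrt K * g n) ^ 2) := by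
    rwa [mul_pow, Real.sq_sqrt hK.le]
  have h1 := key ((n : ℝ) ^ (-(1 / (2 * β + 1)))) (by positivity) hle n (T n) _ _
    (by positivity) (by positivity) (hn' 0 (zero_mem_smoothClass hL.le)) hn'
  rw [← Real.rpow_mul hn0'.le, ← Real.rpow_mul hn0'.le,
    show -(1 / (2 * β + 1)) * (2 * β + 1) = -1 by field_simp, Real.rpow_neg_one,
    mul_inv_cancel₀ hn0'.ne', mul_one,
    show -(1 / (2 * β + 1)) * (β - 1) = -((β - 1) / (2 * β + 1)) by ring] at h1
  rw [minimaxRate, div_mul_eq_mul_div, div_le_iff₀ (by positivity)]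
  linarith

/-- An estimator that beats `logRate` at `β` pays for it at the zero function: the trade-off at the
bandwidth `(κ log n / n)^{1/(2β+1)}`. -/
lemma eventually_logRate_le (hσ : 0 < σ) (hC : 0 < C) (hL : 0 < L) (hx₀ : ‖x₀‖ < 1)
    (hβ : 1 < β) {δ : ℝ} (hδ : 0 < δ) {g g₀ : ℕ → ℝ} (hg : ∀ᶠ n in atTop, 0 < g n)
    (hg₀ : ∀ᶠ n in atTop, 0 < g₀ n) {K : ℝ} (hK : 0 < K) {T : Estimator}
    (h : ∀ᶠ n in atTop, ∀ f ∈ smoothClass C L β,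
      risk μ σ x₀ (T n) f ≤ ENNReal.ofReal (K * g n ^ 2))
    (h₀ : ∀ᶠ n in atTop, risk μ σ x₀ (T n) 0 ≤ ENNReal.ofReal (K * g₀ n ^ 2))
    (hlim : Tendsto (fun n => g n / logRate n β) atTop (𝓝 0)) :
    ∃ b : ℝ, 0 < b ∧ ∀ᶠ n : ℕ in atTop, b * (logRate n β * (n : ℝ) ^ (-δ)) ≤ g₀ n := by
  obtain ⟨a, c, ha, hc, key⟩ := exists_tradeoff (μ := μ) (x₀ := x₀) hσ hC hL hβ
  have hp : 0 < 2 * β + 1 := by linarith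
  have hK' := Real.sqrt_pos.2 hK
  set κ := δ / c with hκ
  have hκ0 : 0 < κ := by positivity
  set m := a * κ ^ ((β - 1) / (2 * β + 1)) with hm
  have hm0 : 0 < m := by positivity
  refine ⟨m / (2 * Real.sqrt K), by positivity, ?_⟩
  have hlim1 : Tendsto (fun n : ℕ => (κ * (Real.log n / n)) ^ (1 / (2 * β + 1))) atTop (𝓝 0) := by
    have h1 : Tendsto (fun x : ℝ => Real.log x / x) atTop (𝓝 0) := by
      simpa using Real.isLittleO_log_id_atTop.tendsto_div_nhds_zero
    have h2 := ((h1.comp tendsto_natCast_atTop_atTop).const_mul κ).rpow_const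
      (p := 1 / (2 * β + 1)) (Or.inr (by positivity))
    rw [mul_zero, Real.zero_rpow (by positivity)] at h2
    exact h2
  filter_upwards [hg, hg₀, h, h₀, eventually_ge_atTop 3,
    hlim1.eventually_le_const (by linarith : 0 < 1 - ‖x₀‖),
    hlim.eventually_le_const (by positivity : 0 < m / (2 * Real.sqrt K))]
    with n hgn hg₀n hn h₀n hn3 hle hsmall
  have hl := one_le_log_natCast hn3
  have hn0 : (0 : ℝ) < n := by positivity
  have hψ := logRate_pos hn3 β
  have hy : 0 < κ * (Real.log n / n) := by positivity
  have h1 := key _ (Real.rpow_pos_of_pos hy _) hle n (T n) (Real.sqrt K * g₀ n)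
    (Real.sqrt K * g n) (by positivity) (by positivity)
    (by rwa [mul_pow, Real.sq_sqrt hK.le]) (by rwa [mul_pow, Real.sq_sqrt hK.le])
  rw [← Real.rpow_mul hy.le, ← Real.rpow_mul hy.le,
    show 1 / (2 * β + 1) * (2 * β + 1) = 1 by field_simp, Real.rpow_one,
    show 1 / (2 * β + 1) * (β - 1) = (β - 1) / (2 * β + 1) by ring,
    Real.mul_rpow hκ0.le (by positivity), ← mul_assoc, ← hm, ← logRate,
    show c * (n * (κ * (Real.log n / n))) = Real.log n * δ by rw [hκ]; field_simp,
    ← Real.rpow_def_of_pos hn0] at h1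
  rw [div_le_div_iff₀ hψ (by positivity)] at hsmall
  rw [Real.rpow_neg hn0.le, ← mul_assoc, ← div_eq_mul_inv, div_le_iff₀ (by positivity),
    div_mul_eq_mul_div, div_le_iff₀ (by positivity)]
  nlinarith

lemma tendsto_rpow_mul_log_rpow {δ : ℝ} (hδ : 0 < δ) (r : ℝ) :
    Tendsto (fun n : ℕ => (n : ℝ) ^ δ * Real.log n ^ (-r)) atTop atTop := by
  have h1 : Tendsto (fun n : ℕ => Real.log n ^ r / (n : ℝ) ^ δ) atTop (𝓝[>] 0) := by
    refine tendsto_nhdsWithin_iff.2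
      ⟨(isLittleO_log_rpow_rpow_atTop r hδ).tendsto_div_nhds_zero.comp tendsto_natCast_atTop_atTop,
        ?_⟩
    filter_upwards [eventually_ge_atTop 3] with n hn
    have := one_le_log_natCast hn
    have : (0 : ℝ) < n := by positivity
    exact mem_Ioi.2 (by positivity)
  refine h1.inv_tendsto_nhdsGT_zero.congr' ?_
  filter_upwards [eventually_ge_atTop 3] with n hn
  have := one_le_log_natCast hn
  rw [Pi.inv_apply, inv_div, Real.rpow_neg (by positivity), div_eq_mul_inv]

/-- Beating `logRate` at the smoothness `β` is paid for, with a divergent factor, at every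
smoothness beyond `β + 1`. -/
lemma tendsto_div_logRate_mul_div_logRate (hσ : 0 < σ) (hC : 0 < C) (hL : 0 < L) (hx₀ : ‖x₀‖ < 1)
    (hβ : 1 < β) {b : ℕ → ℝ} (hb : ∀ᶠ n in atTop, β + 1 ≤ b n) {g g₀ : ℕ → ℝ}
    (hg : ∀ᶠ n in atTop, 0 < g n) (hg₀ : ∀ᶠ n in atTop, 0 < g₀ n) {K : ℝ} (hK : 0 < K)
    {T : Estimator}
    (h : ∀ᶠ n in atTop, ∀ f ∈ smoothClass C L β,
      risk μ σ x₀ (T n) f ≤ ENNReal.ofReal (K * g n ^ 2))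
    (h₀ : ∀ᶠ n in atTop, risk μ σ x₀ (T n) 0 ≤ ENNReal.ofReal (K * g₀ n ^ 2))
    (hlim : Tendsto (fun n => g n / logRate n β) atTop (𝓝 0)) :
    Tendsto (fun n => g n / logRate n β * (g₀ n / logRate n (b n))) atTop atTop := by
  set e := (β - 1) / (2 * β + 1) with he
  set e₁ := (β + 1 - 1) / (2 * (β + 1) + 1) with he₁
  -- the gain of the smoothness `β + 1` over `β` in the exponent of the rate
  set η := e₁ - e with hη
  have hη0 : 0 < η := by
    rw [hη, sub_pos, he, he₁, div_lt_div_iff₀ (by linarith) (by linarith)]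
    nlinarith
  obtain ⟨c₁, hc₁, H₁⟩ := eventually_minimaxRate_le hσ hC hL hx₀ hβ hg hK h
  obtain ⟨c₂, hc₂, H₂⟩ := eventually_logRate_le hσ hC hL hx₀ hβ (half_pos hη0) hg hg₀ hK h h₀ hlim
  refine tendsto_atTop_mono' _ ?_
    ((tendsto_rpow_mul_log_rpow (half_pos hη0) e₁).const_mul_atTop (mul_pos hc₁ hc₂))
  filter_upwards [H₁, H₂, hb, eventually_ge_atTop 3] with n h1 h2 hbn hn
  have hl := one_le_log_natCast hn
  have hn0 : (0 : ℝ) < n := by positivity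
  have hψ := logRate_pos hn β
  have hψb := logRate_pos hn (b n)
  have hφ := minimaxRate_pos (by omega : 0 < n) β
  have hy := one_le_div_log hn
  have h3 : ((n : ℝ) / Real.log n) ^ e₁ ≤ (logRate n (b n))⁻¹ := by
    rw [logRate_eq_rpow_neg hn, Real.rpow_neg (by positivity), inv_inv]
    exact Real.rpow_le_rpow_of_exponent_le hy (exponent_mono (by linarith) hbn)
  have h4 : (n : ℝ) ^ (η / 2) * Real.log n ^ (-e₁) =
      minimaxRate n β * (n : ℝ) ^ (-(η / 2)) * ((n : ℝ) / Real.log n) ^ e₁ := by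
    rw [minimaxRate, ← Real.rpow_add hn0, Real.div_rpow hn0.le (by positivity),
      Real.rpow_neg (x := Real.log n) (by positivity), div_eq_mul_inv (_ ^ e₁), ← mul_assoc,
      ← Real.rpow_add hn0]
    congr 2
    rw [← he, hη]; ring
  calc c₁ * c₂ * ((n : ℝ) ^ (η / 2) * Real.log n ^ (-e₁))
      = (c₁ * minimaxRate n β) * (c₂ * (n : ℝ) ^ (-(η / 2))) * ((n : ℝ) / Real.log n) ^ e₁ := by
        rw [h4]; ring
    _ ≤ (c₁ * minimaxRate n β) * (c₂ * (n : ℝ) ^ (-(η / 2))) * (logRate n (b n))⁻¹ := by gcongr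
    _ = (c₁ * minimaxRate n β) / logRate n β *
          (c₂ * (logRate n β * (n : ℝ) ^ (-(η / 2))) / logRate n (b n)) := by field_simp
    _ ≤ g n / logRate n β * (g₀ n / logRate n (b n)) := by
        have : 0 < g n := (mul_pos hc₁ hφ).trans_le h1
        gcongr

/-- The minimax rates cannot be attained simultaneously at a smoothness `β` and beyond `β + 1`: the
rate at `β` beats `logRate` by a power of `log n`, and `minimaxRate ≤ logRate` everywhere. -/
lemma not_minimaxRate_pair (hσ : 0 < σ) (hC : 0 < C) (hL : 0 < L) (hx₀ : ‖x₀‖ < 1)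
    (hβ : 1 < β) {b : ℕ → ℝ} (hb : ∀ᶠ n in atTop, β + 1 ≤ b n) {K : ℝ} (hK : 0 < K)
    {T : Estimator}
    (h : ∀ᶠ n in atTop, ∀ f ∈ smoothClass C L β,
      risk μ σ x₀ (T n) f ≤ ENNReal.ofReal (K * minimaxRate n β ^ 2))
    (h₀ : ∀ᶠ n in atTop, risk μ σ x₀ (T n) 0 ≤ ENNReal.ofReal (K * minimaxRate n (b n) ^ 2)) :
    False := by
  have hpos : ∀ᶠ n : ℕ in atTop, 0 < n := eventually_gt_atTop 0
  have key := tendsto_div_logRate_mul_div_logRate hσ hC hL hx₀ hβ hb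
    (hpos.mono fun n hn => minimaxRate_pos hn β) (hpos.mono fun n hn => minimaxRate_pos hn (b n))
    hK h h₀ (tendsto_minimaxRate_div_logRate hβ)
  obtain ⟨n, hn, hbn, hn3⟩ := ((key.eventually_gt_atTop 1).and
    (hb.and (eventually_ge_atTop 3))).exists
  refine hn.not_ge (mul_le_one₀ (minimaxRate_div_logRate_le_one hβ hn3) ?_
    (minimaxRate_div_logRate_le_one (by linarith) hn3))
  exact (div_pos (minimaxRate_pos (by omega) _) (logRate_pos hn3 _)).le

/-- A minimax optimal estimator attains the rate `minimaxRate`, by the upper bound for the minimax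
risk. -/
lemma exists_risk_le_of_isMinimaxOptimal (hx₀ : ‖x₀‖ ≤ 1) (hC : 0 ≤ C) (hβ : 1 < β)
    {T : Estimator} (hT : IsMinimaxOptimal μ σ x₀ (smoothClass C L β) T) :
    ∃ K : ℝ, 0 < K ∧ ∀ᶠ n in atTop, ∀ f ∈ smoothClass C L β,
      risk μ σ x₀ (T n) f ≤ ENNReal.ofReal (K * minimaxRate n β ^ 2) := by
  obtain ⟨Ψ, -, -, C₁, C₂, hC₁, hC₂, hev⟩ := hT
  obtain ⟨K, hK, hmm⟩ := minimaxRisk_le (μ := μ) (σ := σ) (L := L) hx₀ hC hβ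
  refine ⟨C₂ * K / C₁, by positivity, ?_⟩
  filter_upwards [hev, eventually_gt_atTop 0] with n hn hn0 f hf
  refine (le_iSup₂_of_le f hf le_rfl).trans (hn.2.trans (ENNReal.ofReal_le_ofReal ?_))
  have h1 := (ENNReal.ofReal_le_ofReal_iff (by positivity)).1 (hn.1.trans (hmm n hn0))
  rw [div_mul_eq_mul_div, le_div_iff₀ hC₁]
  nlinarith

/-- The lower bound half of the adaptive rate of convergence. The losing smoothness `β''` is any
point of the grids beyond `β' + 1`: a fixed one for persistent grids, the largest one otherwise.
-/
lemma exists_tendsto_div_logRate {β₁ : ℝ} {B : ℕ → Finset ℝ} {top : ℕ → ℝ}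
    (hσ : 0 < σ) (hC : 0 < C) (hL : 0 < L) (hx₀ : ‖x₀‖ < 1) (hβ₁ : 1 < β₁)
    (hmin : ∀ n, IsLeast (B n : Set ℝ) β₁) (hmax : ∀ n, IsGreatest (B n : Set ℝ) (top n))
    (htop : Tendsto top atTop atTop) {γ : ℕ → ℝ → ℝ} {T : Estimator}
    (hγ : ∀ n, ∀ β ∈ B n, 0 < γ n β) (hT : AttainsRate μ σ C L x₀ B γ T)
    (hβ' : ∀ᶠ n in atTop, β' ∈ B n)
    (hlim : Tendsto (fun n => γ n β' / logRate n β') atTop (𝓝 0)) :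
    ∃ β'' : ℕ → ℝ, (∀ᶠ n in atTop, β'' n ∈ B n) ∧
      (IsPersistent B → ∃ b, ∀ n, β'' n = b) ∧
      Tendsto (fun n => γ n β' / logRate n β' * (γ n (β'' n) / logRate n (β'' n)))
        atTop atTop := by
  obtain ⟨n₀, hn₀⟩ := hβ'.exists
  have hβ'1 : 1 < β' := hβ₁.trans_le ((hmin n₀).2 hn₀)
  obtain ⟨K, hK, hrisk⟩ := exists_risk_le_of_attainsRate hT (.of_forall hγ)
  obtain ⟨β'', hmem, hge, hconst⟩ : ∃ β'' : ℕ → ℝ, (∀ᶠ n in atTop, β'' n ∈ B n) ∧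
      (∀ᶠ n in atTop, β' + 1 ≤ β'' n) ∧ (IsPersistent B → ∃ b, ∀ n, β'' n = b) := by
    by_cases hB : IsPersistent B
    · obtain ⟨m, hm⟩ := (htop.eventually_ge_atTop (β' + 1)).exists
      exact ⟨fun _ => top m, hB m _ (hmax m).1, .of_forall fun _ => hm,
        fun _ => ⟨top m, fun _ => rfl⟩⟩
    · exact ⟨top, .of_forall fun n => (hmax n).1, htop.eventually_ge_atTop _,
        fun h => absurd h hB⟩
  refine ⟨β'', hmem, hconst, tendsto_div_logRate_mul_div_logRate (μ := μ) hσ hC hL hx₀ hβ'1 hge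
    ?_ ?_ hK (T := T) ?_ ?_ hlim⟩
  · filter_upwards [hβ'] with n hn using hγ n _ hn
  · filter_upwards [hmem] with n hn using hγ n _ hn
  · filter_upwards [hβ', hrisk] with n hn hr using hr _ hn
  · filter_upwards [hmem, hrisk] with n hn hr using hr _ hn 0 (zero_mem_smoothClass hL.le)

end

end ERT

end

theorem theorem4 (μ σ C L β₁ : ℝ) (x₀ : ERT.Plane) (B : ℕ → Finset ℝ) (top : ℕ → ℝ)
    (hσ : 0 < σ) (hC : 0 < C) (hL : 0 < L) (hx₀ : ‖x₀‖ < 1) (hβ₁ : 1 < β₁)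
    (hmin : ∀ n, IsLeast (B n : Set ℝ) β₁)
    (hmax : ∀ n, IsGreatest (B n : Set ℝ) (top n))
    (htop : Tendsto top atTop atTop) :
    (¬ ∃ T : ERT.Estimator, ERT.AttainsRate μ σ C L x₀ B ERT.minimaxRate T) ∧
    (ERT.IsPersistent B → ¬ ∃ T : ERT.Estimator, ∀ m, ∀ β ∈ B m,
      ERT.IsMinimaxOptimal μ σ x₀ (ERT.smoothClass C L β) T) ∧
    ERT.IsAdaptiveRate μ σ C L x₀ B ERT.logRate := by
  refine ⟨?_, ?_, ⟨_, ERT.attainsRate_adaptiveEst hx₀.le hC.le hβ₁ fun n β hβ => (hmin n).2 hβ⟩, ?_⟩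
  · rintro ⟨T, hT⟩
    obtain ⟨K, hK, hrisk⟩ := ERT.exists_risk_le_of_attainsRate hT
      ((eventually_gt_atTop 0).mono fun n hn β _ => ERT.minimaxRate_pos hn β)
    refine ERT.not_minimaxRate_pair (μ := μ) hσ hC hL hx₀ hβ₁ (htop.eventually_ge_atTop (β₁ + 1)) hK
      (T := T) ?_ ?_
    · exact hrisk.mono fun n hr => hr _ (hmin n).1
    · exact hrisk.mono fun n hr => hr _ (hmax n).1 0 (ERT.zero_mem_smoothClass hL.le)
  · rintro - ⟨T, hT⟩
    obtain ⟨m, hm⟩ := (htop.eventually_ge_atTop (β₁ + 1)).exists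
    obtain ⟨K₁, hK₁, h₁⟩ := ERT.exists_risk_le_of_isMinimaxOptimal hx₀.le hC.le hβ₁
      (hT m β₁ (hmin m).1)
    obtain ⟨K₂, hK₂, h₂⟩ := ERT.exists_risk_le_of_isMinimaxOptimal hx₀.le hC.le
      (by linarith : 1 < top m) (hT m (top m) (hmax m).1)
    refine ERT.not_minimaxRate_pair (μ := μ) hσ hC hL hx₀ hβ₁ (b := fun _ => top m)
      (.of_forall fun _ => hm) (lt_max_of_lt_left hK₁ : 0 < max K₁ K₂) (T := T) ?_ ?_
    · refine h₁.mono fun n hr f hf => (hr f hf).trans (ENNReal.ofReal_le_ofReal ?_)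
      gcongr
      exact le_max_left _ _
    · refine h₂.mono fun n hr => (hr 0 (ERT.zero_mem_smoothClass hL.le)).trans
        (ENNReal.ofReal_le_ofReal ?_)
      gcongr
      exact le_max_right _ _
  · intro γ T hγ hT β' hβ' hlim
    exact ERT.exists_tendsto_div_logRate hσ hC hL hx₀ hβ₁ hmin hmax htop hγ hT hβ' hlim
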